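/- Let $\mathfrak S$ be any one of the following three categories: $C^\infty$-manifolds (ground field $\Bbbk=\mathbb R$), complex analytic manifolds ($\Bbbk=\mathbb C$), or smooth schemes of finite type over $\mathbb C$ ($\Bbbk=\mathbb C$). All spaces, maps, vector fields and differential forms below are taken in $\mathfrak S$, and a submersion is a morphism whose differential is surjective at every point. Let $\mathbb X=[X_1\rightrightarrows X_0]$ be a Lie groupoid, that is, a groupoid internal to $\mathfrak S$, with source $s$, target $t$, identity section $e$ and multiplication $m$, such that $s$ is a submersion. Suppose that $\mathbb X$ carries a flat connection: a subbundle $\mathcal H\subset TX_1$, closed under the Lie bracket of vector fields, with $TX_1=\mathcal H\oplus\ker(ds)$, with $de(T_xX_0)=\mathcal H_{e(x)}$ for all $x\in X_0$, and with $\theta_{m(z,y)}=\theta_z\circ\theta_y$ whenever $s(z)=t(y)$, where $\theta_y=dt\circ(ds|_{\mathcal H_y})^{-1}:T_{s(y)}X_0\to T_{t(y)}X_0$. For a form $\eta$ on $X_1$ let $\mathcal H(\eta)$ be its composition with the projection of $TX_1$ onto $\mathcal H$ along $\ker(ds)$. A differential $j$-form on $\mathbb X$ is a differential $j$-form $\omega$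 on $X_0$ with $\mathcal H(s^*\omega)=\mathcal H(t^*\omega)$; it is closed if $d\omega=0$. Let $G$ be a Lie group in $\mathfrak S$ (a group object) with Lie algebra $\mathfrak g$. Let $E_G$ be a principal $G$-bundle over $\mathbb X$: a principal right $G$-bundle $\pi:E_G\to X_0$ with a left action $(\gamma,p)\mapsto\gamma\cdot p$ of $\mathbb X$, defined on $s^*E_G=X_1\times_{s,X_0,\pi}E_G$ and commuting with the action of $G$. Let $D$ be a connection on it: a splitting of the Atiyah sequence $0\to \mathrm{ad}(E_G)\to \mathrm{At}(E_G)=(TE_G)/G\to TX_0\to 0$, such that the corresponding $G$-equivariant $\mathfrak g$-valued connection $1$-form on $E_G$ has the same pullback to $s^*E_G$ under $(\gamma,p)\mapsto p$ and under $(\gamma,p)\mapsto\gamma\cdot p$. Then there is a unique $\mathrm{ad}(E_G)$-valued $2$-form $K(D)$ on $X_0$, the curvature of $D$, with $$K(D)(V,W)=[DV,DW]-D[V,W]$$ for all local vector fields $V,W$ on $X_0$. Theorem. For every $k\ge 0$ and every $\nu\in(\mathrm{Sym}^k(\mathfrak g^*))^G$, regarded as a symmetric $k$-linear form on $\mathfrak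 g$ invariant under the adjoint action, the evaluation $\nu(K(D))$, given at $x\in X_0$ by $$\nu(K(D))(v_1,\dots,v_{2k})=\frac1{2^k}\sum_{\tau\in S_{2k}}\operatorname{sgn}(\tau)\,\nu\bigl(K_p(v_{\tau(1)},v_{\tau(2)}),\dots,K_p(v_{\tau(2k-1)},v_{\tau(2k)})\bigr),$$ where $K_p$ is $K(D)$ at $x$ written in $\mathfrak g$ by means of any point $p\in E_G$ over $x$, does not depend on $p$ and is a closed differential $2k$-form on the Lie groupoid $\mathbb X$. -/

import Mathlib

open scoped Topology

universe u

/-! ## Spaces with a sheaf of functions -/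

/-- A topological space with a sheaf of `𝕜`-valued functions.  The sheaf is recorded by saying which
functions are regular (smooth, holomorphic, algebraic) at a point, that is, on a neighbourhood of it;
only the germ at the point matters, so functions may be taken to be defined everywhere. The sections
over an open set `U` are the functions which are regular at every point of `U`. -/
structure FunctionSpace (𝕜 : Type) [Field 𝕜] where
  Pt : Type u
  [top : TopologicalSpace Pt]
  /-- The functions which are regular on a neighbourhood of a point. -/
  regAt : Pt → Subalgebra 𝕜 (Pt → 𝕜)
  regAt_congr : ∀ {x : Pt} {f g : Pt → 𝕜}, f ∈ regAt x → f =ᶠ[𝓝 x] g → g ∈ regAt x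
  regAt_nhds : ∀ {x : Pt} {f : Pt → 𝕜}, f ∈ regAt x → ∀ᶠ y in 𝓝 x, f ∈ regAt y

attribute [instance] FunctionSpace.top

namespace FunctionSpace

/-! ## The three categories of smooth spaces

No separation or countability axiom and no quasi-compactness is imposed: Hausdorff second countable
manifolds and schemes of finite type are included, and so are the more general ones. The dimension
may vary from one connected component to another. -/

/-- A `C^∞`-manifold: locally isomorphic to an open subset of some `ℝⁿ` with the sheaf of
`C^∞` functions. -/
def IsSmoothManifold (X : FunctionSpace.{u} ℝ) : Prop :=
  ∀ x : X.Pt, ∃ (n : ℕ) (e : OpenPartialHomeomorph X.Pt (Fin n → ℝ)), x ∈ e.source ∧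
    ∀ y ∈ e.source, ∀ f : X.Pt → ℝ,
      f ∈ X.regAt y ↔
        ∀ᶠ z in 𝓝 (e y), ContDiffAt ℝ ((⊤ : ℕ∞) : WithTop ℕ∞) (fun w => f (e.symm w)) z

/-- A complex analytic manifold: locally isomorphic to an open subset of some `ℂⁿ` with the sheaf
of holomorphic functions. -/
def IsComplexManifold (X : FunctionSpace.{u} ℂ) : Prop :=
  ∀ x : X.Pt, ∃ (n : ℕ) (e : OpenPartialHomeomorph X.Pt (Fin n → ℂ)), x ∈ e.source ∧
    ∀ y ∈ e.source, ∀ f : X.Pt → ℂ,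
      f ∈ X.regAt y ↔ AnalyticAt ℂ (fun w => f (e.symm w)) (e y)

/-- The closed points of `Spec A`, for a `ℂ`-algebra `A` of finite type; by the Nullstellensatz they are
the `ℂ`-algebra homomorphisms `A → ℂ`. -/
def MaxSpec (A : Type) [CommRing A] [Algebra ℂ A] : Type := A →ₐ[ℂ] ℂ

/-- The evaluation of elements of `A` at a closed point of `Spec A`. -/
def MaxSpec.eval {A : Type} [CommRing A] [Algebra ℂ A] (p : MaxSpec A) : A →ₐ[ℂ] ℂ := p

/-- The Zariski topology. -/
instance (A : Type) [CommRing A] [Algebra ℂ A] : TopologicalSpace (MaxSpec A) :=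
  TopologicalSpace.generateFrom {U | ∃ a : A, U = {p | p.eval a ≠ 0}}

/-- A smooth scheme over `ℂ`, presented by its closed points with the Zariski topology and the sheaf
of regular functions: locally isomorphic to an open subset of the space of closed points of
`Spec A`, for a smooth `ℂ`-algebra `A` (of finite presentation), with functions locally of the form
`a / b`, where `a, b ∈ A`. A smooth scheme over `ℂ` is reduced and locally of finite type, so it is
determined by this space, and the morphisms are the same. -/
def IsSmoothScheme (X : FunctionSpace.{u} ℂ) : Prop :=
  ∀ x : X.Pt, ∃ (A : Type) (_ : CommRing A) (_ : Algebra ℂ A) (_ : Algebra.Smooth ℂ A)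
    (e : OpenPartialHomeomorph X.Pt (MaxSpec A)), x ∈ e.source ∧
    ∀ y ∈ e.source, ∀ f : X.Pt → ℂ,
      f ∈ X.regAt y ↔ ∃ a b : A, (e y).eval b ≠ 0 ∧
        ∀ᶠ z in 𝓝 y, f z = (e z).eval a / (e z).eval b

/-- The three categories of smooth spaces, each given by its ground field and its objects. The
morphisms are those of `FunctionSpace.IsMorphism`. -/
inductive SmoothCategory : (𝕜 : Type) → [Field 𝕜] → (FunctionSpace.{u} 𝕜 → Prop) → Prop
  | smooth : SmoothCategory ℝ IsSmoothManifold
  | analytic : SmoothCategory ℂ IsComplexManifold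
  | algebraic : SmoothCategory ℂ IsSmoothScheme

variable {𝕜 : Type} [Field 𝕜]

/-! ## Morphisms, tangent vectors, vector fields -/

/-- A morphism: a continuous map which pulls regular functions back to regular functions. -/
def IsMorphism (X Y : FunctionSpace.{u} 𝕜) (φ : X.Pt → Y.Pt) : Prop :=
  Continuous φ ∧ ∀ (x : X.Pt) (f : Y.Pt → 𝕜), f ∈ Y.regAt (φ x) → f ∘ φ ∈ X.regAt x

/-- The point derivations at `x` of the regular functions. -/
def tangentSubmodule (X : FunctionSpace.{u} 𝕜) (x : X.Pt) :
    Submodule 𝕜 (Module.Dual 𝕜 (X.regAt x)) where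
  carrier := {v | ∀ f g : X.regAt x, v (f * g) = f.1 x * v g + g.1 x * v f}
  add_mem' := by
    intro v w hv hw f g
    simp only [LinearMap.add_apply, hv f g, hw f g]
    ring
  zero_mem' := by intro f g; simp
  smul_mem' := by
    intro c v hv f g
    simp only [LinearMap.smul_apply, hv f g, smul_eq_mul]
    ring

/-- The tangent space at `x`. -/
abbrev Tangent (X : FunctionSpace.{u} 𝕜) (x : X.Pt) : Type u := X.tangentSubmodule x

open Classical in
/-- The differential `df` of a function at `x`, as a linear form on the tangent space (`0` by
convention if `f` is not regular at `x`). -/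
noncomputable def d (X : FunctionSpace.{u} 𝕜) (f : X.Pt → 𝕜) (x : X.Pt) :
    X.Tangent x →ₗ[𝕜] 𝕜 :=
  if h : f ∈ X.regAt x then
    { toFun := fun v => v.1 ⟨f, h⟩
      map_add' := fun _ _ => rfl
      map_smul' := fun _ _ => rfl }
  else 0

/-- Precomposition with `φ`, as a map of germs of regular functions from `y` to `x`. -/
def pullbackGerm {X Y : FunctionSpace.{u} 𝕜} (φ : X.Pt → Y.Pt) (x : X.Pt) (y : Y.Pt)
    (h : ∀ f ∈ Y.regAt y, f ∘ φ ∈ X.regAt x) : Y.regAt y →ₗ[𝕜] X.regAt x where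
  toFun f := ⟨f.1 ∘ φ, h f.1 f.2⟩
  map_add' _ _ := rfl
  map_smul' _ _ := rfl

open Classical in
/-- The differential `T_x X → T_y Y` at `x` of a morphism `φ : X → Y` with `φ x = y`, given by
`(dφ v) f = v (f ∘ φ)` (`0` by convention if `φ` is not a morphism near `x` or `φ x ≠ y`). -/
noncomputable def differential {X Y : FunctionSpace.{u} 𝕜} (φ : X.Pt → Y.Pt) (x : X.Pt) (y : Y.Pt) :
    X.Tangent x →ₗ[𝕜] Y.Tangent y :=
  if h : φ x = y ∧ ∀ f ∈ Y.regAt y, f ∘ φ ∈ X.regAt x then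
    { toFun := fun v => ⟨v.1 ∘ₗ pullbackGerm φ x y h.2, by
        intro f g
        have := v.2 (pullbackGerm φ x y h.2 f) (pullbackGerm φ x y h.2 g)
        have h1 := h.1
        subst h1
        exact this⟩
      map_add' := fun _ _ => rfl
      map_smul' := fun _ _ => rfl }
  else 0

/-- The differential is surjective at every point. -/
def IsSubmersion (X Y : FunctionSpace.{u} 𝕜) (φ : X.Pt → Y.Pt) : Prop :=
  IsMorphism X Y φ ∧ ∀ x, Function.Surjective (differential (X := X) (Y := Y) φ x (φ x))

/-- A family of tangent vectors. -/
abbrev VectorField (X : FunctionSpace.{u} 𝕜) : Type u := ∀ x : X.Pt, X.Tangent x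

/-- A regular vector field on a neighbourhood of `x`. -/
def VectorField.RegAt {X : FunctionSpace.{u} 𝕜} (V : X.VectorField) (x : X.Pt) : Prop :=
  ∀ᶠ y in 𝓝 x, ∀ f ∈ X.regAt y, (fun z => X.d f z (V z)) ∈ X.regAt y

/-- The Lie bracket at `x` of two vector fields which are regular near `x`: the tangent vector
`f ↦ V_x (W f) - W_x (V f)`. -/
noncomputable def lieBracket {X : FunctionSpace.{u} 𝕜} (V W : X.VectorField) : X.VectorField :=
  fun x => Classical.epsilon fun u : X.Tangent x => ∀ f ∈ X.regAt x,
    X.d f x u = X.d (fun y => X.d f y (W y)) x (V x) - X.d (fun y => X.d f y (V y)) x (W x)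

/-- A map `F` defined on the points of `X ×_Z Y` is a morphism `X ×_Z Y → W`: it induces
a map on `T`-valued points, for each smooth space `T`. (By Yoneda's lemma this is the same as
being a morphism from the fibre product, whenever the fibre product exists in the category; it does
if `φ` or `ψ` is a submersion.) -/
def IsMorphismOnFiberProduct (C : FunctionSpace.{u} 𝕜 → Prop) {X Y Z W : FunctionSpace.{u} 𝕜}
    (φ : X.Pt → Z.Pt) (ψ : Y.Pt → Z.Pt) (F : ∀ x y, φ x = ψ y → W.Pt) : Prop :=
  ∀ T : FunctionSpace.{u} 𝕜, C T → ∀ (a : T.Pt → X.Pt) (b : T.Pt → Y.Pt),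
    IsMorphism T X a → IsMorphism T Y b → ∀ h : ∀ τ, φ (a τ) = ψ (b τ),
      IsMorphism T W fun τ => F (a τ) (b τ) (h τ)

/-- The same for a product `X × Y`. -/
def IsMorphismOnProduct (C : FunctionSpace.{u} 𝕜 → Prop) {X Y W : FunctionSpace.{u} 𝕜}
    (F : X.Pt → Y.Pt → W.Pt) : Prop :=
  ∀ T : FunctionSpace.{u} 𝕜, C T → ∀ (a : T.Pt → X.Pt) (b : T.Pt → Y.Pt),
    IsMorphism T X a → IsMorphism T Y b → IsMorphism T W fun τ => F (a τ) (b τ)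

/-! ## Differential forms -/

/-- A family of functions of `j` tangent vectors; the differential forms are those satisfying
`IsRegularForm`, which makes them alternating and multilinear. -/
abbrev FormField (X : FunctionSpace.{u} 𝕜) (j : ℕ) : Type u :=
  ∀ x : X.Pt, (Fin j → X.Tangent x) → 𝕜

/-- `dg₁ ∧ … ∧ dg_j`. -/
noncomputable def dWedge (X : FunctionSpace.{u} 𝕜) {j : ℕ} (g : Fin j → X.Pt → 𝕜) :
    X.FormField j :=
  fun x v => Matrix.det (Matrix.of fun a b => X.d (g b) x (v a))

/-- `ω = ∑ᵢ fᵢ dgᵢ₁ ∧ … ∧ dgᵢⱼ` on a neighbourhood of `x`, with regular `fᵢ` and `gᵢₐ`. -/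
def Represents {X : FunctionSpace.{u} 𝕜} {j : ℕ} (ω : X.FormField j) (x : X.Pt) {N : ℕ}
    (f : Fin N → X.Pt → 𝕜) (g : Fin N → Fin j → X.Pt → 𝕜) : Prop :=
  (∀ i, f i ∈ X.regAt x) ∧ (∀ i a, g i a ∈ X.regAt x) ∧
    ∀ᶠ y in 𝓝 x, ∀ v, ω y v = ∑ i, f i y * X.dWedge (g i) y v

/-- A differential `j`-form, that is, a section of `⋀^j T^*X`: locally a finite sum of expressions
`f dg₁ ∧ … ∧ dg_j` in regular functions. -/
def IsRegularForm {X : FunctionSpace.{u} 𝕜} {j : ℕ} (ω : X.FormField j) : Prop :=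
  ∀ x, ∃ (N : ℕ) (f : Fin N → X.Pt → 𝕜) (g : Fin N → Fin j → X.Pt → 𝕜), Represents ω x f g

/-- `η` is the exterior derivative of `ω`: if `ω = ∑ᵢ fᵢ dgᵢ₁ ∧ … ∧ dgᵢⱼ` near `x`, then
`η = ∑ᵢ dfᵢ ∧ dgᵢ₁ ∧ … ∧ dgᵢⱼ` at `x`. -/
def IsExteriorDerivative {X : FunctionSpace.{u} 𝕜} {j : ℕ} (ω : X.FormField j)
    (η : X.FormField (j + 1)) : Prop :=
  ∀ (x : X.Pt) (N : ℕ) (f : Fin N → X.Pt → 𝕜) (g : Fin N → Fin j → X.Pt → 𝕜),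
    Represents ω x f g → ∀ v, η x v = ∑ i, X.dWedge (Fin.cons (f i) (g i)) x v

/-- A closed differential form. -/
def IsClosedForm {X : FunctionSpace.{u} 𝕜} {j : ℕ} (ω : X.FormField j) : Prop :=
  IsRegularForm ω ∧ IsExteriorDerivative ω fun _ _ => 0

/-- The pullback of a form along a morphism. -/
noncomputable def pullback {X Y : FunctionSpace.{u} 𝕜} {j : ℕ} (φ : X.Pt → Y.Pt)
    (ω : Y.FormField j) : X.FormField j :=
  fun x v => ω (φ x) fun i => differential φ x (φ x) (v i)

/-! ## Lie groups -/

/-- A Lie group: a group object in the category `C`. -/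
structure IsLieGroup (C : FunctionSpace.{u} 𝕜 → Prop) (G : FunctionSpace.{u} 𝕜) [Group G.Pt] :
    Prop where
  mem : C G
  mul : IsMorphismOnProduct C (X := G) (Y := G) (W := G) fun g h => g * h
  inv : IsMorphism G G fun g => g⁻¹

/-- The Lie algebra `𝔤 = T_1 G` (only its underlying vector space and the adjoint action are
needed). -/
abbrev LieAlg (G : FunctionSpace.{u} 𝕜) [Group G.Pt] : Type u := G.Tangent 1

/-- The adjoint action of `G` on `𝔤`. -/
noncomputable def Ad (G : FunctionSpace.{u} 𝕜) [Group G.Pt] (g : G.Pt) : G.LieAlg →ₗ[𝕜] G.LieAlg :=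
  differential (fun h => g * h * g⁻¹) 1 1

end FunctionSpace

open FunctionSpace

variable {𝕜 : Type} [Field 𝕜]

/-! ## Lie groupoids and their connections -/

/-- A Lie groupoid `[X₁ ⇉ X₀]` in the category `C`. -/
structure LieGroupoid (C : FunctionSpace.{u} 𝕜 → Prop) (X₀ X₁ : FunctionSpace.{u} 𝕜) where
  mem_objects : C X₀
  mem_arrows : C X₁
  /-- source -/
  s : X₁.Pt → X₀.Pt
  /-- target -/
  t : X₁.Pt → X₀.Pt
  /-- identity section -/
  e : X₀.Pt → X₁.Pt
  /-- inversion -/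
  i : X₁.Pt → X₁.Pt
  /-- multiplication `X₁ ×_{s, X₀, t} X₁ → X₁` -/
  m : ∀ z y : X₁.Pt, s z = t y → X₁.Pt
  s_e : ∀ x, s (e x) = x
  t_e : ∀ x, t (e x) = x
  s_i : ∀ y, s (i y) = t y
  t_i : ∀ y, t (i y) = s y
  s_m : ∀ z y h, s (m z y h) = s y
  t_m : ∀ z y h, t (m z y h) = t z
  assoc : ∀ w z y (h : s w = t z) (h' : s z = t y),
    m (m w z h) y ((s_m w z h).trans h') = m w (m z y h') (h.trans (t_m z y h').symm)
  e_m : ∀ y, m (e (t y)) y (s_e (t y)) = y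
  m_e : ∀ y, m y (e (s y)) (t_e (s y)).symm = y
  i_m : ∀ y, m (i y) y (s_i y) = e (s y)
  m_i : ∀ y, m y (i y) (t_i y).symm = e (t y)
  submersion_s : IsSubmersion X₁ X₀ s
  morphism_t : IsMorphism X₁ X₀ t
  morphism_e : IsMorphism X₀ X₁ e
  morphism_i : IsMorphism X₁ X₁ i
  morphism_m : IsMorphismOnFiberProduct C (X := X₁) (Y := X₁) (Z := X₀) (W := X₁) s t m

variable {C : FunctionSpace.{u} 𝕜 → Prop} {X₀ X₁ : FunctionSpace.{u} 𝕜}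

namespace LieGroupoid

/-- The subspace `𝒦_y = ker (ds)_y` of `T_y X₁`. -/
noncomputable def kerS (𝒳 : LieGroupoid C X₀ X₁) (y : X₁.Pt) : Submodule 𝕜 (X₁.Tangent y) :=
  LinearMap.ker (differential (X := X₁) (Y := X₀) 𝒳.s y (𝒳.s y))

/-- The map `θ_y : T_a X₀ → T_b X₀` of a complement `ℋ` of `ker ds`, where `a = s y` and `b = t y`:
the horizontal lift at `y` followed by `dt`. -/
noncomputable def theta (𝒳 : LieGroupoid C X₀ X₁) (ℋ : ∀ y : X₁.Pt, Submodule 𝕜 (X₁.Tangent y))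
    (y : X₁.Pt) (a b : X₀.Pt) (u : X₀.Tangent a) : X₀.Tangent b :=
  differential 𝒳.t y b
    (Classical.epsilon fun w : X₁.Tangent y => w ∈ ℋ y ∧ differential 𝒳.s y a w = u)

/-- A connection on a Lie groupoid. -/
structure Connection (𝒳 : LieGroupoid C X₀ X₁) where
  /-- the distribution `ℋ ⊂ TX₁` -/
  hor : ∀ y : X₁.Pt, Submodule 𝕜 (X₁.Tangent y)
  /-- `ℋ` is a subbundle: it has local frames. -/
  subbundle : ∀ y : X₁.Pt, ∃ (r : ℕ) (V : Fin r → X₁.VectorField), (∀ a, (V a).RegAt y) ∧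
    ∀ᶠ z in 𝓝 y, LinearIndependent 𝕜 (fun a => V a z) ∧
      Submodule.span 𝕜 (Set.range fun a => V a z) = hor z
  /-- `TX₁ = ℋ ⊕ ker ds`. -/
  compl : ∀ y : X₁.Pt, IsCompl (hor y) (𝒳.kerS y)
  range_e : ∀ x : X₀.Pt,
    LinearMap.range (differential (X := X₀) (Y := X₁) 𝒳.e x (𝒳.e x)) = hor (𝒳.e x)
  /-- `θ_{m(z,y)} = θ_z ∘ θ_y`. -/
  theta_m : ∀ (z y : X₁.Pt) (h : 𝒳.s z = 𝒳.t y) (u : X₀.Tangent (𝒳.s y)),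
    𝒳.theta hor (𝒳.m z y h) (𝒳.s y) (𝒳.t z) u =
      𝒳.theta hor z (𝒳.t y) (𝒳.t z) (𝒳.theta hor y (𝒳.s y) (𝒳.t y) u)

variable {𝒳 : LieGroupoid C X₀ X₁}

/-- A flat (integrable) connection: `ℋ` is closed under the Lie bracket of vector fields. -/
def Connection.IsFlat (ℋ : 𝒳.Connection) : Prop :=
  ∀ (y : X₁.Pt) (V W : X₁.VectorField), V.RegAt y → W.RegAt y →
    (∀ᶠ z in 𝓝 y, V z ∈ ℋ.hor z) → (∀ᶠ z in 𝓝 y, W z ∈ ℋ.hor z) → lieBracket V W y ∈ ℋ.hor y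

/-- The form `ℋ(ω)` on `X₁` obtained by composing `ω` with the projection of `TX₁` onto `ℋ`
along `ker ds`. -/
noncomputable def Connection.horizontalPart (ℋ : 𝒳.Connection) {j : ℕ} (ω : X₁.FormField j) :
    X₁.FormField j :=
  fun y v => ω y fun a => (ℋ.hor y).projection (𝒳.kerS y) (ℋ.compl y) (v a)

/-- A differential `j`-form on the Lie groupoid: a differential `j`-form `ω` on `X₀` such that
`ℋ(s^* ω) = ℋ(t^* ω)`. -/
def Connection.IsGroupoidForm (ℋ : 𝒳.Connection) {j : ℕ} (ω : X₀.FormField j) : Prop :=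
  IsRegularForm ω ∧
    ℋ.horizontalPart (pullback 𝒳.s ω) = ℋ.horizontalPart (pullback 𝒳.t ω)

end LieGroupoid

/-! ## Principal bundles over Lie groupoids and their connections -/

/-- A principal (right) `G`-bundle `π : E → X₀` over the Lie groupoid `𝒳`. -/
structure PrincipalBundle (𝒳 : LieGroupoid C X₀ X₁) (G : FunctionSpace.{u} 𝕜) [Group G.Pt]
    (E : FunctionSpace.{u} 𝕜) where
  mem : C E
  π : E.Pt → X₀.Pt
  surjective_π : Function.Surjective π
  submersion_π : IsSubmersion E X₀ π
  /-- the right action of `G` -/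
  act : E.Pt → G.Pt → E.Pt
  morphism_act : IsMorphismOnProduct C (X := E) (Y := G) (W := E) act
  act_one : ∀ p, act p 1 = p
  act_mul : ∀ p g h, act p (g * h) = act (act p g) h
  π_act : ∀ p g, π (act p g) = π p
  /-- `E × G → E ×_{X₀} E`, `(p, g) ↦ (p, p g)` is bijective, with inverse `(p, p g) ↦ (p, div p (p g))`
  which is a morphism. -/
  div : ∀ p q : E.Pt, π p = π q → G.Pt
  act_div : ∀ p q h, act p (div p q h) = q
  div_act : ∀ p g, div p (act p g) (π_act p g).symm = g
  morphism_div : IsMorphismOnFiberProduct C (X := E) (Y := E) (Z := X₀) (W := G) π π div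
  /-- the left action `X₁ ×_{s, X₀, π} E → E` of the groupoid -/
  σ : ∀ (γ : X₁.Pt) (p : E.Pt), 𝒳.s γ = π p → E.Pt
  morphism_σ : IsMorphismOnFiberProduct C (X := X₁) (Y := E) (Z := X₀) (W := E) 𝒳.s π σ
  π_σ : ∀ γ p h, π (σ γ p h) = 𝒳.t γ
  σ_e : ∀ p, σ (𝒳.e (π p)) p (𝒳.s_e (π p)) = p
  σ_m : ∀ z y p (h : 𝒳.s z = 𝒳.t y) (h' : 𝒳.s y = π p),
    σ (𝒳.m z y h) p ((𝒳.s_m z y h).trans h') = σ z (σ y p h') (h.trans (π_σ y p h').symm)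
  σ_act : ∀ γ p g (h : 𝒳.s γ = π p),
    act (σ γ p h) g = σ γ (act p g) (h.trans (π_act p g).symm)

namespace PrincipalBundle

variable {𝒳 : LieGroupoid C X₀ X₁} {G E : FunctionSpace.{u} 𝕜} [Group G.Pt]

/-- The identification of `𝔤` with the vertical tangent space at `p`, the differential at `1` of
`g ↦ p g`. -/
noncomputable def vert (P : PrincipalBundle 𝒳 G E) (p : E.Pt) : G.LieAlg →ₗ[𝕜] E.Tangent p :=
  differential (fun g => P.act p g) 1 p

/-- A connection on the principal bundle over the Lie groupoid, given by its `𝔤`-valued `1`-form. -/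
structure Connection (P : PrincipalBundle 𝒳 G E) where
  /-- the connection form `TE → 𝔤` -/
  form : ∀ p : E.Pt, E.Tangent p →ₗ[𝕜] G.LieAlg
  regular : ∀ ℓ : Module.Dual 𝕜 G.LieAlg,
    IsRegularForm (X := E) (j := 1) fun p v => ℓ (form p (v 0))
  /-- It is a left inverse of the inclusion of the vertical tangent bundle. -/
  form_vert : ∀ p ξ, form p (P.vert p ξ) = ξ
  /-- It is `G`-equivariant. -/
  equivariant : ∀ p g (v : E.Tangent p),
    form (P.act p g) (differential (fun q => P.act q g) p (P.act p g) v) = G.Ad g⁻¹ (form p v)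
  /-- The pullbacks of the connection form along the source map `(γ, p) ↦ p` and the target map
  `(γ, p) ↦ γ · p` of `s^*E = X₁ ×_{X₀} E` coincide; stated on `T`-valued points `(a, b)` of `s^*E`. -/
  source_eq_target : ∀ T : FunctionSpace.{u} 𝕜, C T → ∀ (a : T.Pt → X₁.Pt) (b : T.Pt → E.Pt),
    IsMorphism T X₁ a → IsMorphism T E b → ∀ h : ∀ τ, 𝒳.s (a τ) = P.π (b τ),
      ∀ (τ : T.Pt) (u : T.Tangent τ),
        form (b τ) (differential b τ (b τ) u) =
          form (P.σ (a τ) (b τ) (h τ))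
            (differential (fun τ' => P.σ (a τ') (b τ') (h τ')) τ (P.σ (a τ) (b τ) (h τ)) u)

variable {P : PrincipalBundle 𝒳 G E}

/-- The splitting `D` of the Atiyah sequence: the horizontal lift to `p` of a tangent vector at
`x = π p`. -/
noncomputable def Connection.lift (D : P.Connection) (p : E.Pt) (x : X₀.Pt) (u : X₀.Tangent x) :
    E.Tangent p :=
  Classical.epsilon fun w : E.Tangent p => differential P.π p x w = u ∧ D.form p w = 0

/-- The (`G`-invariant) horizontal lift `D V` of a vector field `V` on `X₀`. -/
noncomputable def Connection.liftField (D : P.Connection) (V : X₀.VectorField) : E.VectorField :=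
  fun p => D.lift p (P.π p) (V (P.π p))

/-- A family of functions of two tangent vectors at the points `x` of `X₀` with values in the fibres
of `ad(E) = E ×^G 𝔤`, where the value at `x` is written as an element of `𝔤` in terms of each point
`p` of `E` over `x`. -/
abbrev AdField (P : PrincipalBundle 𝒳 G E) : Type u :=
  ∀ x : X₀.Pt, {p : E.Pt // P.π p = x} → X₀.Tangent x → X₀.Tangent x → G.LieAlg

/-- `K` is an `ad(E)`-valued `2`-form on `X₀`: the element `[p, K_p]` of `E ×^G 𝔤` does not depend on
`p`, and the corresponding `𝔤`-valued `2`-form on `E` is regular. -/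
def IsAdForm (K : P.AdField) : Prop :=
  (∀ (x : X₀.Pt) (p : {p : E.Pt // P.π p = x}) (g : G.Pt) (u v : X₀.Tangent x),
    K x ⟨P.act p.1 g, (P.π_act p.1 g).trans p.2⟩ u v = G.Ad g⁻¹ (K x p u v)) ∧
  ∀ ℓ : Module.Dual 𝕜 G.LieAlg, IsRegularForm (X := E) (j := 2) fun p v =>
    ℓ (K (P.π p) ⟨p, rfl⟩ (differential P.π p (P.π p) (v 0)) (differential P.π p (P.π p) (v 1)))

/-- `K` is the curvature `K(D)` of `D`: it is the `ad(E)`-valued `2`-form such that, for all local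
vector fields `V`, `W` on `X₀`, one has `K(V, W) = [D V, D W] - D [V, W]`. -/
def Connection.IsCurvature (D : P.Connection) (K : P.AdField) : Prop :=
  IsAdForm K ∧
  ∀ (x : X₀.Pt) (V W : X₀.VectorField), V.RegAt x → W.RegAt x → ∀ p : {p : E.Pt // P.π p = x},
    P.vert p.1 (K x p (V x) (W x)) =
      lieBracket (D.liftField V) (D.liftField W) p.1 - D.lift p.1 x (lieBracket V W x)

end PrincipalBundle

/-! ## Invariant polynomials -/

/-- `ν ∈ (Sym^k 𝔤^*)^G`, as a symmetric multilinear form invariant under the adjoint action. -/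
def IsInvariantSymmetric (G : FunctionSpace.{u} 𝕜) [Group G.Pt] {k : ℕ}
    (ν : MultilinearMap 𝕜 (fun _ : Fin k => G.LieAlg) 𝕜) : Prop :=
  (∀ (τ : Equiv.Perm (Fin k)) (ξ : Fin k → G.LieAlg), ν (fun a => ξ (τ a)) = ν ξ) ∧
    ∀ (g : G.Pt) (ξ : Fin k → G.LieAlg), ν (fun a => G.Ad g (ξ a)) = ν ξ

/-- The evaluation `ν(κ ∧ … ∧ κ)` of a symmetric multilinear form `ν` of degree `k` on a `2`-form `κ`
with values in a vector space `L`, on tangent vectors `v₁, …, v₂ₖ`. The factor `1 / 2^k` is that of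
the wedge product of `2`-forms: for `ν = ℓ ⊗ … ⊗ ℓ`, the value is the `k`-th wedge power of the scalar
`2`-form `ℓ ∘ κ`. -/
noncomputable def evalPolynomial {T L : Type u} [AddCommGroup L] [Module 𝕜 L] {k : ℕ}
    (ν : MultilinearMap 𝕜 (fun _ : Fin k => L) 𝕜) (κ : T → T → L) (v : Fin (2 * k) → T) : 𝕜 :=
  ((2 : 𝕜) ^ k)⁻¹ * ∑ τ : Equiv.Perm (Fin (2 * k)), ((Equiv.Perm.sign τ : ℤ) : 𝕜) *
    ν fun a : Fin k => κ (v (τ ⟨2 * a.1, by omega⟩)) (v (τ ⟨2 * a.1 + 1, by omega⟩))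

/-!
The argument is carried out on a *good* category of spaces with functions (`FunctionSpace.IsGood`).
Three things are asked of it: every space has, near each point, regular functions `yᵢ` with a dual
frame of regular vector fields (`HasCoordinates`); a map and a submersion with the same target have
local fibre products (`IsLocalFiberProduct`); and a function on the target of a submersion is regular
if its pullback is.

Let `θ` be the connection form on `E`. A tangent vector of `E` is determined by its image under `dπ`
and by its value under `θ` (`Connection.ext`), because the kernel of `dπ` consists of the vertical
vectors. Hence a vector field `V` on `X₀` has a unique horizontal lift `DV`, and
`[DV, DW] - D[V, W]` is vertical with component `θ [DV, DW] = -dθ(DV, DW)`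
(`Connection.form_lieBracket`). The right-hand side depends on `V` and `W` at one point only; this
gives existence of the curvature `K` (`Connection.exists_isCurvature`), and uniqueness is clear since
tangent vectors extend to vector fields.

For the Bianchi identity (`Connection.IsCurvature.bianchi`) take commuting vector fields `V`, `W`, `U`
on `X₀`. Then `[DV, DW]` is the vertical field with coefficient `K(V, W)`. Right translation preserves
horizontal lifts, so `DU` commutes with the vertical field of a fixed `ξ ∈ 𝔤`
(`Connection.liftField_vertField_comm`), and the Jacobi identity for `DU`, `DV`, `DW` says that the
cyclic sum of the derivatives of `K(V, W)` along `DU` vanishes.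

Let `ω = ν(K)`. Invariance of `ν` makes it independent of the point of the fibre
(`IsAdForm.evalPolynomial_eq`), and its values on regular vector fields are regular on `X₀` because
they are so on `E`. On commuting vector fields `V₀, …, V_{2k}` the number `(2k)! dω(V₀, …, V_{2k})` is
the antisymmetrization of the derivatives `V₀ (ω (V₁, …, V_{2k}))`
(`Represents.factorial_mul_exteriorDerivative`), which may be computed on `E` along `DV₀`. By the
Leibniz rule it is a sum of terms in which one factor `K(Vᵢ, Vⱼ)` is differentiated; summing a term
over the rotations of the three indices in that factor gives zero by the Bianchi identity
(`Connection.IsCurvature.sum_perm_d_eq_zero`). So `dω = 0`.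

Finally, the two maps from `X₁ ×_{X₀} E` to `E`, the projection and the action, pull `θ` back to the
same form, hence also `dθ`. A tangent vector `w` of `X₁` lifts to a tangent vector of the fibre product
whose two images in `E` are the horizontal lifts of `ds(w)` and of `dt(w)`; as `K` is `-dθ` on
horizontal lifts, `s^*K` and `t^*K` agree (`Connection.IsCurvature.source_eq_target`), and with them
`s^*ω` and `t^*ω`.

It remains to see that the three categories are good. For manifolds (`IsSmoothnessClass.isGood`) the
tangent vectors are the tangent vectors of a chart by the lemma of Hadamard, and the inverse function
theorem puts submersions in the form of a projection. For smooth schemes over `ℂ`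
(`isGood_isSmoothScheme`) functions are determined by their values at complex points, because smooth
algebras are reduced and by the Nullstellensatz; a basis of the Kähler differentials gives
coordinates; a map which is surjective on tangent spaces is smooth by the Jacobian criterion
(`exists_smooth_away`), so that descent of functions is faithfully flat descent (`exists_descent`) and
the fibre product is the spectrum of a tensor product, whose tangent vectors are homomorphisms to the
dual numbers.
-/


/-! ### Tangent vectors, differentials and derivatives along vector fields -/

namespace FunctionSpace

section Tangent

variable {X Y Z : FunctionSpace.{u} 𝕜} {x : X.Pt} {f g : X.Pt → 𝕜}

theorem d_apply (h : f ∈ X.regAt x) (v : X.Tangent x) : X.d f x v = v.1 ⟨f, h⟩ := by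
  rw [d, dif_pos h]
  rfl

theorem tangent_ext {v w : X.Tangent x} (h : ∀ f ∈ X.regAt x, X.d f x v = X.d f x w) : v = w := by
  refine Subtype.ext (LinearMap.ext fun f => ?_)
  have := h f.1 f.2
  rwa [d_apply f.2, d_apply f.2] at this

theorem const_mem (c : 𝕜) : (fun _ => c) ∈ X.regAt x := (X.regAt x).algebraMap_mem c

theorem add_mem' (hf : f ∈ X.regAt x) (hg : g ∈ X.regAt x) : (fun z => f z + g z) ∈ X.regAt x :=
  (X.regAt x).add_mem hf hg

theorem sub_mem' (hf : f ∈ X.regAt x) (hg : g ∈ X.regAt x) : (fun z => f z - g z) ∈ X.regAt x :=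
  (X.regAt x).sub_mem hf hg

theorem mul_mem' (hf : f ∈ X.regAt x) (hg : g ∈ X.regAt x) : (fun z => f z * g z) ∈ X.regAt x :=
  (X.regAt x).mul_mem hf hg

theorem neg_mem' (hf : f ∈ X.regAt x) : (fun z => -f z) ∈ X.regAt x := (X.regAt x).neg_mem hf

theorem const_mul_mem' (c : 𝕜) (hf : f ∈ X.regAt x) : (fun z => c * f z) ∈ X.regAt x :=
  mul_mem' (const_mem c) hf

theorem d_add (hf : f ∈ X.regAt x) (hg : g ∈ X.regAt x) (v : X.Tangent x) :
    X.d (fun z => f z + g z) x v = X.d f x v + X.d g x v := by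
  rw [d_apply hf, d_apply hg, d_apply (add_mem' hf hg)]
  exact v.1.map_add ⟨f, hf⟩ ⟨g, hg⟩

theorem d_mul (hf : f ∈ X.regAt x) (hg : g ∈ X.regAt x) (v : X.Tangent x) :
    X.d (fun z => f z * g z) x v = f x * X.d g x v + g x * X.d f x v := by
  rw [d_apply hf, d_apply hg, d_apply (mul_mem' hf hg)]
  exact v.2 ⟨f, hf⟩ ⟨g, hg⟩

theorem d_const (c : 𝕜) (v : X.Tangent x) : X.d (fun _ => c) x v = 0 := by
  have h1 : X.d (fun _ => (1 : 𝕜)) x v = 0 := by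
    have := d_mul (x := x) (const_mem (X := X) (1 : 𝕜)) (const_mem (1 : 𝕜)) v
    simpa using this
  have h := v.1.map_smul c ⟨_, const_mem (X := X) (x := x) (1 : 𝕜)⟩
  rw [← d_apply (const_mem (1 : 𝕜)), h1, smul_zero] at h
  rw [d_apply (const_mem c), ← h]
  congr 1
  exact Subtype.ext (funext fun _ => by simp)

theorem d_const_mul (c : 𝕜) (hf : f ∈ X.regAt x) (v : X.Tangent x) :
    X.d (fun z => c * f z) x v = c * X.d f x v := by
  rw [d_mul (const_mem c) hf, d_const, mul_zero, add_zero]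

theorem d_sub (hf : f ∈ X.regAt x) (hg : g ∈ X.regAt x) (v : X.Tangent x) :
    X.d (fun z => f z - g z) x v = X.d f x v - X.d g x v := by
  rw [d_apply hf, d_apply hg, d_apply (sub_mem' hf hg)]
  exact v.1.map_sub ⟨f, hf⟩ ⟨g, hg⟩

theorem sum_mem' {ι : Type*} (s : Finset ι) {F : ι → X.Pt → 𝕜} (h : ∀ i ∈ s, F i ∈ X.regAt x) :
    (fun z => ∑ i ∈ s, F i z) ∈ X.regAt x := by
  have := (X.regAt x).sum_mem h
  convert! this using 1
  ext z
  simp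

theorem prod_mem' {ι : Type*} (s : Finset ι) {F : ι → X.Pt → 𝕜} (h : ∀ i ∈ s, F i ∈ X.regAt x) :
    (fun z => ∏ i ∈ s, F i z) ∈ X.regAt x := by
  have := (X.regAt x).prod_mem h
  convert! this using 1
  ext z
  simp

theorem d_sum {ι : Type*} (s : Finset ι) {F : ι → X.Pt → 𝕜} (h : ∀ i ∈ s, F i ∈ X.regAt x)
    (v : X.Tangent x) : X.d (fun z => ∑ i ∈ s, F i z) x v = ∑ i ∈ s, X.d (F i) x v := by
  classical
  induction s using Finset.induction_on with
  | empty => simpa using d_const (X := X) (0 : 𝕜) v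
  | insert a s ha ih =>
    simp only [Finset.sum_insert ha]
    rw [d_add (h a (by simp)) (sum_mem' s fun i hi => h i (by simp [hi])),
      ih fun i hi => h i (by simp [hi])]

/-- The Leibniz rule for a finite product. -/
theorem d_prod {ι : Type*} [DecidableEq ι] (s : Finset ι) {F : ι → X.Pt → 𝕜}
    (h : ∀ i ∈ s, F i ∈ X.regAt x) (v : X.Tangent x) :
    X.d (fun z => ∏ i ∈ s, F i z) x v = ∑ i ∈ s, X.d (F i) x v * ∏ j ∈ s.erase i, F j x := by
  induction s using Finset.induction_on with
  | empty => simpa using d_const (X := X) (1 : 𝕜) v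
  | insert a s ha ih =>
    simp only [Finset.prod_insert ha]
    rw [d_mul (h a (by simp)) (prod_mem' s fun i hi => h i (by simp [hi])),
      ih fun i hi => h i (by simp [hi]), Finset.sum_insert ha, Finset.erase_insert ha,
      Finset.mul_sum, add_comm, mul_comm]
    congr 1
    refine Finset.sum_congr rfl fun i hi => ?_
    have hia : i ≠ a := fun e => ha (e ▸ hi)
    rw [Finset.erase_insert_of_ne hia.symm, Finset.prod_insert (by simp [ha])]
    ring

/-- Tangent vectors only see germs. A function which vanishes near `x` is its own product with a
function which is `0` near `x` and `1` elsewhere; both factors vanish at `x`. -/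
theorem d_congr (h : f =ᶠ[𝓝 x] g) (v : X.Tangent x) : X.d f x v = X.d g x v := by
  classical
  have key : ∀ k : X.Pt → 𝕜, k =ᶠ[𝓝 x] (fun _ => 0) → X.d k x v = 0 := by
    intro k hk
    have hkm : k ∈ X.regAt x := X.regAt_congr (const_mem (0 : 𝕜)) hk.symm
    let e : X.Pt → 𝕜 := fun z => if k z = 0 then 0 else 1
    have he : e =ᶠ[𝓝 x] fun _ => 0 := by
      filter_upwards [hk] with z hz
      simp [e, hz]
    have hem : e ∈ X.regAt x := X.regAt_congr (const_mem (0 : 𝕜)) he.symm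
    have hke : k = fun z => k z * e z := by
      funext z
      by_cases hz : k z = 0 <;> simp [e, hz]
    rw [hke, d_mul hkm hem, hk.self_of_nhds, he.self_of_nhds]
    ring
  by_cases hf : f ∈ X.regAt x
  · have hg : g ∈ X.regAt x := X.regAt_congr hf h
    have := key (fun z => f z - g z) (by filter_upwards [h] with z hz; simp [hz])
    rw [d_sub hf hg] at this
    exact sub_eq_zero.mp this
  · have hg : g ∉ X.regAt x := fun hg => hf (X.regAt_congr hg h.symm)
    rw [d, d, dif_neg hf, dif_neg hg]

/-- A derivation of the regular functions, given by an operator on all functions, is a tangent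
vector. -/
theorem exists_tangent (D : (X.Pt → 𝕜) → 𝕜)
    (hadd : ∀ f ∈ X.regAt x, ∀ g ∈ X.regAt x, D (fun z => f z + g z) = D f + D g)
    (hsmul : ∀ c : 𝕜, ∀ f ∈ X.regAt x, D (fun z => c * f z) = c * D f)
    (hmul : ∀ f ∈ X.regAt x, ∀ g ∈ X.regAt x, D (fun z => f z * g z) = f x * D g + g x * D f) :
    ∃ v : X.Tangent x, ∀ f ∈ X.regAt x, X.d f x v = D f := by
  let L : Module.Dual 𝕜 (X.regAt x) :=
    { toFun := fun f => D f.1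
      map_add' := fun f g => hadd f.1 f.2 g.1 g.2
      map_smul' := fun c f => hsmul c f.1 f.2 }
  refine ⟨⟨L, fun f g => hmul f.1 f.2 g.1 g.2⟩, fun f hf => ?_⟩
  rw [d_apply hf]
  rfl

/-- `φ` pulls functions regular at `φ x` back to functions regular at `x`. -/
def PullsAt (X Y : FunctionSpace.{u} 𝕜) (φ : X.Pt → Y.Pt) (x : X.Pt) : Prop :=
  ∀ f ∈ Y.regAt (φ x), f ∘ φ ∈ X.regAt x

theorem IsMorphism.pullsAt {φ : X.Pt → Y.Pt} (h : IsMorphism X Y φ) (x : X.Pt) :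
    PullsAt X Y φ x := fun f hf => h.2 x f hf

theorem d_differential {φ : X.Pt → Y.Pt} {y : Y.Pt} (h : PullsAt X Y φ x) (hy : φ x = y)
    {f : Y.Pt → 𝕜} (hf : f ∈ Y.regAt y) (v : X.Tangent x) :
    Y.d f y (differential φ x y v) = X.d (f ∘ φ) x v := by
  subst hy
  rw [d_apply hf, d_apply (h f hf), differential, dif_pos ⟨rfl, h⟩]
  rfl

theorem isMorphism_id : IsMorphism X X id := ⟨continuous_id, fun _ _ hf => hf⟩

theorem isMorphism_const (y : Y.Pt) : IsMorphism X Y fun _ => y :=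
  ⟨continuous_const, fun _ f _ => const_mem (f y)⟩

theorem PullsAt.comp {φ : X.Pt → Y.Pt} {ψ : Y.Pt → Z.Pt} (hψ : PullsAt Y Z ψ (φ x))
    (hφ : PullsAt X Y φ x) : PullsAt X Z (fun x => ψ (φ x)) x :=
  fun f hf => hφ _ (hψ f hf)

/-- The chain rule. -/
theorem differential_comp {φ : X.Pt → Y.Pt} {ψ : Y.Pt → Z.Pt} {y : Y.Pt} {z : Z.Pt}
    (hφ : PullsAt X Y φ x) (hy : φ x = y) (hψ : PullsAt Y Z ψ y) (hz : ψ y = z)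
    (v : X.Tangent x) :
    differential (fun x => ψ (φ x)) x z v = differential ψ y z (differential φ x y v) := by
  subst hy
  refine tangent_ext fun f hf => ?_
  have hf' : f ∈ Z.regAt (ψ (φ x)) := by rw [hz]; exact hf
  rw [d_differential (PullsAt.comp hψ hφ) hz hf, d_differential hψ hz hf,
    d_differential hφ rfl (hψ f hf')]
  rfl

theorem PullsAt.congr {φ φ' : X.Pt → Y.Pt} (hφ : PullsAt X Y φ x) (h : φ =ᶠ[𝓝 x] φ') :
    PullsAt X Y φ' x := fun f hf => by
  rw [← h.self_of_nhds] at hf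
  exact X.regAt_congr (hφ f hf) (h.fun_comp f)

theorem differential_congr {φ φ' : X.Pt → Y.Pt} {y : Y.Pt} (hφ : PullsAt X Y φ x)
    (h : φ =ᶠ[𝓝 x] φ') (hy : φ x = y) (v : X.Tangent x) :
    differential φ x y v = differential φ' x y v := by
  refine tangent_ext fun f hf => ?_
  rw [d_differential hφ hy hf,
    d_differential (hφ.congr h) (by rw [← hy]; exact h.self_of_nhds.symm) hf]
  exact d_congr (h.fun_comp f) v

theorem differential_const (y : Y.Pt) (v : X.Tangent x) :
    differential (X := X) (Y := Y) (fun _ => y) x y v = 0 := by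
  refine tangent_ext fun f hf => ?_
  rw [d_differential (fun f _ => const_mem (f y)) rfl hf, map_zero]
  exact d_const _ v

theorem differential_id (v : X.Tangent x) : differential (X := X) (Y := X) (fun z => z) x x v = v := by
  refine tangent_ext fun f hf => ?_
  rw [d_differential (X := X) (Y := X) (φ := fun z => z) (fun f hf => hf) rfl hf]
  rfl

/-! ### Vector fields -/

/-- The function `V f`. -/
noncomputable def VectorField.app (V : X.VectorField) (f : X.Pt → 𝕜) : X.Pt → 𝕜 :=
  fun z => X.d f z (V z)

variable {V W : X.VectorField}

theorem VectorField.RegAt.mem (hV : V.RegAt x) (hf : f ∈ X.regAt x) : V.app f ∈ X.regAt x :=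
  hV.self_of_nhds f hf

theorem VectorField.RegAt.eventually (hV : V.RegAt x) : ∀ᶠ y in 𝓝 x, V.RegAt y :=
  hV.eventually_nhds

theorem app_mul (hf : f ∈ X.regAt x) (hg : g ∈ X.regAt x) :
    V.app (fun z => f z * g z) =ᶠ[𝓝 x] fun z => f z * V.app g z + g z * V.app f z := by
  filter_upwards [X.regAt_nhds hf, X.regAt_nhds hg] with z hf hg
  exact d_mul hf hg _

theorem app_add (hf : f ∈ X.regAt x) (hg : g ∈ X.regAt x) :
    V.app (fun z => f z + g z) =ᶠ[𝓝 x] fun z => V.app f z + V.app g z := by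
  filter_upwards [X.regAt_nhds hf, X.regAt_nhds hg] with z hf hg
  exact d_add hf hg _

theorem app_const_mul (c : 𝕜) (hf : f ∈ X.regAt x) :
    V.app (fun z => c * f z) =ᶠ[𝓝 x] fun z => c * V.app f z := by
  filter_upwards [X.regAt_nhds hf] with z hf
  exact d_const_mul c hf _

/-- The commutator of two vector fields regular near `x` is a derivation at `x`, so the Lie bracket
is given by its defining property. -/
theorem d_lieBracket (hV : V.RegAt x) (hW : W.RegAt x) (hf : f ∈ X.regAt x) :
    X.d f x (lieBracket V W x) = X.d (W.app f) x (V x) - X.d (V.app f) x (W x) := by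
  have hex : ∃ u : X.Tangent x, ∀ f ∈ X.regAt x,
      X.d f x u = X.d (W.app f) x (V x) - X.d (V.app f) x (W x) := by
    refine exists_tangent (fun f => X.d (W.app f) x (V x) - X.d (V.app f) x (W x)) ?_ ?_ ?_
    · intro f hf g hg
      rw [d_congr (app_add hf hg) (V x), d_congr (app_add hf hg) (W x),
        d_add (hW.mem hf) (hW.mem hg), d_add (hV.mem hf) (hV.mem hg)]
      ring
    · intro c f hf
      rw [d_congr (app_const_mul c hf) (V x), d_congr (app_const_mul c hf) (W x),
        d_const_mul c (hW.mem hf), d_const_mul c (hV.mem hf)]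
      ring
    · intro f hf g hg
      rw [d_congr (app_mul hf hg) (V x), d_congr (app_mul hf hg) (W x),
        d_add (mul_mem' hf (hW.mem hg)) (mul_mem' hg (hW.mem hf)),
        d_add (mul_mem' hf (hV.mem hg)) (mul_mem' hg (hV.mem hf)),
        d_mul hf (hW.mem hg), d_mul hg (hW.mem hf), d_mul hf (hV.mem hg), d_mul hg (hV.mem hf)]
      simp only [VectorField.app]
      ring
  exact Classical.epsilon_spec hex f hf

end Tangent

end FunctionSpace


/-! ### Local coordinates -/

theorem mem_span_of_forall_eq_zero {ι E : Type*} [Finite ι] [AddCommMonoid E] [Module 𝕜 E]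
    (β : ι → E →ₗ[𝕜] 𝕜) (K : E →ₗ[𝕜] 𝕜) (h : ∀ v, (∀ i, β i v = 0) → K v = 0) :
    K ∈ Submodule.span 𝕜 (Set.range β) := by
  let := Module.addCommMonoidToAddCommGroup 𝕜 (M := E)
  refine mem_span_of_iInf_ker_le_ker fun v hv => h v fun i => ?_
  rw [Submodule.mem_iInf] at hv
  exact hv i

theorem exists_basis_of_injective {E : Type*} [AddCommMonoid E] [Module 𝕜 E] {n : ℕ}
    (L : E →ₗ[𝕜] Fin n → 𝕜) (hL : Function.Injective L) :
    ∃ r : ℕ, Nonempty (Module.Basis (Fin r) 𝕜 E) := by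
  let := Module.addCommMonoidToAddCommGroup 𝕜 (M := E)
  have : FiniteDimensional 𝕜 E := FiniteDimensional.of_injective L hL
  exact ⟨_, ⟨Module.finBasis 𝕜 E⟩⟩

namespace FunctionSpace

/-- Local coordinates `y i` near `x`, with the dual frame `D i` of vector fields. -/
structure IsFrame (X : FunctionSpace.{u} 𝕜) (x : X.Pt) {n : ℕ} (y : Fin n → X.Pt → 𝕜)
    (D : Fin n → X.VectorField) : Prop where
  mem : ∀ i, y i ∈ X.regAt x
  reg : ∀ i, (D i).RegAt x
  dual : ∀ᶠ z in 𝓝 x, ∀ i j, X.d (y j) z (D i z) = if i = j then 1 else 0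
  expand : ∀ᶠ z in 𝓝 x, ∀ v : X.Tangent z, ∀ f ∈ X.regAt z,
    X.d f z v = ∑ i, X.d f z (D i z) * X.d (y i) z v

/-- The local properties of a smooth space on which the calculus of forms rests: the germs of regular
functions form a local ring, and there are local coordinates. -/
structure HasCoordinates (X : FunctionSpace.{u} 𝕜) : Prop where
  inv_mem : ∀ {x : X.Pt} {f : X.Pt → 𝕜}, f ∈ X.regAt x → f x ≠ 0 → (fun z => (f z)⁻¹) ∈ X.regAt x
  eventually_ne : ∀ {x : X.Pt} {f : X.Pt → 𝕜}, f ∈ X.regAt x → f x ≠ 0 → ∀ᶠ z in 𝓝 x, f z ≠ 0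
  exists_frame : ∀ x : X.Pt, ∃ (n : ℕ) (y : Fin n → X.Pt → 𝕜) (D : Fin n → X.VectorField),
    X.IsFrame x y D

section Frame

variable {X Y : FunctionSpace.{u} 𝕜} {x : X.Pt} {f g : X.Pt → 𝕜} {n : ℕ} {y : Fin n → X.Pt → 𝕜}
  {D : Fin n → X.VectorField}

theorem IsFrame.tangent_eq (h : X.IsFrame x y D) :
    ∀ᶠ z in 𝓝 x, ∀ v : X.Tangent z, v = ∑ i, X.d (y i) z v • D i z := by
  filter_upwards [h.expand] with z hz v
  refine tangent_ext fun f hf => ?_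
  rw [hz v f hf, map_sum]
  exact Finset.sum_congr rfl fun i _ => by rw [map_smul, smul_eq_mul, mul_comm]

theorem HasCoordinates.exists_basis (hX : HasCoordinates X) (x : X.Pt) :
    ∃ r : ℕ, Nonempty (Module.Basis (Fin r) 𝕜 (X.Tangent x)) := by
  obtain ⟨n, y, D, h⟩ := hX.exists_frame x
  refine exists_basis_of_injective (LinearMap.pi fun i => X.d (y i) x) ?_
  intro v w hvw
  rw [h.tangent_eq.self_of_nhds v, h.tangent_eq.self_of_nhds w]
  exact Finset.sum_congr rfl fun i _ => by rw [show X.d (y i) x v = X.d (y i) x w from congrFun hvw i]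

/-- A combination of regular vector fields with regular coefficients is regular. -/
theorem VectorField.RegAt.of_eq_sum {ι : Type*} [Fintype ι] {W : ι → X.VectorField}
    {V : X.VectorField} {c : ι → X.Pt → 𝕜} (hW : ∀ i, (W i).RegAt x) (hc : ∀ i, c i ∈ X.regAt x)
    (hV : ∀ᶠ z in 𝓝 x, V z = ∑ i, c i z • W i z) : V.RegAt x := by
  filter_upwards [Filter.eventually_all.2 hW, Filter.eventually_all.2 fun i => X.regAt_nhds (hc i),
    hV.eventually_nhds] with z hWz hcz hVz f hf
  refine X.regAt_congr (sum_mem' Finset.univ fun i _ => mul_mem' (hcz i) (hWz i f hf)) ?_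
  filter_upwards [hVz] with z' hz'
  rw [hz', map_sum]
  simp

theorem det_mem {n : Type*} [Fintype n] [DecidableEq n] {M : X.Pt → Matrix n n 𝕜}
    (h : ∀ i j, (fun z => M z i j) ∈ X.regAt x) : (fun z => (M z).det) ∈ X.regAt x := by
  simp only [Matrix.det_apply']
  exact sum_mem' _ fun σ _ => const_mul_mem' _ (prod_mem' _ fun i _ => h _ _)

theorem adjugate_mem {n : Type*} [Fintype n] [DecidableEq n] {M : X.Pt → Matrix n n 𝕜}
    (h : ∀ i j, (fun z => M z i j) ∈ X.regAt x) (i j : n) :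
    (fun z => (M z).adjugate i j) ∈ X.regAt x := by
  simp only [Matrix.adjugate_apply]
  refine det_mem fun a b => ?_
  by_cases ha : a = j
  · subst ha
    simpa using const_mem _
  · simpa [Matrix.updateRow_ne ha] using h a b

/-- If regular `1`-forms are jointly injective on the tangent space at `x`, a vector field on which
they take regular values is regular. At `x` the differentials of the coordinates are combinations,
with constant coefficients, of the given forms; the matrix of the same combinations in the dual frame
is the identity at `x`, hence invertible near `x`. -/
theorem HasCoordinates.regAt_of_forms (hX : HasCoordinates X) {ι : Type*} [Finite ι]
    (β : ι → ∀ z, X.Tangent z →ₗ[𝕜] 𝕜)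
    (hβ : ∀ (i : ι) (V : X.VectorField), V.RegAt x → (fun z => β i z (V z)) ∈ X.regAt x)
    (inj : ∀ v : X.Tangent x, (∀ i, β i x v = 0) → v = 0) {V : X.VectorField}
    (hV : ∀ i, (fun z => β i z (V z)) ∈ X.regAt x) : V.RegAt x := by
  cases nonempty_fintype ι
  obtain ⟨n, y, D, h⟩ := hX.exists_frame x
  have hspan : ∀ k, ∃ c : ι → 𝕜, ∑ i, c i • β i x = X.d (y k) x := by
    intro k
    have : X.d (y k) x ∈ Submodule.span 𝕜 (Set.range fun i => β i x) :=
      mem_span_of_forall_eq_zero (fun i => β i x) (X.d (y k) x) fun v hv => by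
        rw [inj v hv, map_zero]
    exact (Submodule.mem_span_range_iff_exists_fun 𝕜).1 this
  choose c hc using hspan
  let γ : Fin n → ∀ z, X.Tangent z →ₗ[𝕜] 𝕜 := fun k z => ∑ i, c k i • β i z
  have hγ : ∀ (k : Fin n) (W : X.VectorField), (∀ i, (fun z => β i z (W z)) ∈ X.regAt x) →
      (fun z => γ k z (W z)) ∈ X.regAt x := by
    intro k W hW
    simp only [γ, LinearMap.sum_apply, LinearMap.smul_apply, smul_eq_mul]
    exact sum_mem' _ fun i _ => const_mul_mem' _ (hW i)
  let M : X.Pt → Matrix (Fin n) (Fin n) 𝕜 := fun z => Matrix.of fun k l => γ k z (D l z)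
  have hM : ∀ k l, (fun z => M z k l) ∈ X.regAt x := fun k l => hγ k (D l) fun i => hβ i _ (h.reg l)
  have hMx : M x = 1 := by
    ext k l
    change γ k x (D l x) = _
    rw [show γ k x = X.d (y k) x from hc k, h.dual.self_of_nhds, Matrix.one_apply]
    simp [eq_comm]
  have hdet := det_mem hM
  have hdet0 : (M x).det ≠ 0 := by simp [hMx]
  refine VectorField.RegAt.of_eq_sum (c := fun l z => X.d (y l) z (V z)) h.reg (fun l => ?_) (by
    filter_upwards [h.tangent_eq] with z hz using hz (V z))
  refine X.regAt_congr (mul_mem' (hX.inv_mem hdet hdet0)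
    (sum_mem' Finset.univ fun k _ => mul_mem' (adjugate_mem hM l k) (hγ k V hV))) ?_
  filter_upwards [h.tangent_eq, hX.eventually_ne hdet hdet0] with z hz hz0
  have key : (fun k => γ k z (V z)) = (M z).mulVec fun l => X.d (y l) z (V z) := by
    funext k
    conv_lhs => rw [hz (V z)]
    rw [map_sum]
    exact Finset.sum_congr rfl fun l _ => by rw [map_smul, smul_eq_mul, mul_comm]; rfl
  have : ∑ k, (M z).adjugate l k * γ k z (V z) = (M z).det * X.d (y l) z (V z) := by
    have := congrFun (congrArg (M z).adjugate.mulVec key) l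
    rw [Matrix.mulVec_mulVec, Matrix.adjugate_mul, Matrix.smul_mulVec, Matrix.one_mulVec] at this
    exact this
  rw [this, inv_mul_cancel_left₀ hz0]

/-- Tangent vectors at a point extend to commuting vector fields: combinations of a coordinate frame
with constant coefficients. -/
theorem HasCoordinates.exists_commuting (hX : HasCoordinates X) (x : X.Pt) {ι : Type*}
    (v : ι → X.Tangent x) :
    ∃ V : ι → X.VectorField, (∀ a, (V a).RegAt x) ∧ (∀ a, V a x = v a) ∧
      ∀ a b, ∀ᶠ z in 𝓝 x, ∀ f ∈ X.regAt z,
        X.d ((V b).app f) z (V a z) = X.d ((V a).app f) z (V b z) := by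
  obtain ⟨n, y, D, h⟩ := hX.exists_frame x
  have hcomm : ∀ᶠ z in 𝓝 x, ∀ i j, ∀ f ∈ X.regAt z,
      X.d ((D j).app f) z (D i z) = X.d ((D i).app f) z (D j z) := by
    filter_upwards [h.dual.eventually_nhds, h.expand,
      Filter.eventually_all.2 fun i => X.regAt_nhds (h.mem i),
      Filter.eventually_all.2 fun i => (h.reg i).eventually] with z hd he hm hr i j f hf
    have h0 : ∀ k, X.d (y k) z (lieBracket (D i) (D j) z) = 0 := by
      intro k
      have hconst : ∀ l, (D l).app (y k) =ᶠ[𝓝 z] fun _ => if l = k then 1 else 0 := by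
        intro l
        filter_upwards [hd] with z' hz' using hz' l k
      rw [d_lieBracket (hr i) (hr j) (hm k), d_congr (hconst i), d_congr (hconst j), d_const,
        d_const, sub_zero]
    have := he (lieBracket (D i) (D j) z) f hf
    simp only [h0, mul_zero, Finset.sum_const_zero] at this
    rw [d_lieBracket (hr i) (hr j) hf] at this
    exact sub_eq_zero.mp this
  let V : ι → X.VectorField := fun a z => ∑ i, X.d (y i) x (v a) • D i z
  refine ⟨V, fun a => ?_, fun a => (h.tangent_eq.self_of_nhds (v a)).symm, fun a b => ?_⟩
  · exact VectorField.RegAt.of_eq_sum (c := fun i _ => X.d (y i) x (v a)) h.reg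
      (fun i => const_mem _) (Filter.Eventually.of_forall fun z => rfl)
  · filter_upwards [hcomm, Filter.eventually_all.2 fun i => (h.reg i).eventually] with z hz hr f hf
    have happ : ∀ a, (V a).app f = fun z' => ∑ i, X.d (y i) x (v a) * (D i).app f z' := by
      intro a
      funext z'
      simp [V, VectorField.app]
    have hd : ∀ a b, X.d ((V b).app f) z (V a z) =
        ∑ i, ∑ j, X.d (y i) x (v a) * X.d (y j) x (v b) * X.d ((D j).app f) z (D i z) := by
      intro a b
      rw [happ, d_sum _ fun i _ => const_mul_mem' _ ((hr i).mem hf), Finset.sum_comm]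
      refine Finset.sum_congr rfl fun j _ => ?_
      rw [d_const_mul _ ((hr j).mem hf)]
      simp only [V, map_sum, map_smul, smul_eq_mul, Finset.mul_sum]
      exact Finset.sum_congr rfl fun i _ => by ring
    rw [hd a b, hd b a, Finset.sum_comm]
    refine Finset.sum_congr rfl fun i _ => Finset.sum_congr rfl fun j _ => ?_
    rw [hz i j f hf]
    ring

theorem HasCoordinates.exists_extension (hX : HasCoordinates X) (x : X.Pt) (v : X.Tangent x) :
    ∃ V : X.VectorField, V.RegAt x ∧ V x = v := by
  obtain ⟨V, h1, h2, -⟩ := hX.exists_commuting x (fun _ : Unit => v)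
  exact ⟨V (), h1 (), h2 ()⟩

end Frame

/-! ### Categories with fibre products and descent along submersions -/

/-- The one-point space. -/
def point (𝕜 : Type) [Field 𝕜] : FunctionSpace.{u} 𝕜 where
  Pt := PUnit
  regAt _ := ⊤
  regAt_congr _ _ := trivial
  regAt_nhds _ := Filter.Eventually.of_forall fun _ => trivial

/-- `T`, with `a : T → X` and `b : T → Y`, is locally a fibre product of `φ : X → Z` and `ψ : Y → Z`:
its tangent vectors are the compatible pairs of tangent vectors of `X` and `Y`, and it has the
universal property for germs of maps. -/
structure IsLocalFiberProduct (C : FunctionSpace.{u} 𝕜 → Prop) {X Y Z T : FunctionSpace.{u} 𝕜}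
    (φ : X.Pt → Z.Pt) (ψ : Y.Pt → Z.Pt) (a : T.Pt → X.Pt) (b : T.Pt → Y.Pt) : Prop where
  mem : C T
  fst : IsMorphism T X a
  snd : IsMorphism T Y b
  comm : ∀ τ, φ (a τ) = ψ (b τ)
  exists_lift : ∀ (τ : T.Pt) (v : X.Tangent (a τ)) (w : Y.Tangent (b τ)),
    differential (Y := Z) φ (a τ) (φ (a τ)) v = differential (Y := Z) ψ (b τ) (φ (a τ)) w →
      ∃ u : T.Tangent τ, differential a τ (a τ) u = v ∧ differential b τ (b τ) u = w
  injective : ∀ (τ : T.Pt) (u : T.Tangent τ),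
    differential (Y := X) a τ (a τ) u = 0 → differential (Y := Y) b τ (b τ) u = 0 → u = 0
  exists_map : ∀ S : FunctionSpace.{u} 𝕜, C S → ∀ (a' : S.Pt → X.Pt) (b' : S.Pt → Y.Pt),
    IsMorphism S X a' → IsMorphism S Y b' → (∀ σ, φ (a' σ) = ψ (b' σ)) →
      ∀ (σ : S.Pt) (τ : T.Pt), a' σ = a τ → b' σ = b τ →
        ∃ c : S.Pt → T.Pt, c σ = τ ∧ PullsAt S T c σ ∧
          (∀ᶠ ρ in 𝓝 σ, a (c ρ) = a' ρ) ∧ ∀ᶠ ρ in 𝓝 σ, b (c ρ) = b' ρ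

/-- The properties of a category of smooth spaces which the Chern-Weil construction uses. -/
structure IsGood (C : FunctionSpace.{u} 𝕜 → Prop) : Prop where
  charZero : CharZero 𝕜
  coord : ∀ X, C X → HasCoordinates X
  point : C (point 𝕜)
  fiberProduct : ∀ X Y Z, C X → C Y → C Z → ∀ (φ : X.Pt → Z.Pt) (ψ : Y.Pt → Z.Pt),
    IsMorphism X Z φ → IsSubmersion Y Z ψ → ∀ x y, φ x = ψ y →
      ∃ (T : FunctionSpace.{u} 𝕜) (a : T.Pt → X.Pt) (b : T.Pt → Y.Pt) (τ : T.Pt),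
        IsLocalFiberProduct C (X := X) (Y := Y) (Z := Z) φ ψ a b ∧ a τ = x ∧ b τ = y
  /-- A function on the target of a submersion is regular if its pullback is. -/
  descent : ∀ Y Z, C Y → C Z → ∀ ψ : Y.Pt → Z.Pt, IsSubmersion Y Z ψ →
    ∀ (y : Y.Pt) (f : Z.Pt → 𝕜), f ∘ ψ ∈ Y.regAt y → f ∈ Z.regAt (ψ y)

theorem tangent_point_eq_zero {x : (point.{u} 𝕜).Pt} (v : (point.{u} 𝕜).Tangent x) : v = 0 := by
  refine tangent_ext fun f _ => ?_
  rw [map_zero, show f = fun _ => f PUnit.unit from rfl]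
  exact d_const _ v

end FunctionSpace


/-! ### Differential forms and the exterior derivative -/

theorem add_neg_one_smul {E : Type*} [AddCommMonoid E] [Module 𝕜 E] (v : E) :
    v + (-1 : 𝕜) • v = 0 := by
  nth_rewrite 1 [← one_smul 𝕜 v]
  rw [← add_smul, add_neg_cancel, zero_smul]

theorem eq_of_add_neg_one_smul {E : Type*} [AddCommMonoid E] [Module 𝕜 E] {v w : E}
    (h : v + (-1 : 𝕜) • w = 0) : v = w := by
  calc v = v + (w + (-1 : 𝕜) • w) := by rw [add_neg_one_smul, add_zero]
    _ = (v + (-1 : 𝕜) • w) + w := by rw [add_comm w, add_assoc]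
    _ = w := by rw [h, zero_add]

namespace FunctionSpace

section Forms

variable {X Y : FunctionSpace.{u} 𝕜} {x : X.Pt} {j N : ℕ}

theorem tangent_sub_eq (v w : X.Tangent x) : v - w = v + (-1 : 𝕜) • w := by
  refine Subtype.ext (LinearMap.ext fun f => ?_)
  change v.1 f - w.1 f = v.1 f + (-1 : 𝕜) • w.1 f
  simp [sub_eq_add_neg]

/-- `ω` is regular near `x`. -/
def FormField.RegAt (ω : X.FormField j) (x : X.Pt) : Prop :=
  ∃ (N : ℕ) (f : Fin N → X.Pt → 𝕜) (g : Fin N → Fin j → X.Pt → 𝕜), Represents ω x f g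

theorem dWedge_mem {g : Fin j → X.Pt → 𝕜} (hg : ∀ a, g a ∈ X.regAt x) {V : Fin j → X.VectorField}
    (hV : ∀ a, (V a).RegAt x) : (fun z => X.dWedge g z fun a => V a z) ∈ X.regAt x :=
  det_mem fun a b => (hV a).mem (hg b)

theorem Represents.mem {ω : X.FormField j} {f : Fin N → X.Pt → 𝕜} {g : Fin N → Fin j → X.Pt → 𝕜}
    (h : Represents ω x f g) {V : Fin j → X.VectorField} (hV : ∀ a, (V a).RegAt x) :
    (fun z => ω z fun a => V a z) ∈ X.regAt x := by
  refine X.regAt_congr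
    (sum_mem' Finset.univ fun i _ => mul_mem' (h.1 i) (dWedge_mem (h.2.1 i) hV)) ?_
  filter_upwards [h.2.2] with z hz
  exact (hz _).symm

/-- `dg₁ ∧ … ∧ dg_j` at `x` as an alternating map. -/
noncomputable def dWedgeAlternating (X : FunctionSpace.{u} 𝕜) (g : Fin j → X.Pt → 𝕜) (x : X.Pt) :
    X.Tangent x [⋀^Fin j]→ₗ[𝕜] 𝕜 :=
  Matrix.detRowAlternating.compLinearMap (LinearMap.pi fun b => X.d (g b) x)

theorem alternating_sum_apply {ι κ M : Type*} [AddCommMonoid M] [Module 𝕜 M] (s : Finset ι)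
    (A : ι → M [⋀^κ]→ₗ[𝕜] 𝕜) (v : κ → M) : (∑ i ∈ s, A i) v = ∑ i ∈ s, A i v := by
  classical
  induction s using Finset.induction_on with
  | empty => simp
  | insert a s ha ih => rw [Finset.sum_insert ha, Finset.sum_insert ha, AlternatingMap.add_apply, ih]

theorem Represents.pullback {ω : Y.FormField j} {φ : X.Pt → Y.Pt} (hφ : IsMorphism X Y φ)
    {f : Fin N → Y.Pt → 𝕜} {g : Fin N → Fin j → Y.Pt → 𝕜} (h : Represents ω (φ x) f g) :
    Represents (FunctionSpace.pullback φ ω) x (fun i => f i ∘ φ) fun i a => g i a ∘ φ := by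
  refine ⟨fun i => hφ.2 x _ (h.1 i), fun i a => hφ.2 x _ (h.2.1 i a), ?_⟩
  have hg : ∀ᶠ z in 𝓝 (φ x), ∀ i a, g i a ∈ Y.regAt z :=
    Filter.eventually_all.2 fun i => Filter.eventually_all.2 fun a => Y.regAt_nhds (h.2.1 i a)
  filter_upwards [hφ.1.continuousAt.eventually (h.2.2.and hg)] with z hz v
  rw [FunctionSpace.pullback, hz.1]
  refine Finset.sum_congr rfl fun i _ => ?_
  congr 1
  refine congrArg Matrix.det (Matrix.ext fun a b => ?_)
  exact d_differential (hφ.pullsAt z) rfl (hz.2 i b) _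

/-- A family of alternating forms which takes regular values on regular vector fields is a
differential form: it is `(1 / j!) ∑ ω(D_{i₁}, …, D_{i_j}) dy_{i₁} ∧ … ∧ dy_{i_j}`, the sum being over
all multi-indices. -/
theorem HasCoordinates.formRegAt [CharZero 𝕜] (hX : HasCoordinates X) {ω : X.FormField j}
    (halt : ∀ᶠ z in 𝓝 x, ∃ A : X.Tangent z [⋀^Fin j]→ₗ[𝕜] 𝕜, ∀ v, ω z v = A v)
    (hreg : ∀ V : Fin j → X.VectorField, (∀ a, (V a).RegAt x) →
      (fun z => ω z fun a => V a z) ∈ X.regAt x) : ω.RegAt x := by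
  obtain ⟨n, y, D, h⟩ := hX.exists_frame x
  let e := Fintype.equivFin (Fin j → Fin n)
  refine ⟨_, fun i z => (j.factorial : 𝕜)⁻¹ * ω z fun a => D (e.symm i a) z,
    fun i a => y (e.symm i a), fun i => const_mul_mem' _ (hreg _ fun a => h.reg _),
    fun i a => h.mem _, ?_⟩
  filter_upwards [halt, h.tangent_eq] with z ⟨A, hA⟩ hz v
  have hj : (j.factorial : 𝕜) ≠ 0 := by exact_mod_cast j.factorial_ne_zero
  have expand : ∀ w : Fin j → X.Tangent z,
      ω z w = ∑ r : Fin j → Fin n, (∏ a, X.d (y (r a)) z (w a)) * ω z fun a => D (r a) z := by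
    intro w
    rw [hA]
    conv_lhs => rw [show w = fun a => ∑ i, X.d (y i) z (w a) • D i z from funext fun a => hz (w a)]
    have := A.toMultilinearMap.map_sum (fun (a : Fin j) (i : Fin n) => X.d (y i) z (w a) • D i z)
    refine this.trans (Finset.sum_congr rfl fun r _ => ?_)
    refine (A.toMultilinearMap.map_smul_univ (fun a => X.d (y (r a)) z (w a))
      (fun a => D (r a) z)).trans ?_
    rw [smul_eq_mul, hA]
    rfl
  have hperm : ∀ (σ : Equiv.Perm (Fin j)),
      ((Equiv.Perm.sign σ : ℤ) : 𝕜) * ω z (fun a => v (σ a)) = ω z v := by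
    intro σ
    rw [hA, hA, show (fun a => v (σ a)) = v ∘ σ from rfl, A.map_perm]
    rcases Int.units_eq_one_or (Equiv.Perm.sign σ) with hs | hs <;> simp [hs]
  have hsum : (j.factorial : 𝕜) * ω z v =
      ∑ r : Fin j → Fin n, X.dWedge (fun a => y (r a)) z v * ω z fun a => D (r a) z := by
    have : ∑ σ : Equiv.Perm (Fin j),
        ((Equiv.Perm.sign σ : ℤ) : 𝕜) * ω z (fun a => v (σ a)) = (j.factorial : 𝕜) * ω z v := by
      rw [Finset.sum_congr rfl fun σ _ => hperm σ, Finset.sum_const, Finset.card_univ,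
        Fintype.card_perm, Fintype.card_fin, nsmul_eq_mul]
    rw [← this]
    simp only [dWedge, Matrix.det_apply', Matrix.of_apply]
    rw [Finset.sum_congr rfl fun σ _ => by rw [expand fun a => v (σ a)]]
    simp only [Finset.mul_sum, Finset.sum_mul]
    rw [Finset.sum_comm]
    exact Finset.sum_congr rfl fun r _ => Finset.sum_congr rfl fun σ _ => by ring
  rw [← e.sum_comp]
  simp only [Equiv.symm_apply_apply]
  rw [← mul_right_inj' hj, hsum, Finset.mul_sum]
  refine Finset.sum_congr rfl fun r _ => ?_
  field_simp

/-! ### Independence of the exterior derivative from the representation -/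

theorem sum_perm_eq_zero [CharZero 𝕜] {n : ℕ} (F : Equiv.Perm (Fin n) → 𝕜) {a b : Fin n}
    (hab : a ≠ b) (hF : ∀ τ, F (τ * Equiv.swap a b) = F τ) :
    ∑ τ : Equiv.Perm (Fin n), ((Equiv.Perm.sign τ : ℤ) : 𝕜) * F τ = 0 := by
  have h := Equiv.sum_comp (Equiv.mulRight (Equiv.swap a b))
    fun τ : Equiv.Perm (Fin n) => ((Equiv.Perm.sign τ : ℤ) : 𝕜) * F τ
  simp only [Equiv.coe_mulRight, hF, Equiv.Perm.sign_mul, Equiv.Perm.sign_swap hab] at h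
  simp only [mul_neg, mul_one, Units.val_neg, Int.cast_neg, neg_mul, Finset.sum_neg_distrib] at h
  exact self_eq_neg.mp h.symm

/-- A double antisymmetrization, over all indices and over all but the first, is a single one. -/
theorem sum_perm_decomposeFin {n : ℕ} (F : Equiv.Perm (Fin (n + 1)) → 𝕜) :
    ∑ τ : Equiv.Perm (Fin (n + 1)), ((Equiv.Perm.sign τ : ℤ) : 𝕜) *
        ∑ ρ : Equiv.Perm (Fin n), ((Equiv.Perm.sign ρ : ℤ) : 𝕜) *
          F (τ * Equiv.Perm.decomposeFin.symm (0, ρ)) =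
      (n.factorial : 𝕜) * ∑ τ : Equiv.Perm (Fin (n + 1)), ((Equiv.Perm.sign τ : ℤ) : 𝕜) * F τ := by
  have hre : ∀ ρ : Equiv.Perm (Fin n), ∑ τ : Equiv.Perm (Fin (n + 1)),
      ((Equiv.Perm.sign τ : ℤ) : 𝕜) * (((Equiv.Perm.sign ρ : ℤ) : 𝕜) *
        F (τ * Equiv.Perm.decomposeFin.symm (0, ρ))) =
      ∑ τ : Equiv.Perm (Fin (n + 1)), ((Equiv.Perm.sign τ : ℤ) : 𝕜) * F τ := by
    intro ρ
    rw [← Equiv.sum_comp (Equiv.mulRight (Equiv.Perm.decomposeFin.symm (0, ρ)))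
      fun τ : Equiv.Perm (Fin (n + 1)) => ((Equiv.Perm.sign τ : ℤ) : 𝕜) * F τ]
    refine Finset.sum_congr rfl fun τ _ => ?_
    simp only [Equiv.coe_mulRight, Equiv.Perm.sign_mul, Equiv.Perm.decomposeFin.symm_sign, if_true,
      one_mul, Units.val_mul, Int.cast_mul]
    ring
  rw [Finset.sum_congr rfl fun τ _ => Finset.mul_sum _ _ _, Finset.sum_comm,
    Finset.sum_congr rfl fun ρ _ => hre ρ, Finset.sum_const, Finset.card_univ, Fintype.card_perm,
    Fintype.card_fin, nsmul_eq_mul]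

/-- For commuting vector fields `V₀, …, V_j` and `ω = f dg₁ ∧ … ∧ dg_j`, the antisymmetrization of
`V₀ (ω (V₁, …, V_j))` is `j! df ∧ dg₁ ∧ … ∧ dg_j`: second derivatives of the `g_b` are symmetric. -/
theorem sum_perm_d_eq [CharZero 𝕜] {f : X.Pt → 𝕜} {g : Fin j → X.Pt → 𝕜} (hf : f ∈ X.regAt x)
    (hg : ∀ a, g a ∈ X.regAt x) {V : Fin (j + 1) → X.VectorField} (hV : ∀ a, (V a).RegAt x)
    (hc : ∀ a b, ∀ h ∈ X.regAt x, X.d ((V b).app h) x (V a x) = X.d ((V a).app h) x (V b x)) :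
    ∑ τ : Equiv.Perm (Fin (j + 1)), ((Equiv.Perm.sign τ : ℤ) : 𝕜) *
        X.d (fun z => f z * X.dWedge g z fun a => V (τ a.succ) z) x (V (τ 0) x) =
      (j.factorial : 𝕜) * X.dWedge (Fin.cons f g) x fun a => V a x := by
  have hmem : ∀ (τ : Equiv.Perm (Fin (j + 1))), ∀ b ∈ Finset.univ,
      (V (τ b.succ)).app (g b) ∈ X.regAt x := fun τ b _ => (hV _).mem (hg b)
  -- the derivative of a single product of the determinant
  let F : Equiv.Perm (Fin (j + 1)) → 𝕜 := fun τ =>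
    X.d (fun z => f z * ∏ b, (V (τ b.succ)).app (g b) z) x (V (τ 0) x)
  have hexp : ∀ τ : Equiv.Perm (Fin (j + 1)),
      X.d (fun z => f z * X.dWedge g z fun a => V (τ a.succ) z) x (V (τ 0) x) =
        ∑ ρ : Equiv.Perm (Fin j), ((Equiv.Perm.sign ρ : ℤ) : 𝕜) *
          F (τ * Equiv.Perm.decomposeFin.symm (0, ρ)) := by
    intro τ
    have e1 : (fun z => f z * X.dWedge g z fun a => V (τ a.succ) z) = fun z =>
        ∑ ρ : Equiv.Perm (Fin j), ((Equiv.Perm.sign ρ : ℤ) : 𝕜) *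
          (f z * ∏ b, (V ((τ * Equiv.Perm.decomposeFin.symm (0, ρ)) b.succ)).app (g b) z) := by
      funext z
      rw [dWedge, Matrix.det_apply', Finset.mul_sum]
      refine Finset.sum_congr rfl fun ρ _ => ?_
      simp only [Matrix.of_apply, Equiv.Perm.mul_apply, Equiv.Perm.decomposeFin_symm_apply_succ,
        Equiv.swap_self, Equiv.refl_apply, VectorField.app]
      ring
    have hm : ∀ ρ ∈ (Finset.univ : Finset (Equiv.Perm (Fin j))), (fun z => f z *
        ∏ b, (V ((τ * Equiv.Perm.decomposeFin.symm (0, ρ)) b.succ)).app (g b) z) ∈ X.regAt x :=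
      fun ρ _ => mul_mem' hf (prod_mem' _ (hmem _))
    rw [e1, d_sum _ fun ρ hρ => const_mul_mem' _ (hm ρ hρ)]
    refine Finset.sum_congr rfl fun ρ hρ => ?_
    rw [d_const_mul _ (hm ρ hρ)]
    simp [F]
  rw [Finset.sum_congr rfl fun τ _ => by rw [hexp τ], sum_perm_decomposeFin]
  congr 1
  have hF : ∀ τ, F τ = ∑ b, (f x * (X.d ((V (τ b.succ)).app (g b)) x (V (τ 0) x) *
      ∏ c ∈ Finset.univ.erase b, (V (τ c.succ)).app (g c) x)) +
      X.d f x (V (τ 0) x) * ∏ b, (V (τ b.succ)).app (g b) x := by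
    intro τ
    simp only [F]
    rw [d_mul hf (prod_mem' _ (hmem τ)), d_prod _ (hmem τ), Finset.mul_sum]
    ring
  simp only [hF, mul_add, Finset.mul_sum, Finset.sum_add_distrib]
  rw [Finset.sum_comm, Finset.sum_eq_zero, zero_add]
  · rw [dWedge, Matrix.det_apply']
    refine Finset.sum_congr rfl fun τ _ => ?_
    rw [Fin.prod_univ_succ]
    simp [VectorField.app]
  · intro b _
    refine sum_perm_eq_zero (fun τ => f x * (X.d ((V (τ b.succ)).app (g b)) x (V (τ 0) x) *
      ∏ c ∈ Finset.univ.erase b, (V (τ c.succ)).app (g c) x)) (Fin.succ_ne_zero b).symm fun τ => ?_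
    simp only [Equiv.Perm.mul_apply, Equiv.swap_apply_left, Equiv.swap_apply_right]
    rw [hc _ _ _ (hg b)]
    congr 2
    refine Finset.prod_congr rfl fun c hc => ?_
    rw [Equiv.swap_apply_of_ne_of_ne (Fin.succ_ne_zero c)
      fun h => (Finset.mem_erase.1 hc).1 (Fin.succ_injective _ h)]

/-- The exterior derivative of a form is determined by the form: its values on commuting vector fields
are the antisymmetrizations of the derivatives `V₀ (ω (V₁, …, V_j))`. -/
theorem Represents.factorial_mul_exteriorDerivative [CharZero 𝕜] {ω : X.FormField j}
    {f : Fin N → X.Pt → 𝕜} {g : Fin N → Fin j → X.Pt → 𝕜} (h : Represents ω x f g)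
    {V : Fin (j + 1) → X.VectorField} (hV : ∀ a, (V a).RegAt x)
    (hc : ∀ a b, ∀ h ∈ X.regAt x, X.d ((V b).app h) x (V a x) = X.d ((V a).app h) x (V b x)) :
    (j.factorial : 𝕜) * ∑ i, X.dWedge (Fin.cons (f i) (g i)) x (fun a => V a x) =
      ∑ τ : Equiv.Perm (Fin (j + 1)), ((Equiv.Perm.sign τ : ℤ) : 𝕜) *
        X.d (fun z => ω z fun a => V (τ a.succ) z) x (V (τ 0) x) := by
  rw [Finset.mul_sum, Finset.sum_congr rfl fun i _ => (sum_perm_d_eq (h.1 i) (h.2.1 i) hV hc).symm,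
    Finset.sum_comm]
  refine Finset.sum_congr rfl fun τ _ => ?_
  rw [← Finset.mul_sum, ← d_sum _ fun i _ => mul_mem' (h.1 i) (dWedge_mem (h.2.1 i) fun a => hV _)]
  congr 1
  refine d_congr ?_ _
  filter_upwards [h.2.2] with z hz
  exact (hz _).symm

theorem HasCoordinates.exteriorDerivative_unique [CharZero 𝕜] (hX : HasCoordinates X) {N' : ℕ}
    {ω : X.FormField j} {f : Fin N → X.Pt → 𝕜} {g : Fin N → Fin j → X.Pt → 𝕜}
    {f' : Fin N' → X.Pt → 𝕜} {g' : Fin N' → Fin j → X.Pt → 𝕜} (h : Represents ω x f g)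
    (h' : Represents ω x f' g') (v : Fin (j + 1) → X.Tangent x) :
    ∑ i, X.dWedge (Fin.cons (f i) (g i)) x v = ∑ i, X.dWedge (Fin.cons (f' i) (g' i)) x v := by
  obtain ⟨V, hV, rfl', hc⟩ := hX.exists_commuting x v
  have hj : (j.factorial : 𝕜) ≠ 0 := by exact_mod_cast j.factorial_ne_zero
  rw [show v = fun a => V a x from funext fun a => (rfl' a).symm]
  exact mul_left_cancel₀ hj
    ((h.factorial_mul_exteriorDerivative hV fun a b => (hc a b).self_of_nhds).trans
    (h'.factorial_mul_exteriorDerivative hV fun a b => (hc a b).self_of_nhds).symm)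

end Forms

end FunctionSpace


/-! ### Related vector fields and local fibre products -/

namespace FunctionSpace

section Related

variable {X Y Z T : FunctionSpace.{u} 𝕜}

theorem RegAt.zero (x : X.Pt) : VectorField.RegAt (X := X) (fun _ => 0) x := by
  refine Filter.Eventually.of_forall fun y f _ => ?_
  simpa using const_mem (0 : 𝕜)

theorem lieBracket_zero_right {V : X.VectorField} {x : X.Pt} (hV : V.RegAt x) :
    lieBracket V (fun _ => 0) x = 0 := by
  refine tangent_ext fun f hf => ?_
  rw [d_lieBracket hV (RegAt.zero x) hf, map_zero, map_zero, sub_zero,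
    show VectorField.app (X := X) (fun _ => 0) f = fun _ => 0 from funext fun z => map_zero _, d_const]

theorem lieBracket_zero_left {V : X.VectorField} {x : X.Pt} (hV : V.RegAt x) :
    lieBracket (fun _ => 0) V x = 0 := by
  refine tangent_ext fun f hf => ?_
  rw [d_lieBracket (RegAt.zero x) hV hf, map_zero, map_zero, zero_sub,
    show VectorField.app (X := X) (fun _ => 0) f = fun _ => 0 from funext fun z => map_zero _, d_const,
    neg_zero]

/-- If `V'` is `φ`-related to `V`, then `V' (f ∘ φ) = (V f) ∘ φ`. -/
theorem app_comp_of_related {φ : X.Pt → Y.Pt} (hφ : IsMorphism X Y φ) {x : X.Pt}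
    {V' : X.VectorField} {V : Y.VectorField}
    (h : ∀ᶠ z in 𝓝 x, differential φ z (φ z) (V' z) = V (φ z)) {f : Y.Pt → 𝕜}
    (hf : f ∈ Y.regAt (φ x)) : V'.app (f ∘ φ) =ᶠ[𝓝 x] V.app f ∘ φ := by
  filter_upwards [h, hφ.1.continuousAt.eventually (Y.regAt_nhds hf)] with z hz hfz
  rw [VectorField.app, ← d_differential (hφ.pullsAt z) rfl hfz, hz]
  rfl

/-- The Lie bracket is compatible with related vector fields. -/
theorem differential_lieBracket {φ : X.Pt → Y.Pt} (hφ : IsMorphism X Y φ) {x : X.Pt}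
    {V' W' : X.VectorField} {V W : Y.VectorField} (hV' : V'.RegAt x) (hW' : W'.RegAt x)
    (hV : V.RegAt (φ x)) (hW : W.RegAt (φ x))
    (h : ∀ᶠ z in 𝓝 x, differential φ z (φ z) (V' z) = V (φ z))
    (k : ∀ᶠ z in 𝓝 x, differential φ z (φ z) (W' z) = W (φ z)) :
    differential φ x (φ x) (lieBracket V' W' x) = lieBracket V W (φ x) := by
  refine tangent_ext fun f hf => ?_
  rw [d_differential (hφ.pullsAt x) rfl hf, d_lieBracket hV' hW' (hφ.2 x f hf),
    d_lieBracket hV hW hf, d_congr (app_comp_of_related hφ h hf),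
    d_congr (app_comp_of_related hφ k hf), ← d_differential (hφ.pullsAt x) rfl (hW.mem hf),
    ← d_differential (hφ.pullsAt x) rfl (hV.mem hf), h.self_of_nhds, k.self_of_nhds]

variable {φ : X.Pt → Z.Pt} {ψ : Y.Pt → Z.Pt} {a : T.Pt → X.Pt} {b : T.Pt → Y.Pt}

theorem IsLocalFiberProduct.ext (hT : IsLocalFiberProduct C φ ψ a b) {τ : T.Pt}
    {u u' : T.Tangent τ}
    (ha : differential (Y := X) a τ (a τ) u = differential (Y := X) a τ (a τ) u')
    (hb : differential (Y := Y) b τ (b τ) u = differential (Y := Y) b τ (b τ) u') : u = u' := by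
  refine eq_of_add_neg_one_smul (hT.injective τ (u + (-1 : 𝕜) • u') ?_ ?_)
  · rw [map_add, map_smul, ha, add_neg_one_smul]
  · rw [map_add, map_smul, hb, add_neg_one_smul]

/-- A vector field on a fibre product is regular if it is related to regular vector fields on both
factors. -/
theorem IsLocalFiberProduct.regAt (hC : IsGood C) (hX : C X) (hY : C Y)
    (hT : IsLocalFiberProduct C φ ψ a b) {τ : T.Pt} {U : T.VectorField} {V : X.VectorField}
    {W : Y.VectorField} (hV : V.RegAt (a τ)) (hW : W.RegAt (b τ))
    (hU : ∀ σ, differential (Y := X) a σ (a σ) (U σ) = V (a σ))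
    (hU' : ∀ σ, differential (Y := Y) b σ (b σ) (U σ) = W (b σ)) : U.RegAt τ := by
  obtain ⟨n, c, D, hc⟩ := (hC.coord X hX).exists_frame (a τ)
  obtain ⟨n', c', D', hc'⟩ := (hC.coord Y hY).exists_frame (b τ)
  have e1 : ∀ (U : T.VectorField) (i : Fin n), U.app (c i ∘ a) =ᶠ[𝓝 τ]
      fun z => X.d (c i) (a z) (differential a z (a z) (U z)) := by
    intro U i
    filter_upwards [hT.fst.1.continuousAt.eventually (X.regAt_nhds (hc.mem i))] with z hz
    rw [d_differential (hT.fst.pullsAt z) rfl hz]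
    rfl
  have e2 : ∀ (U : T.VectorField) (i : Fin n'), U.app (c' i ∘ b) =ᶠ[𝓝 τ]
      fun z => Y.d (c' i) (b z) (differential b z (b z) (U z)) := by
    intro U i
    filter_upwards [hT.snd.1.continuousAt.eventually (Y.regAt_nhds (hc'.mem i))] with z hz
    rw [d_differential (hT.snd.pullsAt z) rfl hz]
    rfl
  refine (hC.coord T hT.mem).regAt_of_forms (ι := Fin n ⊕ Fin n')
    (fun i z => i.elim (fun i => X.d (c i) (a z) ∘ₗ differential a z (a z))
      fun i => Y.d (c' i) (b z) ∘ₗ differential b z (b z)) ?_ ?_ ?_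
  · rintro (i | i) U hU
    · exact T.regAt_congr (hU.mem (hT.fst.2 τ _ (hc.mem i))) (e1 U i)
    · exact T.regAt_congr (hU.mem (hT.snd.2 τ _ (hc'.mem i))) (e2 U i)
  · intro v hv
    refine hT.injective τ v ?_ ?_
    · rw [hc.tangent_eq.self_of_nhds (differential a τ (a τ) v)]
      exact Finset.sum_eq_zero fun i _ => by
        rw [show X.d (c i) (a τ) (differential a τ (a τ) v) = 0 from hv (Sum.inl i), zero_smul]
    · rw [hc'.tangent_eq.self_of_nhds (differential b τ (b τ) v)]
      exact Finset.sum_eq_zero fun i _ => by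
        rw [show Y.d (c' i) (b τ) (differential b τ (b τ) v) = 0 from hv (Sum.inr i), zero_smul]
  · rintro (i | i)
    · refine T.regAt_congr (hT.fst.2 τ _ (hV.mem (hc.mem i))) (Filter.Eventually.of_forall fun z => ?_)
      change X.d (c i) (a z) (V (a z)) = X.d (c i) (a z) (differential a z (a z) (U z))
      rw [hU]
    · refine T.regAt_congr (hT.snd.2 τ _ (hW.mem (hc'.mem i))) (Filter.Eventually.of_forall fun z => ?_)
      change Y.d (c' i) (b z) (W (b z)) = Y.d (c' i) (b z) (differential b z (b z) (U z))
      rw [hU']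

variable {ε : X.Pt → (point.{u} 𝕜).Pt} {ε' : Y.Pt → (point.{u} 𝕜).Pt}

/-- Partial derivatives on a product, in the direction of the first factor. -/
theorem IsLocalFiberProduct.d_fst (hX : C X) (hT : IsLocalFiberProduct C ε ε' a b) {τ : T.Pt}
    {u : T.Tangent τ} (hu : differential (Y := Y) b τ (b τ) u = 0) (F : X.Pt → Y.Pt → 𝕜)
    (hF : (fun σ => F (a σ) (b σ)) ∈ T.regAt τ) :
    T.d (fun σ => F (a σ) (b σ)) τ u =
      X.d (fun q => F q (b τ)) (a τ) (differential (Y := X) a τ (a τ) u) := by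
  obtain ⟨c, hc, hp, h1, h2⟩ := hT.exists_map X hX id (fun _ => b τ) isMorphism_id
    (isMorphism_const _) (fun _ => rfl) (a τ) τ rfl rfl
  have hpa : PullsAt T X a (c (a τ)) := hT.fst.pullsAt _
  have hpb : PullsAt T Y b (c (a τ)) := hT.snd.pullsAt _
  have hu' : u = differential c (a τ) τ (differential (Y := X) a τ (a τ) u) := by
    refine hT.ext ?_ ?_
    · rw [← differential_comp hp hc (by rw [← hc]; exact hpa) rfl,
        differential_congr (φ' := fun z => z) (PullsAt.comp hpa hp) h1 (by rw [hc]),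
        differential_id]
    · rw [← differential_comp hp hc (by rw [← hc]; exact hpb) rfl,
        differential_congr (φ' := fun _ => b τ) (PullsAt.comp hpb hp) h2 (by rw [hc]),
        differential_const, hu]
  conv_lhs => rw [hu']
  rw [d_differential hp hc hF]
  refine d_congr ?_ _
  filter_upwards [h1, h2] with q h1 h2
  simp only [Function.comp_apply, h1, h2, id]

/-- Partial derivatives on a product, in the direction of the second factor. -/
theorem IsLocalFiberProduct.d_snd (hY : C Y) (hT : IsLocalFiberProduct C ε ε' a b) {τ : T.Pt}
    {u : T.Tangent τ} (hu : differential (Y := X) a τ (a τ) u = 0) (F : X.Pt → Y.Pt → 𝕜)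
    (hF : (fun σ => F (a σ) (b σ)) ∈ T.regAt τ) :
    T.d (fun σ => F (a σ) (b σ)) τ u =
      Y.d (fun q => F (a τ) q) (b τ) (differential (Y := Y) b τ (b τ) u) := by
  obtain ⟨c, hc, hp, h1, h2⟩ := hT.exists_map Y hY (fun _ => a τ) id (isMorphism_const _)
    isMorphism_id (fun _ => rfl) (b τ) τ rfl rfl
  have hpa : PullsAt T X a (c (b τ)) := hT.fst.pullsAt _
  have hpb : PullsAt T Y b (c (b τ)) := hT.snd.pullsAt _
  have hu' : u = differential c (b τ) τ (differential (Y := Y) b τ (b τ) u) := by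
    refine hT.ext ?_ ?_
    · rw [← differential_comp hp hc (by rw [← hc]; exact hpa) rfl,
        differential_congr (φ' := fun _ => a τ) (PullsAt.comp hpa hp) h1 (by rw [hc]),
        differential_const, hu]
    · rw [← differential_comp hp hc (by rw [← hc]; exact hpb) rfl,
        differential_congr (φ' := fun z => z) (PullsAt.comp hpb hp) h2 (by rw [hc]),
        differential_id]
  conv_lhs => rw [hu']
  rw [d_differential hp hc hF]
  refine d_congr ?_ _
  filter_upwards [h1, h2] with q h1 h2
  simp only [Function.comp_apply, h1, h2, id]

/-- On the product of two spaces, vector fields coming from different factors commute. -/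
theorem IsLocalFiberProduct.exists_commuting_lifts (hC : IsGood C) (hX : C X) (hY : C Y)
    (hT : IsLocalFiberProduct C ε ε' a b) {τ : T.Pt} {V : X.VectorField} {W : Y.VectorField}
    (hV : V.RegAt (a τ)) (hW : W.RegAt (b τ)) :
    ∃ V' W' : T.VectorField, V'.RegAt τ ∧ W'.RegAt τ ∧
      (∀ σ, differential (Y := X) a σ (a σ) (V' σ) = V (a σ)) ∧
      (∀ σ, differential (Y := Y) b σ (b σ) (V' σ) = 0) ∧
      (∀ σ, differential (Y := X) a σ (a σ) (W' σ) = 0) ∧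
      (∀ σ, differential (Y := Y) b σ (b σ) (W' σ) = W (b σ)) ∧
      ∀ f ∈ T.regAt τ, T.d (W'.app f) τ (V' τ) = T.d (V'.app f) τ (W' τ) := by
  have hl : ∀ (σ : T.Pt) (v : X.Tangent (a σ)) (w : Y.Tangent (b σ)), ∃ u : T.Tangent σ,
      differential a σ (a σ) u = v ∧ differential b σ (b σ) u = w := fun σ v w =>
    hT.exists_lift σ v w ((tangent_point_eq_zero _).trans (tangent_point_eq_zero _).symm)
  choose L hL1 hL2 using hl
  have hV' : VectorField.RegAt (X := T) (fun σ => L σ (V (a σ)) 0) τ :=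
    hT.regAt hC hX hY hV (RegAt.zero (b τ)) (fun σ => hL1 _ _ _) fun σ => hL2 _ _ _
  have hW' : VectorField.RegAt (X := T) (fun σ => L σ 0 (W (b σ))) τ :=
    hT.regAt hC hX hY (RegAt.zero (a τ)) hW (fun σ => hL1 _ _ _) fun σ => hL2 _ _ _
  refine ⟨_, _, hV', hW', fun σ => hL1 _ _ _, fun σ => hL2 _ _ _, fun σ => hL1 _ _ _,
    fun σ => hL2 _ _ _, fun f hf => ?_⟩
  have h0 := hT.injective τ (lieBracket (fun σ => L σ (V (a σ)) 0) (fun σ => L σ 0 (W (b σ))) τ)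
    (by
      rw [differential_lieBracket hT.fst hV' hW' hV (RegAt.zero _)
        (Filter.Eventually.of_forall fun σ => hL1 _ _ _)
        (Filter.Eventually.of_forall fun σ => hL1 _ _ _), lieBracket_zero_right hV])
    (by
      rw [differential_lieBracket hT.snd hV' hW' (RegAt.zero _) hW
        (Filter.Eventually.of_forall fun σ => hL2 _ _ _)
        (Filter.Eventually.of_forall fun σ => hL2 _ _ _), lieBracket_zero_left hW])
  have := d_lieBracket hV' hW' hf
  rw [h0, map_zero] at this
  exact sub_eq_zero.mp this.symm

end Related

end FunctionSpace


/-! ### Vertical vectors and horizontal lifts on a principal bundle -/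

namespace PrincipalBundle

variable {𝒳 : LieGroupoid C X₀ X₁} {G E : FunctionSpace.{u} 𝕜} [Group G.Pt]

section Vertical

variable (P : PrincipalBundle 𝒳 G E)

theorem div_self (p : E.Pt) (h : P.π p = P.π p) : P.div p p h = 1 := by
  have key : ∀ (q : E.Pt) (hq : P.π p = P.π q), q = P.act p 1 → P.div p q hq = 1 := by
    rintro q hq rfl
    exact P.div_act p 1
  exact key p h (P.act_one p).symm

theorem morphism_act_right (hG : IsLieGroup C G) (p : E.Pt) : IsMorphism G E fun g => P.act p g :=
  P.morphism_act G hG.mem (fun _ => p) id (isMorphism_const p) isMorphism_id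

theorem morphism_act_left (g : G.Pt) : IsMorphism E E fun p => P.act p g :=
  P.morphism_act E P.mem id (fun _ => g) isMorphism_id (isMorphism_const g)

/-- The vertical vector field of an element of the Lie algebra. -/
noncomputable def vertField (ξ : G.LieAlg) : E.VectorField := fun p => P.vert p ξ

theorem d_vert (hG : IsLieGroup C G) {p : E.Pt} {f : E.Pt → 𝕜} (hf : f ∈ E.regAt p) (ξ : G.LieAlg) :
    E.d f p (P.vert p ξ) = G.d (fun g => f (P.act p g)) 1 ξ :=
  d_differential ((P.morphism_act_right hG p).pullsAt 1) (P.act_one p) hf ξ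

theorem differential_π_vert (hG : IsLieGroup C G) (p : E.Pt) (ξ : G.LieAlg) :
    differential (Y := X₀) P.π p (P.π p) (P.vert p ξ) = 0 := by
  rw [vert, ← differential_comp ((P.morphism_act_right hG p).pullsAt 1) (P.act_one p)
    (P.submersion_π.1.pullsAt p) rfl, show (fun g => P.π (P.act p g)) = fun _ => P.π p from
    funext fun g => P.π_act p g, differential_const]

/-- The kernel of `dπ` consists of the vertical vectors. A vector `v` in the kernel is tangent to the
fibre `T` of `π` through `p`, and on `T` one has `q = p · div (p, q)`. -/
theorem exists_vert (hC : IsGood C) (hG : IsLieGroup C G) {p : E.Pt} (v : E.Tangent p)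
    (hv : differential (Y := X₀) P.π p (P.π p) v = 0) : ∃ ξ, P.vert p ξ = v := by
  obtain ⟨T, a, b, τ, hT, -, rfl⟩ := hC.fiberProduct (point 𝕜) E X₀ hC.point P.mem
    𝒳.mem_objects (fun _ => P.π p) P.π (isMorphism_const _) P.submersion_π PUnit.unit p rfl
  obtain ⟨w, -, rfl⟩ := hT.exists_lift τ 0 v (by rw [map_zero]; exact hv.symm)
  have hg : IsMorphism T G fun σ => P.div (b τ) (b σ) (hT.comm σ) :=
    P.morphism_div T hT.mem (fun _ => b τ) b (isMorphism_const _) hT.snd hT.comm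
  have hg1 : P.div (b τ) (b τ) (hT.comm τ) = 1 := P.div_self _ _
  refine ⟨differential (fun σ => P.div (b τ) (b σ) (hT.comm σ)) τ 1 w, ?_⟩
  rw [vert, ← differential_comp (hg.pullsAt τ) hg1
    ((P.morphism_act_right hG (b τ)).pullsAt 1) (P.act_one _)]
  simp only [P.act_div]

end Vertical

section Lift

variable {P : PrincipalBundle 𝒳 G E} (D : P.Connection)

theorem Connection.eq_zero (hC : IsGood C) (hG : IsLieGroup C G) {p : E.Pt} {v : E.Tangent p}
    (h : differential (Y := X₀) P.π p (P.π p) v = 0) (h' : D.form p v = 0) : v = 0 := by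
  obtain ⟨ξ, rfl⟩ := P.exists_vert hC hG v h
  rw [D.form_vert] at h'
  rw [h', map_zero]

/-- A tangent vector of `E` is determined by its image in `X₀` and its value under the connection
form. -/
theorem Connection.ext (hC : IsGood C) (hG : IsLieGroup C G) {p : E.Pt} {v w : E.Tangent p}
    (h : differential (Y := X₀) P.π p (P.π p) v = differential (Y := X₀) P.π p (P.π p) w)
    (h' : D.form p v = D.form p w) : v = w := by
  refine eq_of_add_neg_one_smul (𝕜 := 𝕜) (D.eq_zero hC hG ?_ ?_)
  · rw [map_add, map_smul, h, add_neg_one_smul]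
  · rw [map_add, map_smul, h', add_neg_one_smul]

/-- Every tangent vector has a horizontal lift: subtract from any lift its vertical part. -/
theorem Connection.lift_spec (hG : IsLieGroup C G) {p : E.Pt} {x : X₀.Pt} (hx : P.π p = x)
    (u : X₀.Tangent x) :
    differential P.π p x (D.lift p x u) = u ∧ D.form p (D.lift p x u) = 0 := by
  subst hx
  have hex : ∃ w : E.Tangent p, differential P.π p (P.π p) w = u ∧ D.form p w = 0 := by
    obtain ⟨w, hw⟩ := P.submersion_π.2 p u
    refine ⟨w + (-1 : 𝕜) • P.vert p (D.form p w), ?_, ?_⟩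
    · rw [map_add, map_smul, P.differential_π_vert hG, smul_zero, add_zero, hw]
    · rw [map_add, map_smul, D.form_vert, add_neg_one_smul]
  exact Classical.epsilon_spec hex

theorem Connection.eq_lift (hC : IsGood C) (hG : IsLieGroup C G) {p : E.Pt} {x : X₀.Pt}
    (hx : P.π p = x) {w : E.Tangent p} {u : X₀.Tangent x} (hw : differential P.π p x w = u)
    (h : D.form p w = 0) : w = D.lift p x u := by
  subst hx
  exact D.ext hC hG (hw.trans (D.lift_spec hG rfl u).1.symm) (h.trans (D.lift_spec hG rfl u).2.symm)

/-- The horizontal lift at `p`, as a linear map. -/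
noncomputable def Connection.liftLinear (hC : IsGood C) (hG : IsLieGroup C G) (p : E.Pt) :
    X₀.Tangent (P.π p) →ₗ[𝕜] E.Tangent p where
  toFun := D.lift p (P.π p)
  map_add' u v := by
    refine (D.eq_lift hC hG rfl ?_ ?_).symm
    · rw [map_add, (D.lift_spec hG rfl u).1, (D.lift_spec hG rfl v).1]
    · rw [map_add, (D.lift_spec hG rfl u).2, (D.lift_spec hG rfl v).2, add_zero]
  map_smul' c u := by
    refine (D.eq_lift hC hG rfl ?_ ?_).symm
    · rw [map_smul, (D.lift_spec hG rfl u).1, RingHom.id_apply]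
    · rw [map_smul, (D.lift_spec hG rfl u).2, smul_zero]

/-- Right translation by `g` preserves horizontal lifts. -/
theorem Connection.differential_act_lift (hC : IsGood C) (hG : IsLieGroup C G) {p : E.Pt} {x : X₀.Pt}
    (hx : P.π p = x) (g : G.Pt) (u : X₀.Tangent x) :
    differential (fun q => P.act q g) p (P.act p g) (D.lift p x u) = D.lift (P.act p g) x u := by
  refine D.eq_lift hC hG ((P.π_act p g).trans hx) ?_ ?_
  · rw [← differential_comp ((P.morphism_act_left g).pullsAt p) rfl
      (P.submersion_π.1.pullsAt _) ((P.π_act p g).trans hx), show (fun q => P.π (P.act q g)) = P.π from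
      funext fun q => P.π_act q g]
    exact (D.lift_spec hG hx u).1
  · rw [D.equivariant, (D.lift_spec hG hx u).2, map_zero]

/-- The base components and the connection form detect whether a vector field on `E` is regular. -/
theorem Connection.regAt_of_components (hC : IsGood C) (hG : IsLieGroup C G) {p : E.Pt}
    {U : E.VectorField}
    (h : ∀ c ∈ X₀.regAt (P.π p),
      (fun z => X₀.d c (P.π z) (differential P.π z (P.π z) (U z))) ∈ E.regAt p)
    (h' : ∀ ℓ : Module.Dual 𝕜 G.LieAlg, (fun z => ℓ (D.form z (U z))) ∈ E.regAt p) : U.RegAt p := by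
  obtain ⟨n, c, F, hc⟩ := (hC.coord X₀ 𝒳.mem_objects).exists_frame (P.π p)
  obtain ⟨r, ⟨B⟩⟩ := (hC.coord G hG.mem).exists_basis 1
  refine (hC.coord E P.mem).regAt_of_forms
    (ι := Fin n ⊕ Fin r)
    (fun i z => i.elim (fun i => X₀.d (c i) (P.π z) ∘ₗ differential P.π z (P.π z))
      fun i => B.coord i ∘ₗ D.form z) ?_ ?_ ?_
  · rintro (i | i) U hU
    · refine E.regAt_congr (hU.mem (P.submersion_π.1.2 p _ (hc.mem i))) ?_
      filter_upwards [P.submersion_π.1.1.continuousAt.eventually (X₀.regAt_nhds (hc.mem i))] with z hz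
      change _ = X₀.d (c i) (P.π z) (differential P.π z (P.π z) (U z))
      rw [d_differential (P.submersion_π.1.pullsAt z) rfl hz]
      rfl
    · obtain ⟨N, f, g, hr⟩ := D.regular (B.coord i) p
      exact hr.mem (V := fun _ => U) fun _ => hU
  · intro v hv
    refine D.eq_zero hC hG ?_ ?_
    · rw [hc.tangent_eq.self_of_nhds (differential P.π p (P.π p) v)]
      exact Finset.sum_eq_zero fun i _ => by
        rw [show X₀.d (c i) (P.π p) (differential P.π p (P.π p) v) = 0 from hv (Sum.inl i), zero_smul]
    · exact (B.forall_coord_eq_zero_iff).1 fun i => hv (Sum.inr i)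
  · rintro (i | i)
    · exact h _ (hc.mem i)
    · exact h' (B.coord i)

theorem Connection.liftField_regAt (hC : IsGood C) (hG : IsLieGroup C G) {p : E.Pt}
    {V : X₀.VectorField} (hV : V.RegAt (P.π p)) : (D.liftField V).RegAt p := by
  refine D.regAt_of_components hC hG (fun c hc => ?_) fun ℓ => ?_
  · refine E.regAt_congr (P.submersion_π.1.2 p _ (hV.mem hc)) (Filter.Eventually.of_forall fun z => ?_)
    change X₀.d c (P.π z) (V (P.π z)) = _
    exact congrArg _ (D.lift_spec hG rfl _).1.symm
  · simp only [liftField, (D.lift_spec hG rfl _).2, map_zero]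
    exact const_mem 0

theorem Connection.vertField_regAt (D : P.Connection) (hC : IsGood C) (hG : IsLieGroup C G)
    (p : E.Pt) (ξ : G.LieAlg) :
    (P.vertField ξ).RegAt p := by
  refine D.regAt_of_components hC hG (fun c hc => ?_) fun ℓ => ?_
  · simp only [vertField, P.differential_π_vert hG, map_zero]
    exact const_mem 0
  · simp only [vertField, D.form_vert]
    exact const_mem _

theorem Connection.differential_liftField (hG : IsLieGroup C G) (V : X₀.VectorField) (p : E.Pt) :
    differential (Y := X₀) P.π p (P.π p) (D.liftField V p) = V (P.π p) :=
  (D.lift_spec hG rfl _).1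

theorem Connection.form_liftField (hG : IsLieGroup C G) (V : X₀.VectorField) (p : E.Pt) :
    D.form p (D.liftField V p) = 0 := (D.lift_spec hG rfl _).2

theorem Connection.differential_act_liftField (hC : IsGood C) (hG : IsLieGroup C G)
    (V : X₀.VectorField) (p : E.Pt) (g : G.Pt) :
    differential (fun q => P.act q g) p (P.act p g) (D.liftField V p) = D.liftField V (P.act p g) := by
  rw [liftField, D.differential_act_lift hC hG rfl, liftField]
  have key : ∀ x, x = P.π p → D.lift (P.act p g) (P.π p) (V (P.π p)) = D.lift (P.act p g) x (V x) := by
    rintro x rfl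
    rfl
  exact key _ (P.π_act p g)

/-- Horizontal lifts are `G`-invariant, so they commute with the vertical vector fields. On `E × G`
the lift of a vector field from `E` commutes with the lift of a vector field from `G`; the map
`(q, g) ↦ q g` relates the first to itself, and along `g = 1` it relates the second to the vertical
vector field. -/
theorem Connection.liftField_vertField_comm (hC : IsGood C) (hG : IsLieGroup C G) {p : E.Pt}
    {V : X₀.VectorField} (hV : V.RegAt (P.π p)) (ξ : G.LieAlg) {f : E.Pt → 𝕜} (hf : f ∈ E.regAt p) :
    E.d ((P.vertField ξ).app f) p (D.liftField V p) =
      E.d ((D.liftField V).app f) p (P.vert p ξ) := by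
  obtain ⟨T, a, b, τ, hT, rfl, hb⟩ := hC.fiberProduct E G (point 𝕜) P.mem hG.mem hC.point
    (fun _ => PUnit.unit) (fun _ => PUnit.unit) (isMorphism_const _)
    ⟨isMorphism_const _, fun x v => ⟨0, by rw [tangent_point_eq_zero v, map_zero]⟩⟩ p 1 rfl
  obtain ⟨W, hW, hW1⟩ := (hC.coord G hG.mem).exists_extension 1 ξ
  obtain ⟨V', W', hV', hW', hV'1, hV'2, hW'1, hW'2, hcomm⟩ := hT.exists_commuting_lifts hC P.mem
    hG.mem (D.liftField_regAt hC hG hV) (hb.symm ▸ hW)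
  have hm : IsMorphism T E fun σ => P.act (a σ) (b σ) :=
    P.morphism_act T hT.mem a b hT.fst hT.snd
  have hmτ : P.act (a τ) (b τ) = a τ := by rw [hb, P.act_one]
  have hFτ : (fun σ => f (P.act (a σ) (b σ))) ∈ T.regAt τ := hm.2 τ f (by simpa only [hmτ] using hf)
  have hF := T.regAt_nhds hFτ
  -- the lift of `V`, applied to `f (q g)`, is `(V f) (q g)`
  have e1 : V'.app (fun σ => f (P.act (a σ) (b σ))) =ᶠ[𝓝 τ]
      fun σ => (D.liftField V).app f (P.act (a σ) (b σ)) := by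
    filter_upwards [hF, hm.1.continuousAt.eventually (hmτ.symm ▸ E.regAt_nhds hf :
      ∀ᶠ q in 𝓝 (P.act (a τ) (b τ)), f ∈ E.regAt q)]
      with σ hσ hfσ
    rw [VectorField.app, hT.d_fst P.mem (hV'2 σ) (fun q g => f (P.act q g)) hσ, hV'1]
    rw [VectorField.app, ← D.differential_act_liftField hC hG,
      d_differential ((P.morphism_act_left (b σ)).pullsAt _) rfl hfσ]
    rfl
  -- the lift of `W`, applied to `f (q g)`, is a function of `q` and `g`, which for `g = 1` is `ξ f`
  let H : E.Pt → G.Pt → 𝕜 := fun q g => G.d (fun g' => f (P.act q g')) g (W g)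
  have e2 : W'.app (fun σ => f (P.act (a σ) (b σ))) =ᶠ[𝓝 τ] fun σ => H (a σ) (b σ) := by
    filter_upwards [hF] with σ hσ
    rw [VectorField.app, hT.d_snd hG.mem (hW'1 σ) (fun q g => f (P.act q g)) hσ, hW'2]
  have e3 : (fun q => H q (b τ)) =ᶠ[𝓝 (a τ)] (P.vertField ξ).app f := by
    filter_upwards [E.regAt_nhds hf] with q hq
    simp only [H]
    rw [hb, hW1, VectorField.app, vertField, P.d_vert hG hq]
  have h1 := hcomm _ hFτ
  rw [d_congr e2, d_congr e1, hT.d_fst P.mem (hV'2 τ) H (T.regAt_congr (hW'.mem hFτ) e2),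
    hT.d_snd hG.mem (hW'1 τ) (fun q g => (D.liftField V).app f (P.act q g))
      (T.regAt_congr (hV'.mem hFτ) e1), hV'1, hW'2, d_congr e3, hb, hW1] at h1
  rw [h1, P.d_vert hG ((D.liftField_regAt hC hG hV).mem hf)]

end Lift

end PrincipalBundle


/-! ### Exterior derivatives of `1`-forms and `2`-forms along vector fields -/

namespace FunctionSpace

section LowDegree

variable {X : FunctionSpace.{u} 𝕜} {x : X.Pt} {j N : ℕ}

theorem Represents.eventually {ω : X.FormField j} {f : Fin N → X.Pt → 𝕜}
    {g : Fin N → Fin j → X.Pt → 𝕜} (h : Represents ω x f g) : ∀ᶠ z in 𝓝 x, Represents ω z f g := by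
  filter_upwards [Filter.eventually_all.2 fun i => X.regAt_nhds (h.1 i),
    Filter.eventually_all.2 fun i => Filter.eventually_all.2 fun a => X.regAt_nhds (h.2.1 i a),
    h.2.2.eventually_nhds] with z h1 h2 h3 using ⟨h1, h2, h3⟩

theorem Represents.d_apply_fields {ω : X.FormField j} {f : Fin N → X.Pt → 𝕜}
    {g : Fin N → Fin j → X.Pt → 𝕜} (h : Represents ω x f g) {V : Fin j → X.VectorField}
    (hV : ∀ a, (V a).RegAt x) (u : X.Tangent x) :
    X.d (fun z => ω z fun a => V a z) x u =
      ∑ i, (f i x * X.d (fun z => X.dWedge (g i) z fun a => V a z) x u +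
        X.dWedge (g i) x (fun a => V a x) * X.d (f i) x u) := by
  rw [d_congr (g := fun z => ∑ i, f i z * X.dWedge (g i) z fun a => V a z)
    (by filter_upwards [h.2.2] with z hz using hz _),
    d_sum _ fun i _ => mul_mem' (h.1 i) (dWedge_mem (h.2.1 i) hV)]
  exact Finset.sum_congr rfl fun i _ => d_mul (h.1 i) (dWedge_mem (h.2.1 i) hV) u

theorem dWedge_cons_one (f : X.Pt → 𝕜) (g : Fin 1 → X.Pt → 𝕜) (u v : X.Tangent x) :
    X.dWedge (Fin.cons f g) x ![u, v] = X.d f x u * X.d (g 0) x v - X.d (g 0) x u * X.d f x v :=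
  Matrix.det_fin_two _

/-- `dω(V, W) = V (ω(W)) - W (ω(V)) - ω([V, W])` for a `1`-form `ω`. -/
theorem Represents.exteriorDerivative_one {ω : X.FormField 1} {f : Fin N → X.Pt → 𝕜}
    {g : Fin N → Fin 1 → X.Pt → 𝕜} (h : Represents ω x f g) {V W : X.VectorField}
    (hV : V.RegAt x) (hW : W.RegAt x) :
    ∑ i, X.dWedge (Fin.cons (f i) (g i)) x ![V x, W x] =
      X.d (fun z => ω z fun _ => W z) x (V x) - X.d (fun z => ω z fun _ => V z) x (W x) -
        ω x fun _ => lieBracket V W x := by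
  rw [h.d_apply_fields (V := fun _ => W) (fun _ => hW), h.d_apply_fields (V := fun _ => V) fun _ => hV,
    h.2.2.self_of_nhds, ← Finset.sum_sub_distrib, ← Finset.sum_sub_distrib]
  refine Finset.sum_congr rfl fun i _ => ?_
  rw [dWedge_cons_one]
  have hg := h.2.1 i 0
  have e : ∀ U : X.VectorField, (fun z => X.d (g i 0) z (U z)) = U.app (g i 0) := fun U => rfl
  simp only [dWedge, Matrix.det_fin_one, Matrix.of_apply, e, d_lieBracket hV hW hg]
  ring

end LowDegree

end FunctionSpace

/-! ### The curvature -/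

namespace PrincipalBundle

variable {𝒳 : LieGroupoid C X₀ X₁} {G E : FunctionSpace.{u} 𝕜} [Group G.Pt]
  {P : PrincipalBundle 𝒳 G E} (D : P.Connection)

/-- The vertical part of the bracket of horizontal lifts is minus the exterior derivative of the
connection form, so it depends only on the values of the vector fields at the point. -/
theorem Connection.form_lieBracket (hC : IsGood C) (hG : IsLieGroup C G) {p : E.Pt}
    (ℓ : Module.Dual 𝕜 G.LieAlg) {N : ℕ} {f : Fin N → E.Pt → 𝕜} {g : Fin N → Fin 1 → E.Pt → 𝕜}
    (h : Represents (X := E) (fun p v => ℓ (D.form p (v 0))) p f g) {V W : X₀.VectorField}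
    (hV : V.RegAt (P.π p)) (hW : W.RegAt (P.π p)) :
    ℓ (D.form p (lieBracket (D.liftField V) (D.liftField W) p)) =
      -∑ i, E.dWedge (Fin.cons (f i) (g i)) p
        ![D.lift p (P.π p) (V (P.π p)), D.lift p (P.π p) (W (P.π p))] := by
  have := h.exteriorDerivative_one (D.liftField_regAt hC hG hV) (D.liftField_regAt hC hG hW)
  simp only [D.form_liftField hG, map_zero, d_const] at this
  change _ = -∑ i, E.dWedge (Fin.cons (f i) (g i)) p ![D.liftField V p, D.liftField W p]
  rw [this]
  ring

theorem Connection.differential_lieBracket_liftField (hC : IsGood C) (hG : IsLieGroup C G) {p : E.Pt}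
    {V W : X₀.VectorField} (hV : V.RegAt (P.π p)) (hW : W.RegAt (P.π p)) :
    differential (Y := X₀) P.π p (P.π p) (lieBracket (D.liftField V) (D.liftField W) p) =
      lieBracket V W (P.π p) :=
  differential_lieBracket P.submersion_π.1 (D.liftField_regAt hC hG hV) (D.liftField_regAt hC hG hW)
    hV hW (Filter.Eventually.of_forall fun z => D.differential_liftField hG V z)
    (Filter.Eventually.of_forall fun z => D.differential_liftField hG W z)

/-- The vertical part of the bracket of two horizontal lifts at a point depends only on the values of
the vector fields at that point, being given by the exterior derivative of the connection form. -/
theorem Connection.form_lieBracket_congr (hC : IsGood C) (hG : IsLieGroup C G) {p : E.Pt}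
    {V W V' W' : X₀.VectorField} (hV : V.RegAt (P.π p)) (hW : W.RegAt (P.π p))
    (hV' : V'.RegAt (P.π p)) (hW' : W'.RegAt (P.π p)) (h1 : V (P.π p) = V' (P.π p))
    (h2 : W (P.π p) = W' (P.π p)) :
    D.form p (lieBracket (D.liftField V) (D.liftField W) p) =
      D.form p (lieBracket (D.liftField V') (D.liftField W') p) := by
  obtain ⟨r, ⟨B⟩⟩ := (hC.coord G hG.mem).exists_basis 1
  refine B.ext_elem fun i => ?_
  obtain ⟨N, f, g, h⟩ := D.regular (B.coord i) p
  have e1 := D.form_lieBracket hC hG (B.coord i) h hV hW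
  have e2 := D.form_lieBracket hC hG (B.coord i) h hV' hW'
  rw [h1, h2] at e1
  exact e1.trans e2.symm

theorem Connection.IsCurvature.eq_form {D : P.Connection} {K : P.AdField} (hK : D.IsCurvature K)
    (hG : IsLieGroup C G) {p : E.Pt} {V W : X₀.VectorField}
    (hV : V.RegAt (P.π p)) (hW : W.RegAt (P.π p)) :
    K (P.π p) ⟨p, rfl⟩ (V (P.π p)) (W (P.π p)) =
      D.form p (lieBracket (D.liftField V) (D.liftField W) p) := by
  have := congrArg (D.form p) (hK.2 (P.π p) V W hV hW ⟨p, rfl⟩)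
  rw [D.form_vert, tangent_sub_eq, map_add, map_smul, (D.lift_spec hG rfl _).2, smul_zero,
    add_zero] at this
  exact this

/-- The curvature is minus the exterior derivative of the connection form on horizontal lifts. -/
theorem Connection.IsCurvature.apply_eq {D : P.Connection} {K : P.AdField} (hK : D.IsCurvature K)
    (hC : IsGood C) (hG : IsLieGroup C G) {p : E.Pt} (ℓ : Module.Dual 𝕜 G.LieAlg) {N : ℕ}
    {f : Fin N → E.Pt → 𝕜} {g : Fin N → Fin 1 → E.Pt → 𝕜}
    (h : Represents (X := E) (fun p v => ℓ (D.form p (v 0))) p f g) (u v : X₀.Tangent (P.π p)) :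
    ℓ (K (P.π p) ⟨p, rfl⟩ u v) = -∑ i, E.dWedge (Fin.cons (f i) (g i)) p
        ![D.lift p (P.π p) u, D.lift p (P.π p) v] := by
  obtain ⟨U, hU, rfl⟩ := (hC.coord X₀ 𝒳.mem_objects).exists_extension (P.π p) u
  obtain ⟨V, hV, rfl⟩ := (hC.coord X₀ 𝒳.mem_objects).exists_extension (P.π p) v
  rw [hK.eq_form hG hU hV, D.form_lieBracket hC hG ℓ h hU hV]

/-- The curvature is the vertical part of the bracket of the horizontal lifts of arbitrary extensions
of the given tangent vectors. -/
theorem Connection.exists_isCurvature (hC : IsGood C) (hG : IsLieGroup C G) :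
    ∃ K, D.IsCurvature K := by
  have := hC.charZero
  have hX := hC.coord X₀ 𝒳.mem_objects
  choose ext hreg hext using fun x => hX.exists_extension x
  let K : P.AdField := fun x p u v =>
    D.form p.1 (lieBracket (D.liftField (ext x u)) (D.liftField (ext x v)) p.1)
  refine ⟨K, ⟨?_, fun ℓ p => ?_⟩, ?_⟩
  · rintro x ⟨p, rfl⟩ g u v
    have hr : ∀ w, (D.liftField (ext (P.π p) w)).RegAt (P.act p g) := fun w =>
      D.liftField_regAt hC hG (by rw [P.π_act]; exact hreg _ _)
    change D.form (P.act p g) (lieBracket _ _ (P.act p g)) = _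
    rw [← differential_lieBracket (P.morphism_act_left g)
      (D.liftField_regAt hC hG (hreg _ _)) (D.liftField_regAt hC hG (hreg _ _)) (hr u) (hr v)
      (Filter.Eventually.of_forall fun z => D.differential_act_liftField hC hG _ z g)
      (Filter.Eventually.of_forall fun z => D.differential_act_liftField hC hG _ z g),
      D.equivariant]
  · obtain ⟨N, f, g, h⟩ := D.regular ℓ p
    have hrep : ∀ᶠ z in 𝓝 p, ∀ v : Fin 2 → E.Tangent z,
        ℓ (K (P.π z) ⟨z, rfl⟩ (differential P.π z (P.π z) (v 0)) (differential P.π z (P.π z) (v 1))) =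
          -∑ i, E.dWedge (Fin.cons (f i) (g i)) z
            fun a => D.lift z (P.π z) (differential P.π z (P.π z) (v a)) := by
      filter_upwards [h.eventually] with z hz v
      change ℓ (D.form z _) = _
      rw [D.form_lieBracket hC hG ℓ hz (hreg _ _) (hreg _ _), hext, hext]
      refine congrArg Neg.neg (Finset.sum_congr rfl fun i _ => congrArg _ (funext fun a => ?_))
      fin_cases a <;> rfl
    refine (hC.coord E P.mem).formRegAt ?_ fun V hV => ?_
    · filter_upwards [hrep] with z hz
      refine ⟨(-∑ i, E.dWedgeAlternating (Fin.cons (f i) (g i)) z).compLinearMap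
        (D.liftLinear hC hG z ∘ₗ differential P.π z (P.π z)), fun v => ?_⟩
      rw [hz, AlternatingMap.compLinearMap_apply, AlternatingMap.neg_apply, alternating_sum_apply]
      rfl
    · have hV' : ∀ a, VectorField.RegAt (X := E)
          (fun z => D.lift z (P.π z) (differential P.π z (P.π z) (V a z))) p := by
        intro a
        refine D.regAt_of_components hC hG (fun c hc => ?_) fun ℓ => ?_
        · refine E.regAt_congr ((hV a).mem (P.submersion_π.1.2 p _ hc)) ?_
          filter_upwards [P.submersion_π.1.1.continuousAt.eventually (X₀.regAt_nhds hc)] with z hz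
          rw [(D.lift_spec hG rfl _).1, d_differential (P.submersion_π.1.pullsAt z) rfl hz]
          rfl
        · simp only [(D.lift_spec hG rfl _).2, map_zero]
          exact const_mem 0
      refine E.regAt_congr (neg_mem' (sum_mem' Finset.univ fun i _ => dWedge_mem
        (g := Fin.cons (f i) (g i)) (fun a => ?_) hV')) ?_
      · refine Fin.cases ?_ (fun a => ?_) a
        · exact h.1 i
        · exact h.2.1 i a
      · filter_upwards [hrep] with z hz
        exact (hz _).symm
  · rintro x V W hV hW ⟨p, rfl⟩
    refine D.ext hC hG ?_ ?_
    · rw [P.differential_π_vert hG, tangent_sub_eq, map_add, map_smul,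
        D.differential_lieBracket_liftField hC hG hV hW, (D.lift_spec hG rfl _).1, add_neg_one_smul]
    · rw [D.form_vert, tangent_sub_eq, map_add, map_smul, (D.lift_spec hG rfl _).2, smul_zero,
        add_zero]
      exact D.form_lieBracket_congr hC hG (hreg _ _) (hreg _ _) hV hW (hext _ _) (hext _ _)

theorem Connection.isCurvature_unique (hC : IsGood C) (hG : IsLieGroup C G) {K K' : P.AdField}
    (hK : D.IsCurvature K) (hK' : D.IsCurvature K') : K = K' := by
  funext x p u v
  obtain ⟨p, rfl⟩ := p
  obtain ⟨U, hU, rfl⟩ := (hC.coord X₀ 𝒳.mem_objects).exists_extension (P.π p) u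
  obtain ⟨V, hV, rfl⟩ := (hC.coord X₀ 𝒳.mem_objects).exists_extension (P.π p) v
  rw [hK.eq_form hG hU hV, hK'.eq_form hG hU hV]

end PrincipalBundle


/-! ### The Bianchi identity -/

namespace PrincipalBundle

variable {𝒳 : LieGroupoid C X₀ X₁} {G E : FunctionSpace.{u} 𝕜} [Group G.Pt]
  {P : PrincipalBundle 𝒳 G E} {D : P.Connection}

theorem Connection.IsCurvature.coord_mem {K : P.AdField} (hK : D.IsCurvature K) (hC : IsGood C)
    (hG : IsLieGroup C G) {p : E.Pt} {V W : X₀.VectorField} (hV : V.RegAt (P.π p))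
    (hW : W.RegAt (P.π p)) (ℓ : Module.Dual 𝕜 G.LieAlg) :
    (fun q => ℓ (K (P.π q) ⟨q, rfl⟩ (V (P.π q)) (W (P.π q)))) ∈ E.regAt p := by
  obtain ⟨N, f, g, h⟩ := hK.1.2 ℓ p
  have := h.mem (V := ![D.liftField V, D.liftField W]) fun a => by
    fin_cases a
    · exact D.liftField_regAt hC hG hV
    · exact D.liftField_regAt hC hG hW
  refine E.regAt_congr this (Filter.Eventually.of_forall fun q => ?_)
  simp only [Matrix.cons_val_zero, Matrix.cons_val_one, D.differential_liftField hG]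

/-- For commuting vector fields `V`, `W` the bracket of the horizontal lifts is the vertical vector
field of `K(V, W)`. -/
theorem Connection.IsCurvature.d_commutator {K : P.AdField} (hK : D.IsCurvature K) (hC : IsGood C)
    (hG : IsLieGroup C G) {r : ℕ} (B : Module.Basis (Fin r) 𝕜 G.LieAlg) {q : E.Pt}
    {V W : X₀.VectorField} (hV : V.RegAt (P.π q)) (hW : W.RegAt (P.π q))
    (hc : ∀ f ∈ X₀.regAt (P.π q), X₀.d (W.app f) (P.π q) (V (P.π q)) =
      X₀.d (V.app f) (P.π q) (W (P.π q))) {f : E.Pt → 𝕜} (hf : f ∈ E.regAt q) :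
    E.d ((D.liftField W).app f) q (D.liftField V q) - E.d ((D.liftField V).app f) q (D.liftField W q) =
      ∑ i, B.coord i (K (P.π q) ⟨q, rfl⟩ (V (P.π q)) (W (P.π q))) * (P.vertField (B i)).app f q := by
  have h0 : lieBracket V W (P.π q) = 0 := by
    refine tangent_ext fun f hf => ?_
    rw [d_lieBracket hV hW hf, hc f hf, sub_self, map_zero]
  have h := hK.2 (P.π q) V W hV hW ⟨q, rfl⟩
  rw [h0, tangent_sub_eq, show D.lift q (P.π q) 0 = 0 from (D.liftLinear hC hG q).map_zero, smul_zero,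
    add_zero] at h
  rw [← d_lieBracket (D.liftField_regAt hC hG hV) (D.liftField_regAt hC hG hW) hf]
  change E.d f q (lieBracket _ _ (⟨q, rfl⟩ : {p : E.Pt // P.π p = P.π q}).1) = _
  rw [← h]
  conv_lhs => rw [← B.sum_repr (K (P.π q) ⟨q, rfl⟩ (V (P.π q)) (W (P.π q)))]
  rw [map_sum, map_sum]
  refine Finset.sum_congr rfl fun i _ => ?_
  rw [map_smul, map_smul]
  rfl

/-- The Bianchi identity. It is the Jacobi identity for the horizontal lifts, because vertical vector
fields commute with horizontal lifts. -/
theorem Connection.IsCurvature.bianchi {K : P.AdField} (hK : D.IsCurvature K) (hC : IsGood C)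
    (hG : IsLieGroup C G) {p : E.Pt} {ι : Type*} {V : ι → X₀.VectorField}
    (hV : ∀ a, (V a).RegAt (P.π p))
    (hc : ∀ a b, ∀ᶠ z in 𝓝 (P.π p), ∀ f ∈ X₀.regAt z,
      X₀.d ((V b).app f) z (V a z) = X₀.d ((V a).app f) z (V b z))
    (ℓ : Module.Dual 𝕜 G.LieAlg) (a b c : ι) :
    E.d (fun q => ℓ (K (P.π q) ⟨q, rfl⟩ (V b (P.π q)) (V c (P.π q)))) p (D.liftField (V a) p) +
      E.d (fun q => ℓ (K (P.π q) ⟨q, rfl⟩ (V c (P.π q)) (V a (P.π q)))) p (D.liftField (V b) p) +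
      E.d (fun q => ℓ (K (P.π q) ⟨q, rfl⟩ (V a (P.π q)) (V b (P.π q)))) p (D.liftField (V c) p) = 0 := by
  obtain ⟨r, ⟨B⟩⟩ := (hC.coord G hG.mem).exists_basis 1
  let κ : ι → ι → Fin r → E.Pt → 𝕜 := fun a b i q =>
    B.coord i (K (P.π q) ⟨q, rfl⟩ (V a (P.π q)) (V b (P.π q)))
  have hκ : ∀ a b i, κ a b i ∈ E.regAt p := fun a b i => hK.coord_mem hC hG (hV a) (hV b) _
  let H : ι → E.VectorField := fun a => D.liftField (V a)
  have hH : ∀ a, (H a).RegAt p := fun a => D.liftField_regAt hC hG (hV a)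
  have hξ : ∀ i, (P.vertField (B i)).RegAt p := fun i => D.vertField_regAt hC hG p _
  -- `[H a, [H b, H c]] f = ∑ i, (H a) (κ b c i) ξ_i f`
  have key : ∀ a b c, ∀ f ∈ E.regAt p,
      E.d ((H b).app ((H c).app f)) p (H a p) - E.d ((H c).app ((H b).app f)) p (H a p) -
        (E.d ((H c).app ((H a).app f)) p (H b p) - E.d ((H b).app ((H a).app f)) p (H c p)) =
      ∑ i, E.d (κ b c i) p (H a p) * E.d f p (P.vert p (B i)) := by
    intro a b c f hf
    have hcomm : (fun q => (H b).app ((H c).app f) q - (H c).app ((H b).app f) q) =ᶠ[𝓝 p]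
        fun q => ∑ i, κ b c i q * (P.vertField (B i)).app f q := by
      have hπ := P.submersion_π.1.1.continuousAt (x := p)
      filter_upwards [hπ.eventually (hV b).eventually, hπ.eventually (hV c).eventually,
        hπ.eventually (hc b c), E.regAt_nhds hf] with q h1 h2 h3 h4
      exact hK.d_commutator hC hG B h1 h2 h3 h4
    rw [← d_sub ((hH b).mem ((hH c).mem hf)) ((hH c).mem ((hH b).mem hf)), d_congr hcomm,
      d_sum _ fun i _ => mul_mem' (hκ b c i) ((hξ i).mem hf),
      hK.d_commutator hC hG B (hV b) (hV c) (hc b c).self_of_nhds ((hH a).mem hf),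
      ← Finset.sum_sub_distrib]
    refine Finset.sum_congr rfl fun i _ => ?_
    rw [d_mul (hκ b c i) ((hξ i).mem hf), D.liftField_vertField_comm hC hG (hV a) (B i) hf]
    simp only [VectorField.app, vertField, κ, H]
    ring
  have hzero : ∑ i, (E.d (κ b c i) p (H a p) + E.d (κ c a i) p (H b p) + E.d (κ a b i) p (H c p)) •
      B i = 0 := by
    rw [← D.form_vert p (∑ i, _), ← (D.form p).map_zero]
    congr 1
    refine tangent_ext fun f hf => ?_
    have h1 := key a b c f hf
    have h2 := key b c a f hf
    have h3 := key c a b f hf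
    have h4 : ∀ x : Fin r → 𝕜, E.d f p (P.vert p (∑ i, x i • B i)) =
        ∑ i, x i * E.d f p (P.vert p (B i)) := fun x => by simp
    rw [h4, map_zero]
    simp only [add_mul, Finset.sum_add_distrib, ← h1, ← h2, ← h3]
    ring
  have hcoord : ∀ i, E.d (κ b c i) p (H a p) + E.d (κ c a i) p (H b p) + E.d (κ a b i) p (H c p) = 0 := by
    intro i
    have := congrArg (B.coord i) hzero
    simpa [Finsupp.single_apply] using this
  have hℓ : ∀ a b : ι, (fun q => ℓ (K (P.π q) ⟨q, rfl⟩ (V a (P.π q)) (V b (P.π q)))) =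
      fun q => ∑ i, ℓ (B i) * κ a b i q := by
    intro a b
    funext q
    conv_lhs => rw [← B.sum_repr (K (P.π q) ⟨q, rfl⟩ (V a (P.π q)) (V b (P.π q)))]
    rw [map_sum]
    exact Finset.sum_congr rfl fun i _ => by rw [map_smul, smul_eq_mul, mul_comm]; rfl
  have hd : ∀ (a b : ι) (u : E.Tangent p), E.d (fun q => ∑ i, ℓ (B i) * κ a b i q) p u =
      ∑ i, ℓ (B i) * E.d (κ a b i) p u := by
    intro a b u
    rw [d_sum _ fun i _ => const_mul_mem' _ (hκ a b i)]
    exact Finset.sum_congr rfl fun i _ => d_const_mul _ (hκ a b i) u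
  rw [hℓ, hℓ, hℓ, hd, hd, hd, ← Finset.sum_add_distrib, ← Finset.sum_add_distrib]
  refine Finset.sum_eq_zero fun i _ => ?_
  rw [← mul_add, ← mul_add, hcoord, mul_zero]

end PrincipalBundle


/-! ### Evaluation of symmetric multilinear forms -/

section EvalPolynomial

variable {L : Type*} [AddCommMonoid L] [Module 𝕜 L] {k r : ℕ}

theorem multilinear_eq_sum (B : Module.Basis (Fin r) 𝕜 L) (ν : MultilinearMap 𝕜 (fun _ : Fin k => L) 𝕜)
    (ξ : Fin k → L) :
    ν ξ = ∑ s : Fin k → Fin r, (∏ a, B.coord (s a) (ξ a)) * ν fun a => B (s a) := by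
  conv_lhs => rw [show ξ = fun a => ∑ i, B.coord i (ξ a) • B i from
    funext fun a => (B.sum_repr (ξ a)).symm]
  rw [ν.map_sum]
  exact Finset.sum_congr rfl fun s _ => by rw [ν.map_smul_univ, smul_eq_mul]

namespace FunctionSpace

variable {X : FunctionSpace.{u} 𝕜} {x : X.Pt}

theorem multilinear_mem (B : Module.Basis (Fin r) 𝕜 L) (ν : MultilinearMap 𝕜 (fun _ : Fin k => L) 𝕜)
    {ξ : X.Pt → Fin k → L} (hξ : ∀ a i, (fun z => B.coord i (ξ z a)) ∈ X.regAt x) :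
    (fun z => ν (ξ z)) ∈ X.regAt x := by
  rw [show (fun z => ν (ξ z)) = fun z => ∑ s : Fin k → Fin r,
      ν (fun a => B (s a)) * ∏ a, B.coord (s a) (ξ z a) from
    funext fun z => (multilinear_eq_sum B ν _).trans (Finset.sum_congr rfl fun s _ => mul_comm _ _)]
  exact sum_mem' _ fun s _ => const_mul_mem' _ (prod_mem' _ fun a _ => hξ a _)

/-- The Leibniz rule for a multilinear form. -/
theorem d_multilinear (B : Module.Basis (Fin r) 𝕜 L) (ν : MultilinearMap 𝕜 (fun _ : Fin k => L) 𝕜)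
    {ξ : X.Pt → Fin k → L} (hξ : ∀ a i, (fun z => B.coord i (ξ z a)) ∈ X.regAt x) (u : X.Tangent x) :
    X.d (fun z => ν (ξ z)) x u =
      ∑ a, ν (Function.update (ξ x) a (∑ i, X.d (fun z => B.coord i (ξ z a)) x u • B i)) := by
  have e : ∀ η : Fin k → L, ν η = ∑ s : Fin k → Fin r,
      ν (fun a => B (s a)) * ∏ a, B.coord (s a) (η a) := fun η =>
    (multilinear_eq_sum B ν _).trans (Finset.sum_congr rfl fun s _ => mul_comm _ _)
  rw [show (fun z => ν (ξ z)) = _ from funext fun z => e _, Finset.sum_congr rfl fun a _ => e _]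
  have hm : ∀ s : Fin k → Fin r, (fun z => ∏ a, B.coord (s a) (ξ z a)) ∈ X.regAt x :=
    fun s => prod_mem' _ fun a _ => hξ a _
  rw [d_sum _ fun s _ => const_mul_mem' _ (hm s), Finset.sum_comm]
  refine Finset.sum_congr rfl fun s _ => ?_
  rw [d_const_mul _ (hm s), d_prod _ fun a _ => hξ a (s a), Finset.mul_sum]
  refine Finset.sum_congr rfl fun a _ => ?_
  congr 1
  rw [← Finset.mul_prod_erase _ _ (Finset.mem_univ a), Function.update_self]
  have h1 : B.coord (s a) (∑ i, X.d (fun z => B.coord i (ξ z a)) x u • B i) =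
      X.d (fun z => B.coord (s a) (ξ z a)) x u := by
    simp [Finsupp.single_apply]
  rw [h1]
  congr 1
  refine Finset.prod_congr rfl fun c hc => ?_
  rw [Function.update_of_ne (Finset.mem_erase.1 hc).1]

end FunctionSpace

/-- The sum over all permutations vanishes if the sums over the orbits of a `3`-cycle do. -/
theorem sum_perm_eq_zero_of_cycle [CharZero 𝕜] {n : ℕ} (F : Equiv.Perm (Fin n) → 𝕜)
    (c : Equiv.Perm (Fin n)) (hc : Equiv.Perm.sign c = 1)
    (hF : ∀ τ, F τ + F (τ * c) + F (τ * (c * c)) = 0) :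
    ∑ τ : Equiv.Perm (Fin n), ((Equiv.Perm.sign τ : ℤ) : 𝕜) * F τ = 0 := by
  have h : ∀ c : Equiv.Perm (Fin n), Equiv.Perm.sign c = 1 →
      ∑ τ : Equiv.Perm (Fin n), ((Equiv.Perm.sign τ : ℤ) : 𝕜) * F (τ * c) =
        ∑ τ : Equiv.Perm (Fin n), ((Equiv.Perm.sign τ : ℤ) : 𝕜) * F τ := by
    intro c hc
    rw [← Equiv.sum_comp (Equiv.mulRight c)
      fun τ : Equiv.Perm (Fin n) => ((Equiv.Perm.sign τ : ℤ) : 𝕜) * F τ]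
    simp only [Equiv.coe_mulRight, Equiv.Perm.sign_mul, hc, mul_one]
  have h3 : (3 : 𝕜) * ∑ τ : Equiv.Perm (Fin n), ((Equiv.Perm.sign τ : ℤ) : 𝕜) * F τ = 0 := by
    rw [show (3 : 𝕜) = 1 + 1 + 1 by norm_num, add_mul, add_mul, one_mul]
    conv_lhs =>
      enter [2]
      rw [← h (c * c) (by rw [Equiv.Perm.sign_mul, hc, one_mul])]
    conv_lhs =>
      enter [1, 2]
      rw [← h c hc]
    rw [← Finset.sum_add_distrib, ← Finset.sum_add_distrib]
    refine Finset.sum_eq_zero fun τ _ => ?_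
    rw [← mul_add, ← mul_add, hF, mul_zero]
  exact (mul_eq_zero.1 h3).resolve_left (by norm_num)

/-- `v ↦ ν (κ (v₀, v₁), κ (v₂, v₃), …)` for a bilinear map `κ`. -/
def evalBilinear {T : Type*} [AddCommMonoid T] [Module 𝕜 T]
    (ν : MultilinearMap 𝕜 (fun _ : Fin k => L) 𝕜) (κ : T →ₗ[𝕜] T →ₗ[𝕜] L) :
    MultilinearMap 𝕜 (fun _ : Fin (2 * k) => T) 𝕜 :=
  have key : ∀ [DecidableEq (Fin (2 * k))] (v : Fin (2 * k) → T) (i : Fin (2 * k)),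
      ∃ (a : Fin k) (l : T →ₗ[𝕜] L), ∀ w : T,
        (fun b : Fin k => κ (Function.update v i w ⟨2 * b.1, by omega⟩)
          (Function.update v i w ⟨2 * b.1 + 1, by omega⟩)) =
        Function.update (fun b : Fin k => κ (v ⟨2 * b.1, by omega⟩) (v ⟨2 * b.1 + 1, by omega⟩)) a
          (l w) := by
    intro _ v i
    obtain ⟨i, hi⟩ := i
    rcases Nat.even_or_odd' i with ⟨m, hm | hm⟩
    · have ha : m < k := by omega
      refine ⟨⟨m, ha⟩, κ.flip (v ⟨2 * m + 1, by omega⟩), fun w => ?_⟩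
      subst hm
      funext b
      by_cases hb : b = ⟨m, ha⟩
      · subst hb
        rw [Function.update_self, Function.update_self, Function.update_of_ne (by simp), LinearMap.flip_apply]
      · have : b.1 ≠ m := fun h => hb (Fin.ext h)
        rw [Function.update_of_ne hb, Function.update_of_ne (by simpa using this), Function.update_of_ne
          (by simp only [ne_eq, Fin.mk.injEq]; omega)]
    · have ha : m < k := by omega
      refine ⟨⟨m, ha⟩, κ (v ⟨2 * m, by omega⟩), fun w => ?_⟩
      subst hm
      funext b
      by_cases hb : b = ⟨m, ha⟩
      · subst hb
        rw [Function.update_self, Function.update_self, Function.update_of_ne (by simp)]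
      · have : b.1 ≠ m := fun h => hb (Fin.ext h)
        rw [Function.update_of_ne hb, Function.update_of_ne
          (by simp only [ne_eq, Fin.mk.injEq]; omega), Function.update_of_ne (by simpa using this)]
  { toFun := fun v => ν fun b : Fin k => κ (v ⟨2 * b.1, by omega⟩) (v ⟨2 * b.1 + 1, by omega⟩)
    map_update_add' := fun v i w w' => by
      obtain ⟨a, l, h⟩ := key v i
      simp only [h, map_add, ν.map_update_add]
    map_update_smul' := fun v i c w => by
      obtain ⟨a, l, h⟩ := key v i
      simp only [h, map_smul, ν.map_update_smul] }

/-- The evaluation of a multilinear form on an alternating bilinear map is alternating. -/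
theorem exists_alternating_evalPolynomial {T L : Type u} [AddCommGroup L] [Module 𝕜 L] [AddCommMonoid T]
    [Module 𝕜 T] (ν : MultilinearMap 𝕜 (fun _ : Fin k => L) 𝕜) (κ : T →ₗ[𝕜] T →ₗ[𝕜] L) :
    ∃ A : T [⋀^Fin (2 * k)]→ₗ[𝕜] 𝕜, ∀ v, evalPolynomial ν (fun u w => κ u w) v = A v := by
  refine ⟨((2 : 𝕜) ^ k)⁻¹ • MultilinearMap.alternatization (evalBilinear ν κ), fun v => ?_⟩
  rw [AlternatingMap.smul_apply, MultilinearMap.alternatization_apply, smul_eq_mul, evalPolynomial]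
  congr 1
  refine Finset.sum_congr rfl fun τ _ => ?_
  rw [Units.smul_def, zsmul_eq_mul]
  rfl

end EvalPolynomial


/-! ### The Chern-Weil forms -/

namespace PrincipalBundle

variable {𝒳 : LieGroupoid C X₀ X₁} {G E : FunctionSpace.{u} 𝕜} [Group G.Pt]
  {P : PrincipalBundle 𝒳 G E} {D : P.Connection} {K : P.AdField}

theorem Connection.IsCurvature.exists_bilinear (hK : D.IsCurvature K) (hC : IsGood C)
    (hG : IsLieGroup C G) (p : E.Pt) :
    ∃ κ : X₀.Tangent (P.π p) →ₗ[𝕜] X₀.Tangent (P.π p) →ₗ[𝕜] G.LieAlg,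
      ∀ u v, K (P.π p) ⟨p, rfl⟩ u v = κ u v := by
  obtain ⟨r, ⟨B⟩⟩ := (hC.coord G hG.mem).exists_basis 1
  choose N f g h using fun i => D.regular (B.coord i) p
  have e : ∀ i u v, B.coord i (K (P.π p) ⟨p, rfl⟩ u v) = -∑ l,
      (E.d (f i l) p (D.liftLinear hC hG p u) * E.d (g i l 0) p (D.liftLinear hC hG p v) -
        E.d (g i l 0) p (D.liftLinear hC hG p u) * E.d (f i l) p (D.liftLinear hC hG p v)) := by
    intro i u v
    rw [hK.apply_eq hC hG (B.coord i) (h i)]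
    exact congrArg Neg.neg (Finset.sum_congr rfl fun l _ => dWedge_cons_one _ _ _ _)
  refine ⟨LinearMap.mk₂ 𝕜 (fun u v => K (P.π p) ⟨p, rfl⟩ u v) ?_ ?_ ?_ ?_, fun _ _ => rfl⟩
  · refine fun u u' v => B.ext_elem fun i => ?_
    change B.coord i _ = B.coord i _
    rw [map_add, e, e, e, ← neg_add, ← Finset.sum_add_distrib]
    exact congrArg Neg.neg (Finset.sum_congr rfl fun l _ => by simp only [map_add]; ring)
  · refine fun c u v => B.ext_elem fun i => ?_
    change B.coord i _ = B.coord i _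
    rw [map_smul, e, e, smul_eq_mul, mul_neg, Finset.mul_sum]
    exact congrArg Neg.neg (Finset.sum_congr rfl fun l _ => by
      simp only [map_smul, smul_eq_mul]; ring)
  · refine fun u v v' => B.ext_elem fun i => ?_
    change B.coord i _ = B.coord i _
    rw [map_add, e, e, e, ← neg_add, ← Finset.sum_add_distrib]
    exact congrArg Neg.neg (Finset.sum_congr rfl fun l _ => by simp only [map_add]; ring)
  · refine fun c u v => B.ext_elem fun i => ?_
    change B.coord i _ = B.coord i _
    rw [map_smul, e, e, smul_eq_mul, mul_neg, Finset.mul_sum]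
    exact congrArg Neg.neg (Finset.sum_congr rfl fun l _ => by
      simp only [map_smul, smul_eq_mul]; ring)

/-- Since `ν` is invariant, `ν (K)` does not depend on the point of the fibre in which `K` is written. -/
theorem IsAdForm.evalPolynomial_eq (hK : IsAdForm K) {k : ℕ}
    {ν : MultilinearMap 𝕜 (fun _ : Fin k => G.LieAlg) 𝕜} (hν : IsInvariantSymmetric G ν) (x : X₀.Pt)
    (p q : {p : E.Pt // P.π p = x}) (v : Fin (2 * k) → X₀.Tangent x) :
    evalPolynomial ν (K x p) v = evalPolynomial ν (K x q) v := by
  obtain ⟨p, hp⟩ := p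
  obtain ⟨q, hq⟩ := q
  obtain ⟨g, rfl⟩ : ∃ g, P.act p g = q := ⟨P.div p q (hp.trans hq.symm), P.act_div _ _ _⟩
  rw [evalPolynomial, evalPolynomial]
  congr 1
  refine Finset.sum_congr rfl fun τ _ => ?_
  congr 1
  simp only [hK.1 x ⟨p, hp⟩ g]
  exact (hν.2 g⁻¹ _).symm

theorem Connection.IsCurvature.multilinear_mem (hK : D.IsCurvature K) (hC : IsGood C)
    (hG : IsLieGroup C G) {p : E.Pt} {k n : ℕ} (ν : MultilinearMap 𝕜 (fun _ : Fin k => G.LieAlg) 𝕜)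
    {V : Fin n → X₀.VectorField} (hV : ∀ a, (V a).RegAt (P.π p)) (i j : Fin k → Fin n) :
    (fun q => ν fun a => K (P.π q) ⟨q, rfl⟩ (V (i a) (P.π q)) (V (j a) (P.π q))) ∈ E.regAt p := by
  obtain ⟨r, ⟨B⟩⟩ := (hC.coord G hG.mem).exists_basis 1
  exact FunctionSpace.multilinear_mem B ν fun a l => hK.coord_mem hC hG (hV _) (hV _) _

/-- The antisymmetrization of the derivatives of `ν (K (V₁, V₂), K (V₃, V₄), …)` along the horizontal
lift of `V₀` vanishes, by the Leibniz rule and the Bianchi identity. -/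
theorem Connection.IsCurvature.sum_perm_d_eq_zero (hK : D.IsCurvature K) (hC : IsGood C)
    (hG : IsLieGroup C G) {p : E.Pt} {k : ℕ} (ν : MultilinearMap 𝕜 (fun _ : Fin k => G.LieAlg) 𝕜)
    {V : Fin (2 * k + 1) → X₀.VectorField} (hV : ∀ a, (V a).RegAt (P.π p))
    (hc : ∀ a b, ∀ᶠ z in 𝓝 (P.π p), ∀ f ∈ X₀.regAt z,
      X₀.d ((V b).app f) z (V a z) = X₀.d ((V a).app f) z (V b z)) :
    ∑ τ : Equiv.Perm (Fin (2 * k + 1)), ((Equiv.Perm.sign τ : ℤ) : 𝕜) *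
      E.d (fun q => ν fun a : Fin k => K (P.π q) ⟨q, rfl⟩
        (V (τ (Fin.succ ⟨2 * a.1, by omega⟩)) (P.π q))
        (V (τ (Fin.succ ⟨2 * a.1 + 1, by omega⟩)) (P.π q))) p (D.liftField (V (τ 0)) p) = 0 := by
  have := hC.charZero
  obtain ⟨r, ⟨B⟩⟩ := (hC.coord G hG.mem).exists_basis 1
  let κ : Fin (2 * k + 1) → Fin (2 * k + 1) → G.LieAlg := fun a b =>
    K (P.π p) ⟨p, rfl⟩ (V a (P.π p)) (V b (P.π p))
  let δ : Fin (2 * k + 1) → Fin (2 * k + 1) → Fin (2 * k + 1) → G.LieAlg := fun a b c =>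
    ∑ i, E.d (fun q => B.coord i (K (P.π q) ⟨q, rfl⟩ (V b (P.π q)) (V c (P.π q)))) p
      (D.liftField (V a) p) • B i
  have hδ : ∀ a b c, δ a b c + δ b c a + δ c a b = 0 := by
    intro a b c
    simp only [δ]
    rw [← Finset.sum_add_distrib, ← Finset.sum_add_distrib]
    refine Finset.sum_eq_zero fun i _ => ?_
    rw [← add_smul, ← add_smul, hK.bianchi hC hG hV hc (B.coord i) a b c, zero_smul]
  have hL : ∀ τ : Equiv.Perm (Fin (2 * k + 1)),
      E.d (fun q => ν fun a : Fin k => K (P.π q) ⟨q, rfl⟩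
        (V (τ (Fin.succ ⟨2 * a.1, by omega⟩)) (P.π q))
        (V (τ (Fin.succ ⟨2 * a.1 + 1, by omega⟩)) (P.π q))) p (D.liftField (V (τ 0)) p) =
      ∑ m : Fin k, ν (Function.update (fun a : Fin k => κ (τ (Fin.succ ⟨2 * a.1, by omega⟩))
        (τ (Fin.succ ⟨2 * a.1 + 1, by omega⟩))) m
          (δ (τ 0) (τ (Fin.succ ⟨2 * m.1, by omega⟩)) (τ (Fin.succ ⟨2 * m.1 + 1, by omega⟩)))) :=
    fun τ => d_multilinear B ν (fun a l => hK.coord_mem hC hG (hV _) (hV _) _) _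
  simp only [hL, Finset.mul_sum]
  rw [Finset.sum_comm]
  refine Finset.sum_eq_zero fun m _ => ?_
  -- the `3`-cycle of the three indices in the derivative of the factor `m`
  set i : Fin (2 * k + 1) := Fin.succ ⟨2 * m.1, by omega⟩ with hi
  set j : Fin (2 * k + 1) := Fin.succ ⟨2 * m.1 + 1, by omega⟩ with hj
  have hi0 : i ≠ 0 := Fin.succ_ne_zero _
  have hj0 : j ≠ 0 := Fin.succ_ne_zero _
  have hij : i ≠ j := by simp [hi, hj]
  let c : Equiv.Perm (Fin (2 * k + 1)) := Equiv.swap 0 j * Equiv.swap 0 i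
  have c0 : c 0 = i := by
    simp only [c, Equiv.Perm.mul_apply, Equiv.swap_apply_left]
    exact Equiv.swap_apply_of_ne_of_ne hi0 hij
  have ci : c i = j := by simp [c]
  have cj : c j = 0 := by
    simp only [c, Equiv.Perm.mul_apply]
    rw [Equiv.swap_apply_of_ne_of_ne hj0 hij.symm, Equiv.swap_apply_right]
  have ce : ∀ l, l ≠ 0 → l ≠ i → l ≠ j → c l = l := fun l h1 h2 h3 => by
    simp only [c, Equiv.Perm.mul_apply]
    rw [Equiv.swap_apply_of_ne_of_ne h1 h2, Equiv.swap_apply_of_ne_of_ne h1 h3]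
  refine sum_perm_eq_zero_of_cycle (fun τ => ν (Function.update
    (fun a : Fin k => κ (τ (Fin.succ ⟨2 * a.1, by omega⟩)) (τ (Fin.succ ⟨2 * a.1 + 1, by omega⟩))) m
      (δ (τ 0) (τ i) (τ j)))) c ?_ fun τ => ?_
  · simp only [c]
    rw [Equiv.Perm.sign_mul, Equiv.Perm.sign_swap hj0.symm, Equiv.Perm.sign_swap hi0.symm]
    rfl
  have hu : ∀ (w : G.LieAlg) (σ : Equiv.Perm (Fin (2 * k + 1))),
      (∀ l, l ≠ 0 → l ≠ i → l ≠ j → σ l = l) →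
      Function.update (fun a : Fin k => κ ((τ * σ) (Fin.succ ⟨2 * a.1, by omega⟩))
        ((τ * σ) (Fin.succ ⟨2 * a.1 + 1, by omega⟩))) m w =
      Function.update (fun a : Fin k => κ (τ (Fin.succ ⟨2 * a.1, by omega⟩))
        (τ (Fin.succ ⟨2 * a.1 + 1, by omega⟩))) m w := by
    intro w σ hσ
    funext a
    by_cases ha : a = m
    · subst ha
      rw [Function.update_self, Function.update_self]
    · have ha' : a.1 ≠ m.1 := fun h => ha (Fin.ext h)
      rw [Function.update_of_ne ha, Function.update_of_ne ha, Equiv.Perm.mul_apply,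
        Equiv.Perm.mul_apply, hσ _ (Fin.succ_ne_zero _), hσ _ (Fin.succ_ne_zero _)]
      all_goals simp only [hi, hj, ne_eq, Fin.succ_inj, Fin.mk.injEq]; omega
  rw [hu _ c ce, hu _ (c * c) fun l h1 h2 h3 => by
    rw [Equiv.Perm.mul_apply, ce l h1 h2 h3, ce l h1 h2 h3]]
  simp only [Equiv.Perm.mul_apply, c0, ci, cj]
  rw [← ν.map_update_add, ← ν.map_update_add, hδ]
  exact ν.map_coord_zero m (Function.update_self _ _ _)

/-- The form `ν (K)` is regular because its values on regular vector fields are so after pullback to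
`E`. Its exterior derivative, on commuting vector fields, is an antisymmetrization of derivatives along
horizontal lifts. -/
theorem Connection.IsCurvature.chernWeil (hK : D.IsCurvature K) (hC : IsGood C)
    (hG : IsLieGroup C G) {k : ℕ} {ν : MultilinearMap 𝕜 (fun _ : Fin k => G.LieAlg) 𝕜}
    {ω : X₀.FormField (2 * k)}
    (hω : ∀ (x : X₀.Pt) (p : {p : E.Pt // P.π p = x}) (v : Fin (2 * k) → X₀.Tangent x),
      ω x v = evalPolynomial ν (K x p) v) : IsClosedForm ω := by
  have := hC.charZero
  have hX := hC.coord X₀ 𝒳.mem_objects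
  have hmem : ∀ (p : E.Pt) (V : Fin (2 * k) → X₀.VectorField), (∀ a, (V a).RegAt (P.π p)) →
      (fun z => ω z fun a => V a z) ∈ X₀.regAt (P.π p) := by
    intro p V hV
    refine hC.descent E X₀ P.mem 𝒳.mem_objects P.π P.submersion_π p _ ?_
    rw [show (fun z => ω z fun a => V a z) ∘ P.π = fun q => ((2 : 𝕜) ^ k)⁻¹ *
      ∑ τ : Equiv.Perm (Fin (2 * k)), ((Equiv.Perm.sign τ : ℤ) : 𝕜) *
      ν fun a : Fin k => K (P.π q) ⟨q, rfl⟩ (V (τ ⟨2 * a.1, by omega⟩) (P.π q))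
        (V (τ ⟨2 * a.1 + 1, by omega⟩) (P.π q)) from funext fun q => hω _ ⟨q, rfl⟩ _]
    exact const_mul_mem' _ (sum_mem' _ fun τ _ => const_mul_mem' _
      (hK.multilinear_mem hC hG ν hV (fun a => τ ⟨2 * a.1, by omega⟩)
        fun a => τ ⟨2 * a.1 + 1, by omega⟩))
  refine ⟨fun x => ?_, fun x N f g h v => ?_⟩
  · refine hX.formRegAt (Filter.Eventually.of_forall fun z => ?_) fun V hV => ?_
    · obtain ⟨q, rfl⟩ := P.surjective_π z
      obtain ⟨κ, hκ⟩ := hK.exists_bilinear hC hG q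
      obtain ⟨A, hA⟩ := exists_alternating_evalPolynomial (L := G.LieAlg) ν κ
      refine ⟨A, fun v => (hω _ ⟨q, rfl⟩ v).trans (Eq.trans ?_ (hA v))⟩
      rw [show K (P.π q) ⟨q, rfl⟩ = fun u w => κ u w from funext fun u => funext fun w => hκ u w]
    · obtain ⟨p, rfl⟩ := P.surjective_π x
      exact hmem p V hV
  · obtain ⟨p, rfl⟩ := P.surjective_π x
    obtain ⟨V, hV, rfl', hc⟩ := hX.exists_commuting (P.π p) v
    have hfac : ((2 * k).factorial : 𝕜) ≠ 0 := by exact_mod_cast (2 * k).factorial_ne_zero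
    rw [show v = fun a => V a (P.π p) from funext fun a => (rfl' a).symm]
    refine (mul_left_cancel₀ hfac ?_).symm
    rw [h.factorial_mul_exteriorDerivative hV fun a b => (hc a b).self_of_nhds, mul_zero]
    let Φ : Equiv.Perm (Fin (2 * k + 1)) → 𝕜 := fun τ =>
      E.d (fun q => ν fun a : Fin k => K (P.π q) ⟨q, rfl⟩
        (V (τ (Fin.succ ⟨2 * a.1, by omega⟩)) (P.π q))
        (V (τ (Fin.succ ⟨2 * a.1 + 1, by omega⟩)) (P.π q))) p (D.liftField (V (τ 0)) p)
    have hexp : ∀ τ : Equiv.Perm (Fin (2 * k + 1)),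
        X₀.d (fun z => ω z fun a => V (τ a.succ) z) (P.π p) (V (τ 0) (P.π p)) =
          ((2 : 𝕜) ^ k)⁻¹ * ∑ ρ : Equiv.Perm (Fin (2 * k)), ((Equiv.Perm.sign ρ : ℤ) : 𝕜) *
            Φ (τ * Equiv.Perm.decomposeFin.symm (0, ρ)) := by
      intro τ
      have hm : ∀ ρ ∈ (Finset.univ : Finset (Equiv.Perm (Fin (2 * k)))),
          (fun q => ν fun a : Fin k => K (P.π q) ⟨q, rfl⟩
            (V (τ (ρ ⟨2 * a.1, by omega⟩).succ) (P.π q))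
            (V (τ (ρ ⟨2 * a.1 + 1, by omega⟩).succ) (P.π q))) ∈ E.regAt p :=
        fun ρ _ => hK.multilinear_mem hC hG ν hV (fun a => τ (ρ ⟨2 * a.1, by omega⟩).succ)
          fun a => τ (ρ ⟨2 * a.1 + 1, by omega⟩).succ
      rw [← D.differential_liftField hG (V (τ 0)) p, d_differential (P.submersion_π.1.pullsAt p) rfl
        (hmem p _ fun a => hV _)]
      rw [show (fun z => ω z fun a => V (τ a.succ) z) ∘ P.π = fun q => ((2 : 𝕜) ^ k)⁻¹ *
        ∑ ρ : Equiv.Perm (Fin (2 * k)), ((Equiv.Perm.sign ρ : ℤ) : 𝕜) *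
        ν fun a : Fin k => K (P.π q) ⟨q, rfl⟩ (V (τ (ρ ⟨2 * a.1, by omega⟩).succ) (P.π q))
          (V (τ (ρ ⟨2 * a.1 + 1, by omega⟩).succ) (P.π q)) from funext fun q => hω _ ⟨q, rfl⟩ _,
        d_const_mul _ (sum_mem' _ fun ρ hρ => const_mul_mem' _ (hm ρ hρ)),
        d_sum _ fun ρ hρ => const_mul_mem' _ (hm ρ hρ)]
      congr 1
      refine Finset.sum_congr rfl fun ρ hρ => ?_
      rw [d_const_mul _ (hm ρ hρ)]
      simp only [Φ, Equiv.Perm.mul_apply, Equiv.Perm.decomposeFin_symm_apply_succ,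
        Equiv.Perm.decomposeFin_symm_apply_zero, Equiv.swap_self, Equiv.refl_apply]
    rw [Finset.sum_congr rfl fun τ _ => by rw [hexp τ, mul_left_comm], ← Finset.mul_sum,
      sum_perm_decomposeFin, hK.sum_perm_d_eq_zero hC hG ν hV hc, mul_zero, mul_zero]

/-! ### Invariance under the groupoid -/

/-- The curvature is invariant under the action of the groupoid, because the connection form has the
same pullbacks under the source and the target map of `X₁ ×_{X₀} E`. -/
theorem Connection.IsCurvature.source_eq_target (hK : D.IsCurvature K) (hC : IsGood C)
    (hG : IsLieGroup C G) {y : X₁.Pt} {p : E.Pt} (hyp : 𝒳.s y = P.π p) (w w' : X₁.Tangent y) :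
    K (𝒳.s y) ⟨p, hyp.symm⟩ (differential 𝒳.s y (𝒳.s y) w) (differential 𝒳.s y (𝒳.s y) w') =
      K (𝒳.t y) ⟨P.σ y p hyp, P.π_σ y p hyp⟩ (differential 𝒳.t y (𝒳.t y) w)
        (differential 𝒳.t y (𝒳.t y) w') := by
  have := hC.charZero
  obtain ⟨T, a, b, τ, hT, rfl, rfl⟩ := hC.fiberProduct X₁ E X₀ 𝒳.mem_arrows P.mem 𝒳.mem_objects
    𝒳.s P.π 𝒳.submersion_s.1 P.submersion_π y p hyp
  -- the second projection and the action are the two maps from the fibre product to `E`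
  let c : T.Pt → E.Pt := fun τ => P.σ (a τ) (b τ) (hT.comm τ)
  have hc : IsMorphism T E c := P.morphism_σ T hT.mem a b hT.fst hT.snd hT.comm
  have hform := D.source_eq_target T hT.mem a b hT.fst hT.snd hT.comm
  have hcπ : ∀ σ, P.π (c σ) = 𝒳.t (a σ) := fun σ => P.π_σ _ _ _
  have hlift : ∀ w : X₁.Tangent (a τ), ∃ u : T.Tangent τ,
      differential b τ (b τ) u = D.lift (b τ) (P.π (b τ)) (differential 𝒳.s (a τ) (P.π (b τ)) w) ∧
      differential c τ (c τ) u = D.lift (c τ) (P.π (c τ)) (differential 𝒳.t (a τ) (P.π (c τ)) w) := by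
    intro w
    obtain ⟨u, hu, hu'⟩ := hT.exists_lift τ w
      (D.lift (b τ) (𝒳.s (a τ)) (differential 𝒳.s (a τ) (𝒳.s (a τ)) w))
      (D.lift_spec hG hyp.symm _).1.symm
    have hu'' : differential b τ (b τ) u =
        D.lift (b τ) (P.π (b τ)) (differential 𝒳.s (a τ) (P.π (b τ)) w) := by
      rw [hu']
      exact congrArg (fun x => D.lift (b τ) x (differential 𝒳.s (a τ) x w)) hyp
    refine ⟨u, hu'', D.eq_lift hC hG rfl ?_ ?_⟩
    · rw [← differential_comp (hc.pullsAt τ) rfl (P.submersion_π.1.pullsAt _) rfl, ← hu,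
        ← differential_comp (hT.fst.pullsAt τ) rfl (𝒳.morphism_t.pullsAt _) (hcπ τ).symm]
      exact congrArg (fun F => differential F τ (P.π (c τ)) u) (funext hcπ)
    · exact (hform τ u).symm.trans (by rw [hu'', (D.lift_spec hG rfl _).2])
  -- the images of `u` and `u'` under both maps are horizontal, so that the curvature at both images is
  -- minus the exterior derivative of one and the same form on `T`
  obtain ⟨u, hu, hcu⟩ := hlift w
  obtain ⟨u', hu', hcu'⟩ := hlift w'
  have main : K (P.π (b τ)) ⟨b τ, rfl⟩ (differential 𝒳.s (a τ) (P.π (b τ)) w)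
      (differential 𝒳.s (a τ) (P.π (b τ)) w') =
      K (P.π (c τ)) ⟨c τ, rfl⟩ (differential 𝒳.t (a τ) (P.π (c τ)) w)
        (differential 𝒳.t (a τ) (P.π (c τ)) w') := by
    obtain ⟨r, ⟨B⟩⟩ := (hC.coord G hG.mem).exists_basis 1
    refine B.ext_elem fun i => ?_
    change B.coord i _ = B.coord i _
    obtain ⟨N, f, g, h⟩ := D.regular (B.coord i) (b τ)
    obtain ⟨N', f', g', h'⟩ := D.regular (B.coord i) (c τ)
    rw [hK.apply_eq hC hG _ h, hK.apply_eq hC hG _ h', ← hu, ← hu', ← hcu, ← hcu']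
    have hb := h.pullback hT.snd
    have hb' := h'.pullback hc
    rw [show pullback c (fun p v => B.coord i (D.form p (v 0))) =
        pullback (X := T) (Y := E) (j := 1) b fun p v => B.coord i (D.form p (v 0)) from
      funext fun σ => funext fun v => congrArg (B.coord i) (hform σ (v 0)).symm] at hb'
    have key := (hC.coord T hT.mem).exteriorDerivative_unique hb hb' ![u, u']
    simp only [dWedge_cons_one] at key ⊢
    refine congrArg Neg.neg (Eq.trans ?_ (key.trans ?_))
    · exact Finset.sum_congr rfl fun l _ => by
        rw [d_differential (hT.snd.pullsAt τ) rfl (h.1 l),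
          d_differential (hT.snd.pullsAt τ) rfl (h.1 l),
          d_differential (hT.snd.pullsAt τ) rfl (h.2.1 l 0),
          d_differential (hT.snd.pullsAt τ) rfl (h.2.1 l 0)]
    · exact Finset.sum_congr rfl fun l _ => by
        rw [d_differential (hc.pullsAt τ) rfl (h'.1 l), d_differential (hc.pullsAt τ) rfl (h'.1 l),
          d_differential (hc.pullsAt τ) rfl (h'.2.1 l 0),
          d_differential (hc.pullsAt τ) rfl (h'.2.1 l 0)]
  have e1 : ∀ (x : X₀.Pt) (q : E.Pt) (hq : P.π q = x) (F : X₁.Pt → X₀.Pt),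
      K x ⟨q, hq⟩ (differential F (a τ) x w) (differential F (a τ) x w') =
        K (P.π q) ⟨q, rfl⟩ (differential F (a τ) (P.π q) w) (differential F (a τ) (P.π q) w') := by
    rintro x q rfl F
    rfl
  rw [e1, main, ← e1 (𝒳.t (a τ)) (c τ) (hcπ τ)]

end PrincipalBundle

open PrincipalBundle in
/-- Chern-Weil theory in any good category. The pullbacks of the form along source and target agree
on all tangent vectors of `X₁`, in particular after projection to the horizontal ones. -/
theorem FunctionSpace.IsGood.chernWeil (hC : IsGood C) {G E : FunctionSpace.{u} 𝕜} [Group G.Pt]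
    (hG : IsLieGroup C G) (𝒳 : LieGroupoid C X₀ X₁) (ℋ : 𝒳.Connection)
    (P : PrincipalBundle 𝒳 G E) (D : P.Connection) :
    (∃! K, D.IsCurvature K) ∧
      ∀ K, D.IsCurvature K →
        ∀ (k : ℕ) (ν : MultilinearMap 𝕜 (fun _ : Fin k => G.LieAlg) 𝕜),
          IsInvariantSymmetric G ν →
            ∃ ω : X₀.FormField (2 * k),
              (∀ (x : X₀.Pt) (p : {p : E.Pt // P.π p = x}) (v : Fin (2 * k) → X₀.Tangent x),
                ω x v = evalPolynomial ν (K x p) v) ∧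
              ℋ.IsGroupoidForm ω ∧ IsClosedForm ω := by
  refine ⟨?_, fun K hK k ν hν => ?_⟩
  · obtain ⟨K, hK⟩ := D.exists_isCurvature hC hG
    exact ⟨K, hK, fun K' hK' => D.isCurvature_unique hC hG hK' hK⟩
  choose q hq using P.surjective_π
  let ω : X₀.FormField (2 * k) := fun x v => evalPolynomial ν (K x ⟨q x, hq x⟩) v
  have hω : ∀ (x : X₀.Pt) (p : {p : E.Pt // P.π p = x}) (v : Fin (2 * k) → X₀.Tangent x),
      ω x v = evalPolynomial ν (K x p) v := fun x p v => hK.1.evalPolynomial_eq hν x _ _ v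
  have hcl := hK.chernWeil hC hG hω
  refine ⟨ω, hω, ⟨hcl.1, ?_⟩, hcl⟩
  funext y w
  obtain ⟨p, hp⟩ := P.surjective_π (𝒳.s y)
  rw [LieGroupoid.Connection.horizontalPart, LieGroupoid.Connection.horizontalPart, pullback,
    pullback, hω _ ⟨p, hp⟩, hω _ ⟨P.σ y p hp.symm, P.π_σ y p hp.symm⟩, evalPolynomial, evalPolynomial]
  congr 1
  refine Finset.sum_congr rfl fun τ _ => ?_
  congr 2
  funext a
  exact hK.source_eq_target hC hG hp.symm _ _


/-! ### Hadamard's lemma -/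

section Hadamard

open scoped ContDiff Convolution

open MeasureTheory in
/-- The function `∫₀¹ φ(z, t) dt` of `z` is smooth if `φ` is. The integral is written as a convolution
in `t`, at `0`, with the indicator function of the unit interval. -/
theorem contDiff_parametric_integral {E F : Type*} [NormedAddCommGroup E] [NormedSpace ℝ E]
    [NormedAddCommGroup F] [NormedSpace ℝ F] [CompleteSpace F] {φ : E → ℝ → F}
    (hφ : ContDiff ℝ ∞ fun q : E × ℝ => φ q.1 q.2) :
    ContDiff ℝ ∞ fun z => ∫ t in (0 : ℝ)..1, φ z t := by
  let χ : ContDiffBump (0 : ℝ) := ⟨2, 3, by norm_num, by norm_num⟩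
  let g : E → ℝ → F := fun z s => χ s • φ z (-s)
  let f : ℝ → ℝ := Set.indicator (Set.Ioc 0 1) 1
  have hg : ContDiffOn ℝ ∞ (Function.uncurry g) (Set.univ ×ˢ Set.univ) := by
    refine ContDiff.contDiffOn (ContDiff.smul (χ.contDiff.comp contDiff_snd) ?_)
    exact hφ.comp (contDiff_fst.prodMk contDiff_snd.neg)
  have hf : LocallyIntegrable f volume := by
    refine Integrable.locallyIntegrable ?_
    exact (integrable_indicator_iff measurableSet_Ioc).2 (integrableOn_const (by simp))
  have := contDiffOn_convolution_right_with_param (μ := volume) (n := ⊤) (ContinuousLinearMap.lsmul ℝ ℝ)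
    isOpen_univ (isCompact_closedBall (0 : ℝ) 3) (g := g) (f := f) (fun z s _ hs => ?_) hf hg
  · rw [Set.univ_prod_univ, contDiffOn_univ] at this
    have h0 := this.comp (contDiff_id.prodMk contDiff_const : ContDiff ℝ ∞ fun z : E => (z, (0 : ℝ)))
    refine (funext fun z => ?_ : (fun z => ∫ t in (0 : ℝ)..1, φ z t) = _) ▸ h0
    change _ = ∫ t, f t • g z (0 - t)
    rw [intervalIntegral.integral_of_le zero_le_one, ← integral_indicator measurableSet_Ioc]
    congr 1
    funext t
    by_cases ht : t ∈ Set.Ioc (0 : ℝ) 1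
    · have hχ : χ (-t) = 1 := χ.one_of_mem_closedBall (by
        rw [mem_closedBall_zero_iff, norm_neg, Real.norm_eq_abs, abs_le]
        change -2 ≤ t ∧ t ≤ 2
        constructor <;> linarith [ht.1, ht.2])
      simp [f, g, ht, hχ]
    · simp [f, ht]
  · have : χ s = 0 := χ.zero_of_le_dist (by
      rw [mem_closedBall_zero_iff, not_le] at hs
      rw [dist_zero_right]
      exact hs.le)
    simp [g, this]

/-- Hadamard's lemma for smooth functions. -/
theorem exists_hadamard_smooth {E : Type*} [NormedAddCommGroup E] [NormedSpace ℝ E]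
    [FiniteDimensional ℝ E] {f : E → ℝ} {x : E} (hf : ∀ᶠ z in 𝓝 x, ContDiffAt ℝ ∞ f z) :
    ∃ G : E → E →L[ℝ] ℝ, (∀ᶠ z in 𝓝 x, ContDiffAt ℝ ∞ G z) ∧ ∀ᶠ z in 𝓝 x, f z = f x + G z (z - x) := by
  obtain ⟨r, hr, hball⟩ := Metric.eventually_nhds_iff_ball.1 hf
  let χ : ContDiffBump x := ⟨r / 4, r / 2, by linarith, by linarith⟩
  -- a globally smooth function with the same germ
  let F : E → ℝ := fun z => χ z • f z
  have hF : ContDiff ℝ ∞ F := by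
    refine contDiff_iff_contDiffAt.2 fun z => ?_
    by_cases hz : z ∈ Metric.ball x r
    · exact χ.contDiff.contDiffAt.smul (hball z hz)
    · refine (contDiffAt_const (c := (0 : ℝ))).congr_of_eventuallyEq ?_
      have : z ∉ tsupport χ := by
        rw [χ.tsupport_eq]
        refine fun h => hz (Metric.closedBall_subset_ball ?_ h)
        change r / 2 < r
        linarith
      filter_upwards [notMem_tsupport_iff_eventuallyEq.1 this] with w hw
      simp [F, hw]
  have hFf : F =ᶠ[𝓝 x] f := by
    filter_upwards [χ.eventuallyEq_one] with z hz
    simp [F, hz]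
  have hdF : ContDiff ℝ ∞ (fderiv ℝ F) := hF.fderiv_right (m := ∞) (by simp)
  let G : E → E →L[ℝ] ℝ := fun z => ∫ t in (0 : ℝ)..1, fderiv ℝ F (x + t • (z - x))
  refine ⟨G, Filter.Eventually.of_forall fun z => ContDiff.contDiffAt ?_, ?_⟩
  · refine contDiff_parametric_integral (φ := fun z t => fderiv ℝ F (x + t • (z - x))) ?_
    exact hdF.comp (contDiff_const.add (contDiff_snd.smul (contDiff_fst.sub contDiff_const)))
  · filter_upwards [hFf] with z hz
    have hcont : Continuous fun t : ℝ => fderiv ℝ F (x + t • (z - x)) :=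
      hdF.continuous.comp (by fun_prop)
    have h1 : ∀ t ∈ Set.uIcc (0 : ℝ) 1, HasDerivAt (fun t : ℝ => F (x + t • (z - x)))
        (fderiv ℝ F (x + t • (z - x)) (z - x)) t := by
      intro t _
      have h2 : HasDerivAt (fun t : ℝ => x + t • (z - x)) (z - x) t := by
        simpa using ((hasDerivAt_id t).smul_const (z - x)).const_add x
      exact ((hF.differentiable (by simp)).differentiableAt.hasFDerivAt).comp_hasDerivAt t h2
    have h3 := intervalIntegral.integral_eq_sub_of_hasDerivAt h1
      ((hcont.clm_apply continuous_const).intervalIntegrable _ _)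
    rw [← ContinuousLinearMap.intervalIntegral_apply (hcont.intervalIntegrable _ _)] at h3
    rw [← hz, ← hFf.self_of_nhds, h3]
    simp

/-- Hadamard's lemma for analytic functions. -/
theorem exists_hadamard_analytic {𝕜 E : Type*} [NontriviallyNormedField 𝕜] [CompleteSpace 𝕜]
    [NormedAddCommGroup E] [NormedSpace 𝕜 E] {f : E → 𝕜} {x : E} (hf : AnalyticAt 𝕜 f x) :
    ∃ G : E → E →L[𝕜] 𝕜, AnalyticAt 𝕜 G x ∧ ∀ᶠ z in 𝓝 x, f z = f x + G z (z - x) := by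
  obtain ⟨p, r, hp⟩ := hf
  have hrad : 0 < p.shift.radius := by
    rw [p.radius_shift]
    exact hp.r_pos.trans_le hp.r_le
  have hG : HasFPowerSeriesOnBall (fun z => p.shift.sum (z - x)) p.shift x p.shift.radius := by
    simpa using (p.shift.hasFPowerSeriesOnBall hrad).comp_sub x
  refine ⟨fun z => p.shift.sum (z - x), hG.analyticAt, ?_⟩
  filter_upwards [Metric.eball_mem_nhds x hp.r_pos] with z hz
  have h1 := hp.hasSum_sub hz
  have h2 := hG.hasSum_sub (Metric.eball_subset_eball (hp.r_le.trans p.radius_shift.ge) hz)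
  have h3 : HasSum (fun n : ℕ => (p (n + 1)) fun _ => z - x) (p.shift.sum (z - x) (z - x)) := by
    have := h2.mapL (ContinuousLinearMap.apply 𝕜 𝕜 (z - x))
    refine (funext fun n => ?_ : (fun n : ℕ => (p (n + 1)) fun _ => z - x) = _) ▸ this
    change _ = p (n + 1) (Fin.snoc (fun _ => z - x) (z - x))
    congr 1
    funext i
    refine Fin.lastCases ?_ (fun i => ?_) i <;> simp
  have h4 := (hasSum_nat_add_iff' 1).2 h1
  simp only [Finset.range_one, Finset.sum_singleton] at h4
  have h5 := h4.unique h3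
  rw [← h5, show f x = p 0 fun _ => z - x from (hp.coeff_zero _).symm]
  ring

end Hadamard


/-! ### Manifolds -/

namespace FunctionSpace

section Manifold

variable {𝔽 : Type} [RCLike 𝔽] {n : WithTop ℕ∞}

/-- `f` is of class `C^n` on a neighbourhood of `x`. -/
def SmoothNear {E F : Type*} [NormedAddCommGroup E] [NormedSpace 𝔽 E] [NormedAddCommGroup F]
    [NormedSpace 𝔽 F] (n : WithTop ℕ∞) (f : E → F) (x : E) : Prop :=
  ∀ᶠ z in 𝓝 x, ContDiffAt 𝔽 n f z

/-- A regularity class, `C^∞` over `ℝ` or `C^ω` over `ℂ`, which is stable under derivatives and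
satisfies Hadamard's lemma. -/
structure IsSmoothnessClass (𝔽 : Type) [RCLike 𝔽] (n : WithTop ℕ∞) : Prop where
  succ_le : n + 1 ≤ n
  ne_zero : n ≠ 0
  hadamard : ∀ (d : ℕ) (f : (Fin d → 𝔽) → 𝔽) (x : Fin d → 𝔽), SmoothNear (𝔽 := 𝔽) n f x →
    ∃ G : (Fin d → 𝔽) → (Fin d → 𝔽) →L[𝔽] 𝔽, SmoothNear (𝔽 := 𝔽) n G x ∧
      ∀ᶠ z in 𝓝 x, f z = f x + G z (z - x)

/-- `e` is a chart of the manifold `X` of class `C^n`. -/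
def IsChart (n : WithTop ℕ∞) (X : FunctionSpace.{u} 𝔽) {d : ℕ}
    (e : OpenPartialHomeomorph X.Pt (Fin d → 𝔽)) : Prop :=
  ∀ y ∈ e.source, ∀ f : X.Pt → 𝔽, f ∈ X.regAt y ↔ SmoothNear (𝔽 := 𝔽) n (fun w => f (e.symm w)) (e y)

/-- A manifold of class `C^n`. -/
def IsManifoldOfClass (n : WithTop ℕ∞) (X : FunctionSpace.{u} 𝔽) : Prop :=
  ∀ x : X.Pt, ∃ (d : ℕ) (e : OpenPartialHomeomorph X.Pt (Fin d → 𝔽)), x ∈ e.source ∧ IsChart n X e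

section SmoothNear

variable {E F F' : Type*} [NormedAddCommGroup E] [NormedSpace 𝔽 E] [NormedAddCommGroup F]
    [NormedSpace 𝔽 F] [NormedAddCommGroup F'] [NormedSpace 𝔽 F'] {f : E → F} {x : E}

theorem SmoothNear.eventually (h : SmoothNear (𝔽 := 𝔽) n f x) :
    ∀ᶠ z in 𝓝 x, SmoothNear (𝔽 := 𝔽) n f z := eventually_eventually_nhds.2 h

theorem SmoothNear.contDiffAt (h : SmoothNear (𝔽 := 𝔽) n f x) : ContDiffAt 𝔽 n f x := h.self_of_nhds

theorem SmoothNear.continuousAt (h : SmoothNear (𝔽 := 𝔽) n f x) : ContinuousAt f x :=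
  h.contDiffAt.continuousAt

theorem SmoothNear.congr {g : E → F} (h : SmoothNear (𝔽 := 𝔽) n f x) (hfg : f =ᶠ[𝓝 x] g) :
    SmoothNear (𝔽 := 𝔽) n g x := by
  filter_upwards [h, hfg.eventually_nhds] with z hz hz' using
    hz.congr_of_eventuallyEq (Filter.EventuallyEq.symm hz')

theorem SmoothNear.comp {g : F → F'} {y : F} (hg : SmoothNear (𝔽 := 𝔽) n g y)
    (hf : SmoothNear (𝔽 := 𝔽) n f x) (hy : f x = y) : SmoothNear (𝔽 := 𝔽) n (fun z => g (f z)) x := by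
  subst hy
  filter_upwards [hf, hf.continuousAt.eventually hg] with z h1 h2 using h2.comp z h1

theorem smoothNear_of_contDiff (hf : ContDiff 𝔽 n f) : SmoothNear (𝔽 := 𝔽) n f x :=
  Filter.Eventually.of_forall fun _ => hf.contDiffAt

theorem smoothNear_pi {d : ℕ} {f : E → Fin d → 𝔽} :
    SmoothNear (𝔽 := 𝔽) n f x ↔ ∀ i, SmoothNear (𝔽 := 𝔽) n (fun z => f z i) x := by
  simp only [SmoothNear, contDiffAt_pi]
  exact Filter.eventually_all

theorem SmoothNear.prodMk {g : E → F'} (hf : SmoothNear (𝔽 := 𝔽) n f x)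
    (hg : SmoothNear (𝔽 := 𝔽) n g x) : SmoothNear (𝔽 := 𝔽) n (fun z => (f z, g z)) x := by
  filter_upwards [hf, hg] with z h1 h2 using h1.prodMk h2

theorem SmoothNear.differentiableAt (hn : IsSmoothnessClass 𝔽 n) (h : SmoothNear (𝔽 := 𝔽) n f x) :
    DifferentiableAt 𝔽 f x := h.contDiffAt.differentiableAt hn.ne_zero

theorem SmoothNear.fderiv (hn : IsSmoothnessClass 𝔽 n) (h : SmoothNear (𝔽 := 𝔽) n f x) :
    SmoothNear (𝔽 := 𝔽) n (fderiv 𝔽 f) x := by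
  filter_upwards [h] with z hz using hz.fderiv_right hn.succ_le

end SmoothNear

theorem clm_apply_eq_sum {d : ℕ} (G : (Fin d → 𝔽) →L[𝔽] 𝔽) (w : Fin d → 𝔽) :
    G w = ∑ i, w i * G (Pi.single i 1) := by
  refine (LinearMap.pi_apply_eq_sum_univ G.toLinearMap w).trans (Finset.sum_congr rfl fun i _ => ?_)
  rw [smul_eq_mul, show (fun j => if i = j then 1 else 0) = (Pi.single i 1 : Fin d → 𝔽) from
    funext fun j => by simp [Pi.single_apply, eq_comm]]
  rfl

section Chart

variable {X : FunctionSpace.{u} 𝔽} {x : X.Pt}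

theorem IsChart.comp_mem {d m : ℕ} {e : OpenPartialHomeomorph X.Pt (Fin d → 𝔽)} (he : IsChart n X e)
    (hx : x ∈ e.source) {h : X.Pt → Fin m → 𝔽} (hh : ∀ i, (fun z => h z i) ∈ X.regAt x)
    {F : (Fin m → 𝔽) → 𝔽} (hF : SmoothNear (𝔽 := 𝔽) n F (h x)) : (fun z => F (h z)) ∈ X.regAt x := by
  rw [he x hx]
  refine hF.comp (f := fun w => h (e.symm w)) (smoothNear_pi.2 fun i => (he x hx _).1 (hh i)) ?_
  rw [e.left_inv hx]

theorem IsChart.coord_mem {d : ℕ} {e : OpenPartialHomeomorph X.Pt (Fin d → 𝔽)} (he : IsChart n X e)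
    (hx : x ∈ e.source) (i : Fin d) : (fun z => e z i) ∈ X.regAt x := by
  rw [he x hx]
  refine SmoothNear.congr (f := fun w => w i) (smoothNear_of_contDiff (contDiff_apply 𝔽 𝔽 i)) ?_
  filter_upwards [e.open_target.mem_nhds (e.map_source hx)] with w hw
  rw [e.right_inv hw]

theorem IsChart.continuousAt {d : ℕ} {e : OpenPartialHomeomorph X.Pt (Fin d → 𝔽)} (he : IsChart n X e)
    (hx : x ∈ e.source) {f : X.Pt → 𝔽} (hf : f ∈ X.regAt x) : ContinuousAt f x := by
  refine (((he x hx f).1 hf).continuousAt.comp (e.continuousAt hx)).congr ?_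
  filter_upwards [e.open_source.mem_nhds hx] with z hz
  change f (e.symm (e z)) = f z
  rw [e.left_inv hz]

/-- The chain rule for regular functions. -/
theorem IsChart.d_comp (hn : IsSmoothnessClass 𝔽 n) {d m : ℕ}
    {e : OpenPartialHomeomorph X.Pt (Fin d → 𝔽)} (he : IsChart n X e) (hx : x ∈ e.source)
    {h : X.Pt → Fin m → 𝔽} (hh : ∀ i, (fun z => h z i) ∈ X.regAt x) {F : (Fin m → 𝔽) → 𝔽}
    (hF : SmoothNear (𝔽 := 𝔽) n F (h x)) (v : X.Tangent x) :
    X.d (fun z => F (h z)) x v = fderiv 𝔽 F (h x) fun i => X.d (fun z => h z i) x v := by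
  obtain ⟨G, hG, hFG⟩ := hn.hadamard m F (h x) hF
  have hcont : ContinuousAt h x := continuousAt_pi.2 fun i => he.continuousAt hx (hh i)
  -- the derivative of `F` is the value of `G`
  have hfd : HasFDerivAt F (G (h x)) (h x) := by
    have h1 : HasFDerivAt (fun z => F (h x) + G z (z - h x)) (G (h x)) (h x) := by
      have h2 := (hG.differentiableAt hn).hasFDerivAt.clm_apply
        ((hasFDerivAt_id (𝕜 := 𝔽) (h x)).sub_const (h x))
      refine (h2.const_add (F (h x))).congr_fderiv ?_
      ext w
      simp
    exact h1.congr_of_eventuallyEq hFG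
  have hGi : ∀ i, (fun z => G (h z) (Pi.single i 1)) ∈ X.regAt x := fun i =>
    he.comp_mem hx hh (F := fun w => G w (Pi.single i 1)) (by
      filter_upwards [hG] with w hw using hw.clm_apply contDiffAt_const)
  have hhx : ∀ i, (fun z => h z i - h x i) ∈ X.regAt x := fun i =>
    sub_mem' (hh i) (const_mem (h x i))
  have hexp : (fun z => F (h z)) =ᶠ[𝓝 x]
      fun z => F (h x) + ∑ i, (h z i - h x i) * G (h z) (Pi.single i 1) := by
    filter_upwards [hcont.eventually hFG] with z hz
    rw [hz]
    congr 1
    exact clm_apply_eq_sum _ _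
  rw [hfd.fderiv, d_congr hexp, d_add (const_mem _) (sum_mem' _ fun i _ => mul_mem' (hhx i) (hGi i)),
    d_const, zero_add, d_sum _ fun i _ => mul_mem' (hhx i) (hGi i), clm_apply_eq_sum (G (h x))]
  refine Finset.sum_congr rfl fun i _ => ?_
  rw [d_mul (hhx i) (hGi i), d_sub (hh i) (const_mem _), d_const]
  simp [mul_comm]

/-- The tangent vector with given coordinates. -/
theorem IsChart.exists_tangent (hn : IsSmoothnessClass 𝔽 n) {d : ℕ}
    {e : OpenPartialHomeomorph X.Pt (Fin d → 𝔽)} (he : IsChart n X e) (hx : x ∈ e.source)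
    (w : Fin d → 𝔽) : ∃ v : X.Tangent x, (∀ i, X.d (fun z => e z i) x v = w i) ∧
      ∀ f ∈ X.regAt x, X.d f x v = fderiv 𝔽 (fun w => f (e.symm w)) (e x) w := by
  have hd : ∀ f ∈ X.regAt x, DifferentiableAt 𝔽 (fun w => f (e.symm w)) (e x) := fun f hf =>
    ((he x hx f).1 hf).differentiableAt hn
  obtain ⟨v, hv⟩ := FunctionSpace.exists_tangent (X := X) (x := x)
    (fun f => fderiv 𝔽 (fun w => f (e.symm w)) (e x) w)
    (fun f hf g hg => by simp only; rw [fderiv_fun_add (hd f hf) (hd g hg)]; rfl)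
    (fun c f hf => by simp only; rw [fderiv_const_mul (hd f hf)]; rfl)
    (fun f hf g hg => by
      simp only
      rw [fderiv_fun_mul (hd f hf) (hd g hg), e.left_inv hx]
      rfl)
  refine ⟨v, fun i => ?_, hv⟩
  rw [hv _ (he.coord_mem hx i)]
  have : (fun w => e (e.symm w) i) =ᶠ[𝓝 (e x)] fun w => w i := by
    filter_upwards [e.open_target.mem_nhds (e.map_source hx)] with w hw
    rw [e.right_inv hw]
  rw [this.fderiv_eq, (hasFDerivAt_apply i (e x)).fderiv]
  rfl

theorem IsChart.d_eq_fderiv (hn : IsSmoothnessClass 𝔽 n) {d : ℕ}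
    {e : OpenPartialHomeomorph X.Pt (Fin d → 𝔽)} (he : IsChart n X e) (hx : x ∈ e.source)
    {f : X.Pt → 𝔽} (hf : f ∈ X.regAt x) (v : X.Tangent x) :
    X.d f x v = fderiv 𝔽 (fun w => f (e.symm w)) (e x) fun i => X.d (fun z => e z i) x v := by
  rw [← he.d_comp hn hx (fun i => he.coord_mem hx i) ((he x hx f).1 hf)]
  refine d_congr ?_ v
  filter_upwards [e.open_source.mem_nhds hx] with z hz
  rw [e.left_inv hz]

/-- A tangent vector is determined by its coordinates. -/
theorem IsChart.tangent_ext (hn : IsSmoothnessClass 𝔽 n) {d : ℕ}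
    {e : OpenPartialHomeomorph X.Pt (Fin d → 𝔽)} (he : IsChart n X e) (hx : x ∈ e.source)
    {v w : X.Tangent x} (h : ∀ i, X.d (fun z => e z i) x v = X.d (fun z => e z i) x w) : v = w :=
  FunctionSpace.tangent_ext fun f hf => by
    rw [he.d_eq_fderiv hn hx hf, he.d_eq_fderiv hn hx hf, funext h]

theorem IsManifoldOfClass.hasCoordinates (hn : IsSmoothnessClass 𝔽 n) (hX : IsManifoldOfClass n X) :
    HasCoordinates X where
  inv_mem := by
    intro x f hf hfx
    obtain ⟨d, e, hx, he⟩ := hX x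
    rw [he x hx] at hf ⊢
    have hne : ∀ᶠ z in 𝓝 (e x), f (e.symm z) ≠ 0 :=
      hf.continuousAt.eventually_ne (by rwa [e.left_inv hx])
    filter_upwards [hf, hne] with z h1 h2 using h1.inv h2
  eventually_ne := by
    intro x f hf hfx
    obtain ⟨d, e, hx, he⟩ := hX x
    exact (he.continuousAt hx hf).eventually_ne hfx
  exists_frame := by
    intro x
    obtain ⟨d, e, hx, he⟩ := hX x
    have hex : ∀ (i : Fin d) (z : X.Pt), ∃ v : X.Tangent z, z ∈ e.source →
        (∀ j, X.d (fun z => e z j) z v = (Pi.single i 1 : Fin d → 𝔽) j) ∧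
        ∀ f ∈ X.regAt z, X.d f z v = fderiv 𝔽 (fun w => f (e.symm w)) (e z) (Pi.single i 1) := by
      intro i z
      by_cases hz : z ∈ e.source
      · obtain ⟨v, hv⟩ := he.exists_tangent hn hz (Pi.single i 1)
        exact ⟨v, fun _ => hv⟩
      · exact ⟨0, fun h => absurd h hz⟩
    choose D hD using hex
    have hsrc : ∀ᶠ z in 𝓝 x, z ∈ e.source := e.open_source.mem_nhds hx
    refine ⟨d, fun i z => e z i, D, fun i => he.coord_mem hx i, fun i => ?_, ?_, ?_⟩
    · filter_upwards [hsrc] with z hz f hf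
      rw [he z hz]
      have h1 := (((he z hz f).1 hf).fderiv hn)
      refine SmoothNear.congr (f := fun w => fderiv 𝔽 (fun w => f (e.symm w)) w (Pi.single i 1)) ?_ ?_
      · filter_upwards [h1] with w hw using hw.clm_apply contDiffAt_const
      · filter_upwards [e.open_target.mem_nhds (e.map_source hz), (e.continuousAt_symm (e.map_source hz)).eventually
          (by rw [e.left_inv hz]; exact X.regAt_nhds hf)] with w hw hfw
        rw [(hD i _ (e.map_target hw)).2 f hfw, e.right_inv hw]
    · filter_upwards [hsrc] with z hz i j
      rw [(hD i z hz).1 j, Pi.single_apply]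
      simp only [eq_comm]
    · filter_upwards [hsrc] with z hz v f hf
      rw [he.d_eq_fderiv hn hz hf, clm_apply_eq_sum]
      exact Finset.sum_congr rfl fun i _ => by rw [(hD i z hz).2 f hf, mul_comm]

end Chart

end Manifold

end FunctionSpace


/-! ### Submersions of manifolds -/

namespace FunctionSpace

section Submersion

variable {𝔽 : Type} [RCLike 𝔽] {n : WithTop ℕ∞}

/-- The normal form of a submersion `Ψ`: together with a linear map `P` it gives a chart. -/
theorem exists_submersion_chart (hn : IsSmoothnessClass 𝔽 n) {d m : ℕ}
    {Ψ : (Fin d → 𝔽) → Fin m → 𝔽} {a : Fin d → 𝔽} (hΨ : SmoothNear (𝔽 := 𝔽) n Ψ a)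
    (hsurj : Function.Surjective (fderiv 𝔽 Ψ a)) :
    ∃ (k : ℕ) (P : (Fin d → 𝔽) →L[𝔽] Fin k → 𝔽)
      (Θ : OpenPartialHomeomorph (Fin d → 𝔽) ((Fin m → 𝔽) × (Fin k → 𝔽))),
      a ∈ Θ.source ∧ (∀ z, Θ z = (Ψ z, P z)) ∧ SmoothNear (𝔽 := 𝔽) n Θ.symm (Ψ a, P a) := by
  let K : Submodule 𝔽 (Fin d → 𝔽) := LinearMap.ker (fderiv 𝔽 Ψ a).toLinearMap
  obtain ⟨p, hp⟩ := K.exists_isCompl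
  let eq := (Module.finBasis 𝔽 K).equivFun
  let P : (Fin d → 𝔽) →L[𝔽] Fin (Module.finrank 𝔽 K) → 𝔽 :=
    LinearMap.toContinuousLinearMap (eq.toLinearMap ∘ₗ K.projectionOnto p hp)
  have hPK : ∀ c : K, P c = eq c := fun c => by
    change eq (K.projectionOnto p hp c) = eq c
    rw [Submodule.projectionOnto_apply_left]
  have hbij : Function.Bijective ((fderiv 𝔽 Ψ a).prod P) := by
    refine ⟨(injective_iff_map_eq_zero _).2 fun v hv => ?_, fun ⟨w, c⟩ => ?_⟩
    · have h1 : fderiv 𝔽 Ψ a v = 0 := congrArg Prod.fst hv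
      have h2 : P v = 0 := congrArg Prod.snd hv
      have h3 := hPK ⟨v, h1⟩
      rw [h2] at h3
      exact congrArg Subtype.val (eq.map_eq_zero_iff.1 h3.symm)
    · obtain ⟨v, rfl⟩ := hsurj w
      have hk : ∀ c : K, fderiv 𝔽 Ψ a c = 0 := fun c => c.2
      refine ⟨v + (eq.symm (c - P v) : K), ?_⟩
      rw [ContinuousLinearMap.prod_apply, map_add, map_add, hk, hPK, eq.apply_symm_apply]
      simp
  let A : (Fin d → 𝔽) ≃L[𝔽] (Fin m → 𝔽) × (Fin (Module.finrank 𝔽 K) → 𝔽) :=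
    (LinearEquiv.ofBijective ((fderiv 𝔽 Ψ a).prod P).toLinearMap hbij).toContinuousLinearEquiv
  let Φ : (Fin d → 𝔽) → (Fin m → 𝔽) × (Fin (Module.finrank 𝔽 K) → 𝔽) := fun z => (Ψ z, P z)
  have hΦ : SmoothNear (𝔽 := 𝔽) n Φ a := hΨ.prodMk (smoothNear_of_contDiff P.contDiff)
  have hA : HasFDerivAt Φ (A : (Fin d → 𝔽) →L[𝔽] _) a := by
    refine ((hΨ.differentiableAt hn).hasFDerivAt.prodMk P.hasFDerivAt).congr_fderiv ?_
    ext v <;> rfl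
  let Θ := hΦ.contDiffAt.toOpenPartialHomeomorph Φ hA hn.ne_zero
  have ha : a ∈ Θ.source := hΦ.contDiffAt.mem_toOpenPartialHomeomorph_source hA hn.ne_zero
  refine ⟨_, P, Θ, ha, fun z => rfl, ?_⟩
  have hta : Φ a ∈ Θ.target := Θ.map_source ha
  have hsa : Θ.symm (Φ a) = a := Θ.left_inv ha
  -- the derivative stays invertible near `a`
  have hinv : ∀ᶠ z in 𝓝 a, ContDiffAt 𝔽 n Φ z ∧
      ∃ B : (Fin d → 𝔽) ≃L[𝔽] (Fin m → 𝔽) × (Fin (Module.finrank 𝔽 K) → 𝔽),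
        (B : (Fin d → 𝔽) →L[𝔽] _) = fderiv 𝔽 Φ z := by
    have hr := A.nhds
    rw [← hA.fderiv] at hr
    exact hΦ.and ((hΦ.fderiv hn).continuousAt.eventually hr)
  have hc : Filter.Tendsto Θ.symm (𝓝 (Φ a)) (𝓝 a) := by
    have := Θ.continuousAt_symm hta
    rwa [ContinuousAt, hsa] at this
  filter_upwards [hc.eventually hinv, Θ.open_target.mem_nhds hta] with b ⟨h1, ⟨B, hB⟩⟩ h3
  refine Θ.contDiffAt_symm (f₀' := B) h3 ?_ h1
  rw [hB]
  exact (h1.differentiableAt hn.ne_zero).hasFDerivAt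

variable {X Y Z : FunctionSpace.{u} 𝔽}

theorem IsChart.smoothNear_of_isMorphism {d m : ℕ} {φ : X.Pt → Y.Pt} (hφ : IsMorphism X Y φ)
    {e : OpenPartialHomeomorph X.Pt (Fin d → 𝔽)} (he : IsChart n X e)
    {e' : OpenPartialHomeomorph Y.Pt (Fin m → 𝔽)} (he' : IsChart n Y e') {x : X.Pt} (hx : x ∈ e.source)
    (hy : φ x ∈ e'.source) : SmoothNear (𝔽 := 𝔽) n (fun w => e' (φ (e.symm w))) (e x) :=
  smoothNear_pi.2 fun i => (he x hx _).1 (hφ.2 x _ (he'.coord_mem hy i))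

theorem IsChart.fderiv_apply_eq (hn : IsSmoothnessClass 𝔽 n) {d m : ℕ} {φ : X.Pt → Y.Pt}
    (hφ : IsMorphism X Y φ) {e : OpenPartialHomeomorph X.Pt (Fin d → 𝔽)} (he : IsChart n X e)
    {e' : OpenPartialHomeomorph Y.Pt (Fin m → 𝔽)} (he' : IsChart n Y e') {x : X.Pt} (hx : x ∈ e.source)
    {y : Y.Pt} (hxy : φ x = y) (hy : y ∈ e'.source) (v : X.Tangent x) :
    (fderiv 𝔽 (fun w => e' (φ (e.symm w))) (e x) fun i => X.d (fun z => e z i) x v) =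
      fun j => Y.d (fun z => e' z j) y (differential φ x y v) := by
  subst hxy
  funext j
  have h := he.smoothNear_of_isMorphism hφ he' hx hy
  rw [d_differential (hφ.pullsAt x) rfl (he'.coord_mem hy j),
    he.d_eq_fderiv hn hx (hφ.2 x _ (he'.coord_mem hy j))]
  exact congrArg (fun L : (Fin d → 𝔽) →L[𝔽] 𝔽 => L _) (fderiv_apply (h.differentiableAt hn) j).symm

theorem IsChart.surjective_fderiv (hn : IsSmoothnessClass 𝔽 n) {d m : ℕ} {ψ : Y.Pt → Z.Pt}
    (hψ : IsSubmersion Y Z ψ) {e : OpenPartialHomeomorph Y.Pt (Fin d → 𝔽)} (he : IsChart n Y e)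
    {e' : OpenPartialHomeomorph Z.Pt (Fin m → 𝔽)} (he' : IsChart n Z e') {y : Y.Pt} (hy : y ∈ e.source)
    (hz : ψ y ∈ e'.source) :
    Function.Surjective (fderiv 𝔽 (fun w => e' (ψ (e.symm w))) (e y)) := by
  intro w
  obtain ⟨u, hu, -⟩ := he'.exists_tangent hn hz w
  obtain ⟨v, rfl⟩ := hψ.2 y u
  exact ⟨_, (he.fderiv_apply_eq hn hψ.1 he' hy rfl hz v).trans (funext hu)⟩

/-- A submersion has local sections, so functions which become regular on the source are regular. -/
theorem IsManifoldOfClass.descent (hn : IsSmoothnessClass 𝔽 n) (hY : IsManifoldOfClass n Y)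
    (hZ : IsManifoldOfClass n Z) {ψ : Y.Pt → Z.Pt} (hψ : IsSubmersion Y Z ψ) (y : Y.Pt) (f : Z.Pt → 𝔽)
    (hf : f ∘ ψ ∈ Y.regAt y) : f ∈ Z.regAt (ψ y) := by
  obtain ⟨d, e, hy, he⟩ := hY y
  obtain ⟨m, e', hz, he'⟩ := hZ (ψ y)
  obtain ⟨k, P, Θ, ha, hΘ, hs⟩ := exists_submersion_chart hn
    (he.smoothNear_of_isMorphism hψ.1 he' hy hz) (he.surjective_fderiv hn hψ he' hy hz)
  rw [e.left_inv hy] at hs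
  have hΘy : Θ (e y) = (e' (ψ y), P (e y)) := by rw [hΘ, e.left_inv hy]
  -- the section through `y`, in the charts
  let S : (Fin m → 𝔽) → Fin d → 𝔽 := fun w => Θ.symm (w, P (e y))
  have hS : SmoothNear (𝔽 := 𝔽) n S (e' (ψ y)) :=
    hs.comp (smoothNear_of_contDiff (contDiff_id.prodMk contDiff_const)) rfl
  have hSy : S (e' (ψ y)) = e y := by
    change Θ.symm (e' (ψ y), P (e y)) = _
    rw [← hΘy, Θ.left_inv ha]
  rw [he' _ hz]
  rw [he _ hy] at hf
  refine (hf.comp hS hSy).congr ?_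
  have h1 : ∀ᶠ w in 𝓝 (e' (ψ y)), (w, P (e y)) ∈ Θ.target := by
    have hc : Continuous fun w : Fin m → 𝔽 => (w, P (e y)) := by fun_prop
    refine hc.continuousAt.eventually (Θ.open_target.mem_nhds ?_)
    change (e' (ψ y), P (e y)) ∈ _
    rw [← hΘy]
    exact Θ.map_source ha
  have h2 : ∀ᶠ w in 𝓝 (e' (ψ y)), ψ (e.symm (S w)) ∈ e'.source := by
    refine Filter.Tendsto.eventually (f := fun w => ψ (e.symm (S w))) ?_
      (e'.open_source.mem_nhds (x := ψ (e.symm (S (e' (ψ y))))) ?_)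
    · change ContinuousAt _ _
      refine hψ.1.1.continuousAt.comp (ContinuousAt.comp ?_ hS.continuousAt)
      rw [hSy]
      exact e.continuousAt_symm (e.map_source hy)
    · rwa [hSy, e.left_inv hy]
  filter_upwards [h1, h2] with w h1 h2
  have h3 : e' (ψ (e.symm (S w))) = w := by
    have := Θ.right_inv h1
    rw [hΘ] at this
    exact congrArg Prod.fst this
  change f (ψ (e.symm (S w))) = f (e'.symm w)
  rw [← e'.left_inv h2, h3]

end Submersion

end FunctionSpace


/-! ### Fibre products of manifolds -/

namespace FunctionSpace

section ManifoldFiberProduct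

variable {𝔽 : Type} [RCLike 𝔽] {n : WithTop ℕ∞}

/-- The manifold with a single global chart. -/
def ofChart (n : WithTop ℕ∞) {Q : Type u} [TopologicalSpace Q] {d : ℕ}
    (e : OpenPartialHomeomorph Q (Fin d → 𝔽)) (he : e.source = Set.univ) : FunctionSpace.{u} 𝔽 where
  Pt := Q
  regAt q :=
    { carrier := {f | SmoothNear (𝔽 := 𝔽) n (fun w => f (e.symm w)) (e q)}
      mul_mem' := fun {f g} hf hg => by
        filter_upwards [hf, hg] with z h1 h2 using h1.mul h2
      add_mem' := fun {f g} hf hg => by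
        filter_upwards [hf, hg] with z h1 h2 using h1.add h2
      algebraMap_mem' := fun c => Filter.Eventually.of_forall fun z => contDiffAt_const }
  regAt_congr {q f g} hf hfg := by
    have hq : q ∈ e.source := he ▸ Set.mem_univ q
    have hc := e.continuousAt_symm (e.map_source hq)
    rw [ContinuousAt, e.left_inv hq] at hc
    exact SmoothNear.congr hf (hc.eventually hfg)
  regAt_nhds {q f} hf := (e.continuousAt (he ▸ Set.mem_univ q)).eventually (SmoothNear.eventually hf)

theorem isChart_ofChart {Q : Type u} [TopologicalSpace Q] {d : ℕ}
    (e : OpenPartialHomeomorph Q (Fin d → 𝔽)) (he : e.source = Set.univ) :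
    IsChart n (ofChart n e he) e := fun _ _ _ => Iff.rfl

theorem isManifoldOfClass_ofChart {Q : Type u} [TopologicalSpace Q] {d : ℕ}
    (e : OpenPartialHomeomorph Q (Fin d → 𝔽)) (he : e.source = Set.univ) :
    IsManifoldOfClass n (ofChart n e he) := fun q =>
  ⟨d, e, by rw [he]; exact Set.mem_univ q, isChart_ofChart e he⟩

/-- An open subset of `𝔽^d`, as a manifold. -/
theorem exists_isChart_target_eq (n : WithTop ℕ∞) {d : ℕ} {W : Set (Fin d → 𝔽)} (hW : IsOpen W)
    (hne : W.Nonempty) : ∃ (T : FunctionSpace.{u} 𝔽) (e : OpenPartialHomeomorph T.Pt (Fin d → 𝔽)),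
      IsManifoldOfClass n T ∧ IsChart n T e ∧ e.source = Set.univ ∧ e.target = W := by
  let val : ULift.{u} W → Fin d → 𝔽 := fun q => q.down.1
  have hval : Topology.IsOpenEmbedding val :=
    hW.isOpenEmbedding_subtypeVal.comp Homeomorph.ulift.isOpenEmbedding
  have : Nonempty (ULift.{u} W) := ⟨⟨⟨hne.some, hne.some_mem⟩⟩⟩
  let e : OpenPartialHomeomorph (ULift.{u} W) (Fin d → 𝔽) := hval.toOpenPartialHomeomorph val
  refine ⟨ofChart n e rfl, e, isManifoldOfClass_ofChart e rfl, isChart_ofChart e rfl, rfl, ?_⟩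
  rw [hval.toOpenPartialHomeomorph_target]
  ext w
  exact ⟨fun ⟨q, hq⟩ => hq ▸ q.down.2, fun hw => ⟨⟨⟨w, hw⟩⟩, rfl⟩⟩

theorem isManifoldOfClass_point : IsManifoldOfClass n (point.{u} 𝔽) := by
  intro x
  refine ⟨0, (Homeomorph.homeomorphOfUnique PUnit (Fin 0 → 𝔽)).toOpenPartialHomeomorph, trivial,
    fun y _ f => ⟨fun _ => Filter.Eventually.of_forall fun z =>
      (contDiffAt_const (c := f PUnit.unit)),
      fun _ => trivial⟩⟩

variable {X Y Z T : FunctionSpace.{u} 𝔽}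

/-- A map to the domain of a chart is a morphism if its coordinates are regular. -/
theorem IsChart.isMorphism_symm_comp (hT : IsManifoldOfClass n T) {d : ℕ}
    {e : OpenPartialHomeomorph X.Pt (Fin d → 𝔽)} (he : IsChart n X e) {h : T.Pt → Fin d → 𝔽}
    (hh : ∀ τ i, (fun z => h z i) ∈ T.regAt τ) (ht : ∀ τ, h τ ∈ e.target) :
    IsMorphism T X fun τ => e.symm (h τ) := by
  have hcont : Continuous h := continuous_iff_continuousAt.2 fun τ => continuousAt_pi.2 fun i => by
    obtain ⟨m, e', hτ, he'⟩ := hT τ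
    exact he'.continuousAt hτ (hh τ i)
  refine ⟨continuous_iff_continuousAt.2 fun τ =>
    (e.continuousAt_symm (ht τ)).comp hcont.continuousAt, fun τ f hf => ?_⟩
  obtain ⟨m, e', hτ, he'⟩ := hT τ
  have := (he _ (e.map_target (ht τ)) f).1 hf
  rw [e.right_inv (ht τ)] at this
  exact he'.comp_mem hτ (hh τ) this

/-- If `Θ = (ψ, P)` is a chart of `Y` adapted to the submersion `ψ`, the fibre product has the coordinates
`(x, κ)`, with projections `(x, κ) ↦ x` and `(x, κ) ↦ Θ⁻¹ (φ x, κ)`. It is the open set of those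
coordinates near which all maps involved are defined and regular. -/
theorem IsManifoldOfClass.fiberProduct (hn : IsSmoothnessClass 𝔽 n) (hX : IsManifoldOfClass n X)
    (hY : IsManifoldOfClass n Y) (hZ : IsManifoldOfClass n Z) {φ : X.Pt → Z.Pt} {ψ : Y.Pt → Z.Pt}
    (hφ : IsMorphism X Z φ) (hψ : IsSubmersion Y Z ψ) {x : X.Pt} {y : Y.Pt} (hxy : φ x = ψ y) :
    ∃ (T : FunctionSpace.{u} 𝔽) (a : T.Pt → X.Pt) (b : T.Pt → Y.Pt) (τ : T.Pt),
      IsLocalFiberProduct (IsManifoldOfClass n) (X := X) (Y := Y) (Z := Z) φ ψ a b ∧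
        a τ = x ∧ b τ = y := by
  obtain ⟨dX, eX, hx, heX⟩ := hX x
  obtain ⟨dY, eY, hy, heY⟩ := hY y
  obtain ⟨dZ, eZ, hz, heZ⟩ := hZ (ψ y)
  obtain ⟨k, P, Θ, ha, hΘ, hs⟩ := exists_submersion_chart hn
    (heY.smoothNear_of_isMorphism hψ.1 heZ hy hz) (heY.surjective_fderiv hn hψ heZ hy hz)
  rw [eY.left_inv hy] at hs
  let φ' : (Fin dX → 𝔽) → Fin dZ → 𝔽 := fun w => eZ (φ (eX.symm w))
  have hφ' : SmoothNear (𝔽 := 𝔽) n φ' (eX x) := heX.smoothNear_of_isMorphism hφ heZ hx (hxy ▸ hz)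
  -- the coordinates of the fibre product
  let Λ : (Fin (dX + k) → 𝔽) ≃L[𝔽] (Fin dX → 𝔽) × (Fin k → 𝔽) :=
    ContinuousLinearEquiv.ofFinrankEq (by simp)
  let α : (Fin (dX + k) → 𝔽) →L[𝔽] Fin dX → 𝔽 :=
    (ContinuousLinearMap.fst 𝔽 (Fin dX → 𝔽) (Fin k → 𝔽)).comp Λ.toContinuousLinearMap
  let κ : (Fin (dX + k) → 𝔽) →L[𝔽] Fin k → 𝔽 :=
    (ContinuousLinearMap.snd 𝔽 (Fin dX → 𝔽) (Fin k → 𝔽)).comp Λ.toContinuousLinearMap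
  have hακ : ∀ w w', α w = α w' → κ w = κ w' → w = w' := fun w w' h1 h2 =>
    Λ.injective (Prod.ext h1 h2)
  let η : (Fin (dX + k) → 𝔽) → Fin dY → 𝔽 := fun w => Θ.symm (φ' (α w), κ w)
  let Good : (Fin (dX + k) → 𝔽) → Prop := fun w =>
    α w ∈ eX.target ∧ φ (eX.symm (α w)) ∈ eZ.source ∧ (φ' (α w), κ w) ∈ Θ.target ∧
      η w ∈ eY.target ∧ ψ (eY.symm (η w)) ∈ eZ.source ∧ SmoothNear (𝔽 := 𝔽) n η w ∧
      SmoothNear (𝔽 := 𝔽) n Θ.symm (φ' (α w), κ w)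
  let w₀ : Fin (dX + k) → 𝔽 := Λ.symm (eX x, P (eY y))
  have hα₀ : α w₀ = eX x := congrArg Prod.fst (Λ.apply_symm_apply (eX x, P (eY y)))
  have hκ₀ : κ w₀ = P (eY y) := congrArg Prod.snd (Λ.apply_symm_apply (eX x, P (eY y)))
  have hφ'₀ : φ' (α w₀) = eZ (ψ y) := by
    simp only [φ']
    rw [hα₀, eX.left_inv hx, hxy]
  have hΘy : Θ (eY y) = (eZ (ψ y), P (eY y)) := by rw [hΘ, eY.left_inv hy]
  have hη₀ : η w₀ = eY y := by
    simp only [η]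
    rw [hφ'₀, hκ₀, ← hΘy, Θ.left_inv ha]
  have hpair : SmoothNear (𝔽 := 𝔽) n (fun w => (φ' (α w), κ w)) w₀ :=
    (hφ'.comp (smoothNear_of_contDiff α.contDiff) hα₀).prodMk (smoothNear_of_contDiff κ.contDiff)
  have hs' : SmoothNear (𝔽 := 𝔽) n Θ.symm (φ' (α w₀), κ w₀) := by rw [hφ'₀, hκ₀]; exact hs
  have hη : SmoothNear (𝔽 := 𝔽) n η w₀ := hs'.comp hpair rfl
  have hGood : ∀ᶠ w in 𝓝 w₀, Good w := by
    have hαc : Filter.Tendsto α (𝓝 w₀) (𝓝 (eX x)) := hα₀ ▸ α.continuous.continuousAt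
    have hηc : Filter.Tendsto η (𝓝 w₀) (𝓝 (eY y)) := hη₀ ▸ hη.continuousAt
    have hφc : Filter.Tendsto (fun w => φ (eX.symm w)) (𝓝 (eX x)) (𝓝 (ψ y)) := by
      have h1 : ContinuousAt (fun w => φ (eX.symm w)) (eX x) :=
        hφ.1.continuousAt.comp (eX.continuousAt_symm (eX.map_source hx))
      rwa [ContinuousAt, eX.left_inv hx, hxy] at h1
    have hψc : Filter.Tendsto (fun w => ψ (eY.symm w)) (𝓝 (eY y)) (𝓝 (ψ y)) := by
      have h1 : ContinuousAt (fun w => ψ (eY.symm w)) (eY y) :=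
        hψ.1.1.continuousAt.comp (eY.continuousAt_symm (eY.map_source hy))
      rwa [ContinuousAt, eY.left_inv hy] at h1
    refine (hαc.eventually (eX.open_target.mem_nhds (eX.map_source hx))).and
      (((hφc.comp hαc).eventually (eZ.open_source.mem_nhds hz)).and
      ((hpair.continuousAt.eventually (Θ.open_target.mem_nhds ?_)).and
      ((hηc.eventually (eY.open_target.mem_nhds (eY.map_source hy))).and
      (((hψc.comp hηc).eventually (eZ.open_source.mem_nhds hz)).and
      (hη.eventually.and (hpair.continuousAt.eventually hs'.eventually))))))
    change (φ' (α w₀), κ w₀) ∈ _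
    rw [hφ'₀, hκ₀, ← hΘy]
    exact Θ.map_source ha
  let W : Set (Fin (dX + k) → 𝔽) := {w | ∀ᶠ w' in 𝓝 w, Good w'}
  have hWo : IsOpen W := isOpen_setOfPred_eventually_nhds
  obtain ⟨T, e, hT, heT, hsrc', htgt⟩ := exists_isChart_target_eq n hWo ⟨w₀, hGood⟩
  have hsrc : ∀ τ, τ ∈ e.source := fun τ => hsrc' ▸ Set.mem_univ τ
  have heW : ∀ τ, e τ ∈ W := fun τ => htgt ▸ e.map_source (hsrc τ)
  have hgood : ∀ τ : T.Pt, Good (e τ) := fun τ => (heW τ).self_of_nhds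
  have hmem : ∀ (τ : T.Pt) (F : (Fin (dX + k) → 𝔽) → 𝔽), SmoothNear (𝔽 := 𝔽) n F (e τ) →
      (fun τ => F (e τ)) ∈ T.regAt τ := fun τ F hF =>
    heT.comp_mem (hsrc τ) (fun i => heT.coord_mem (hsrc τ) i) hF
  have hmemα : ∀ (τ : T.Pt) i, (fun τ => α (e τ) i) ∈ T.regAt τ := fun τ i =>
    hmem τ (fun w => α w i) (smoothNear_of_contDiff (contDiff_pi.1 α.contDiff i))
  have hmemκ : ∀ (τ : T.Pt) i, (fun τ => κ (e τ) i) ∈ T.regAt τ := fun τ i =>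
    hmem τ (fun w => κ w i) (smoothNear_of_contDiff (contDiff_pi.1 κ.contDiff i))
  have hmemη : ∀ (τ : T.Pt) i, (fun τ => η (e τ) i) ∈ T.regAt τ := fun τ i =>
    hmem τ (fun w => η w i) (smoothNear_pi.1 (hgood τ).2.2.2.2.2.1 i)
  let a : T.Pt → X.Pt := fun τ => eX.symm (α (e τ))
  let b : T.Pt → Y.Pt := fun τ => eY.symm (η (e τ))
  have haM : IsMorphism T X a := heX.isMorphism_symm_comp hT hmemα fun τ => (hgood τ).1
  have hbM : IsMorphism T Y b := heY.isMorphism_symm_comp hT hmemη fun τ => (hgood τ).2.2.2.1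
  have hax : ∀ τ, eX (a τ) = α (e τ) := fun τ => eX.right_inv (hgood τ).1
  have hby : ∀ τ, eY (b τ) = η (e τ) := fun τ => eY.right_inv (hgood τ).2.2.2.1
  have has : ∀ τ, a τ ∈ eX.source := fun τ => eX.map_target (hgood τ).1
  have hbs : ∀ τ, b τ ∈ eY.source := fun τ => eY.map_target (hgood τ).2.2.2.1
  have haz : ∀ τ, φ (a τ) ∈ eZ.source := fun τ => (hgood τ).2.1
  have hbz : ∀ τ, ψ (b τ) ∈ eZ.source := fun τ => (hgood τ).2.2.2.2.1
  have hΘη : ∀ τ, Θ (η (e τ)) = (φ' (α (e τ)), κ (e τ)) := fun τ => Θ.right_inv (hgood τ).2.2.1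
  have hηs : ∀ τ, η (e τ) ∈ Θ.source := fun τ => Θ.map_target (hgood τ).2.2.1
  have hψη : ∀ τ, eZ (ψ (b τ)) = φ' (α (e τ)) := fun τ => by
    have := hΘη τ
    rw [hΘ] at this
    exact congrArg Prod.fst this
  have hPη : ∀ τ, P (η (e τ)) = κ (e τ) := fun τ => by
    have := hΘη τ
    rw [hΘ] at this
    exact congrArg Prod.snd this
  have hcomm : ∀ τ, φ (a τ) = ψ (b τ) := fun τ => eZ.injOn (haz τ) (hbz τ) (hψη τ).symm
  -- the coordinates of tangent vectors
  have hdlin : ∀ {m : ℕ} (L : (Fin (dX + k) → 𝔽) →L[𝔽] Fin m → 𝔽) (τ : T.Pt) (u : T.Tangent τ) i,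
      T.d (fun τ => L (e τ) i) τ u = L (fun l => T.d (fun τ => e τ l) τ u) i := by
    intro m L τ u i
    have h1 := heT.d_comp hn (hsrc τ) (fun l => heT.coord_mem (hsrc τ) l) (F := fun w => L w i)
      (smoothNear_of_contDiff (contDiff_pi.1 L.contDiff i)) u
    rw [h1]
    exact congrArg (fun M : (Fin (dX + k) → 𝔽) →L[𝔽] 𝔽 => M _)
      ((ContinuousLinearMap.proj i).comp L).fderiv
  have hda : ∀ (τ : T.Pt) (u : T.Tangent τ) i, X.d (fun z => eX z i) (a τ) (differential a τ (a τ) u) =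
      T.d (fun τ => α (e τ) i) τ u := by
    intro τ u i
    rw [d_differential (haM.pullsAt τ) rfl (heX.coord_mem (has τ) i)]
    exact congrArg (fun f => T.d f τ u) (funext fun τ => congrFun (hax τ) i)
  have hdb : ∀ (τ : T.Pt) (u : T.Tangent τ) i, Y.d (fun z => eY z i) (b τ) (differential b τ (b τ) u) =
      T.d (fun τ => η (e τ) i) τ u := by
    intro τ u i
    rw [d_differential (hbM.pullsAt τ) rfl (heY.coord_mem (hbs τ) i)]
    exact congrArg (fun f => T.d f τ u) (funext fun τ => congrFun (hby τ) i)
  have hdP : ∀ (τ : T.Pt) (u : T.Tangent τ) i, T.d (fun τ => κ (e τ) i) τ u =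
      P (fun j => T.d (fun τ => η (e τ) j) τ u) i := by
    intro τ u i
    have h1 := heT.d_comp hn (hsrc τ) (hmemη τ) (F := fun w => P w i)
      (smoothNear_of_contDiff (contDiff_pi.1 P.contDiff i)) u
    have h2 : T.d (fun τ => κ (e τ) i) τ u = T.d (fun τ => P (η (e τ)) i) τ u :=
      congrArg (fun f => T.d f τ u) (funext fun τ => (congrFun (hPη τ) i).symm)
    rw [h2, h1]
    exact congrArg (fun M : (Fin dY → 𝔽) →L[𝔽] 𝔽 => M _)
      ((ContinuousLinearMap.proj i).comp P).fderiv
  have hw₀ : e (e.symm w₀) = w₀ := e.right_inv (htgt ▸ hGood)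
  refine ⟨T, a, b, e.symm w₀, ⟨hT, haM, hbM, hcomm, ?_, ?_, ?_⟩, ?_, ?_⟩
  · intro τ v w hvw
    obtain ⟨u, hu, -⟩ := heT.exists_tangent hn (hsrc τ)
      (Λ.symm (fun i => X.d (fun z => eX z i) (a τ) v, P fun j => Y.d (fun z => eY z j) (b τ) w))
    have hau : differential a τ (a τ) u = v := by
      refine heX.tangent_ext hn (has τ) fun i => ?_
      rw [hda, hdlin, funext hu]
      exact congrFun (congrArg Prod.fst (Λ.apply_symm_apply _)) i
    have hκu : ∀ i, T.d (fun τ => κ (e τ) i) τ u = P (fun j => Y.d (fun z => eY z j) (b τ) w) i := by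
      intro i
      rw [hdlin, funext hu]
      exact congrFun (congrArg Prod.snd (Λ.apply_symm_apply _)) i
    refine ⟨u, hau, heY.tangent_ext hn (hbs τ) fun i => ?_⟩
    -- both sides have the same image under the differential of the chart `Θ`
    have hΘd : ∀ v : Fin dY → 𝔽, fderiv 𝔽 Θ (η (e τ)) v =
        (fderiv 𝔽 (fun w => eZ (ψ (eY.symm w))) (η (e τ)) v, P v) := by
      intro v
      have h1 := heY.smoothNear_of_isMorphism hψ.1 heZ (hbs τ) (hbz τ)
      rw [hby] at h1
      have h2 := ((h1.differentiableAt hn).hasFDerivAt.prodMk P.hasFDerivAt).fderiv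
      rw [show (Θ : (Fin dY → 𝔽) → _) = fun w => (eZ (ψ (eY.symm w)), P w) from funext hΘ, h2]
      rfl
    have hΘi : Function.Injective (fderiv 𝔽 Θ (η (e τ))) := by
      have h1 := heY.smoothNear_of_isMorphism hψ.1 heZ (hbs τ) (hbz τ)
      rw [hby] at h1
      have h2 : DifferentiableAt 𝔽 Θ (η (e τ)) := by
        rw [show (Θ : (Fin dY → 𝔽) → _) = fun w => (eZ (ψ (eY.symm w)), P w) from funext hΘ]
        exact (h1.differentiableAt hn).prodMk P.differentiableAt
      have h3 : DifferentiableAt 𝔽 Θ.symm (Θ (η (e τ))) := by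
        rw [hΘη]
        exact (hgood τ).2.2.2.2.2.2.differentiableAt hn
      have h4 : (fun w => Θ.symm (Θ w)) =ᶠ[𝓝 (η (e τ))] id := by
        filter_upwards [Θ.open_source.mem_nhds (hηs τ)] with w hw using Θ.left_inv hw
      have h5 := h4.fderiv_eq (𝕜 := 𝔽)
      have h6 := fderiv_comp (𝕜 := 𝔽) (η (e τ)) h3 h2
      intro v v' hvv
      have h7 : ∀ v, fderiv 𝔽 Θ.symm (Θ (η (e τ))) (fderiv 𝔽 Θ (η (e τ)) v) = v := fun v => by
        have h8 := congrArg (fun M : (Fin dY → 𝔽) →L[𝔽] Fin dY → 𝔽 => M v) (h6.symm.trans h5)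
        rw [fderiv_id] at h8
        exact h8
      rw [← h7 v, hvv, h7]
    have hmain : (fun i => Y.d (fun z => eY z i) (b τ) (differential b τ (b τ) u)) =
        fun i => Y.d (fun z => eY z i) (b τ) w := by
      apply hΘi
      rw [hΘd, hΘd]
      refine Prod.ext ?_ ?_
      · simp only
        rw [← hby, heY.fderiv_apply_eq hn hψ.1 heZ (hbs τ) rfl (hbz τ),
          heY.fderiv_apply_eq hn hψ.1 heZ (hbs τ) rfl (hbz τ)]
        have h1 : ∀ z, z = ψ (b τ) → ∀ (v : X.Tangent (a τ)) (w : Y.Tangent (b τ)),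
            differential (Y := Z) φ (a τ) z v = differential (Y := Z) ψ (b τ) z w →
            differential (Y := Z) φ (a τ) (ψ (b τ)) v = differential (Y := Z) ψ (b τ) (ψ (b τ)) w := by
          rintro z rfl v w h
          exact h
        rw [← h1 _ (hcomm τ) v w hvw, ← differential_comp (hbM.pullsAt τ) rfl (hψ.1.pullsAt _) rfl, ← hau,
          ← differential_comp (haM.pullsAt τ) rfl (hφ.pullsAt _) (hcomm τ)]
        rw [show (fun τ => φ (a τ)) = fun τ => ψ (b τ) from funext hcomm]
      · simp only
        refine funext fun i => ?_
        rw [← hκu, hdP]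
        simp only [hdb]
    exact congrFun hmain i
  · intro τ u h1 h2
    refine heT.tangent_ext hn (hsrc τ) fun l => ?_
    have h3 : ∀ i, T.d (fun τ => α (e τ) i) τ u = 0 := fun i => by rw [← hda, h1, map_zero]
    have h4 : ∀ i, T.d (fun τ => η (e τ) i) τ u = 0 := fun i => by rw [← hdb, h2, map_zero]
    have h5 : (fun l => T.d (fun τ => e τ l) τ u) = 0 := by
      refine hακ _ _ (funext fun i => ?_) (funext fun i => ?_)
      · rw [map_zero, ← hdlin, h3]
        rfl
      · rw [map_zero, ← hdlin, hdP, funext h4]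
        exact congrFun P.map_zero i
    rw [map_zero]
    exact congrFun h5 l
  · intro S hS a' b' ha' hb' hab σ τ h1 h2
    let w : S.Pt → Fin (dX + k) → 𝔽 := fun ρ => Λ.symm (eX (a' ρ), P (eY (b' ρ)))
    have hwσ : w σ = e τ := by
      refine hακ _ _ ?_ ?_
      · refine (congrArg Prod.fst (Λ.apply_symm_apply _)).trans ?_
        simp only
        rw [h1, hax]
      · refine (congrArg Prod.snd (Λ.apply_symm_apply _)).trans ?_
        simp only
        rw [h2, hby, hPη]
    obtain ⟨dS, eS, hσ, heS⟩ := hS σ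
    have hwm : ∀ l, (fun ρ => w ρ l) ∈ S.regAt σ := by
      intro l
      have h3 : (fun ρ => w ρ l) = fun ρ =>
          Λ.symm (eX (a' ρ), 0) l + Λ.symm (0, P (eY (b' ρ))) l := by
        funext ρ
        simp only [w]
        rw [← Pi.add_apply, ← map_add]
        simp
      rw [h3]
      refine add_mem' ?_ ?_
      · refine heS.comp_mem hσ (h := fun ρ => eX (a' ρ)) (F := fun v => Λ.symm (v, 0) l)
          (fun i => ha'.2 σ _ (heX.coord_mem (by rw [h1]; exact has τ) i)) (smoothNear_of_contDiff ?_)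
        exact contDiff_pi.1 (Λ.symm.contDiff.comp (contDiff_id.prodMk contDiff_const)) l
      · refine heS.comp_mem hσ (h := fun ρ => eY (b' ρ)) (F := fun v => Λ.symm (0, P v) l)
          (fun i => hb'.2 σ _ (heY.coord_mem (by rw [h2]; exact hbs τ) i)) (smoothNear_of_contDiff ?_)
        exact contDiff_pi.1 (Λ.symm.contDiff.comp (contDiff_const.prodMk P.contDiff)) l
    have hwc : ContinuousAt w σ := continuousAt_pi.2 fun l => heS.continuousAt hσ (hwm l)
    have hwW : ∀ᶠ ρ in 𝓝 σ, w ρ ∈ W :=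
      hwc.eventually (hWo.mem_nhds (by rw [hwσ]; exact heW τ))
    let c : S.Pt → T.Pt := fun ρ => e.symm (w ρ)
    have hec : ∀ᶠ ρ in 𝓝 σ, e (c ρ) = w ρ := by
      filter_upwards [hwW] with ρ hρ using e.right_inv (htgt ▸ hρ)
    have hcσ : c σ = τ := by
      simp only [c]
      rw [hwσ, e.left_inv (hsrc τ)]
    refine ⟨c, hcσ, ?_, ?_, ?_⟩
    · intro f hf
      rw [hcσ, heT τ (hsrc τ), ← hwσ] at hf
      exact heS.comp_mem hσ hwm hf
    · filter_upwards [hec, ha'.1.continuousAt.eventually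
        (eX.open_source.mem_nhds (by rw [h1]; exact has τ))] with ρ hρ hρ'
      change eX.symm (α (e (c ρ))) = _
      rw [hρ, show α (w ρ) = eX (a' ρ) from congrArg Prod.fst (Λ.apply_symm_apply _), eX.left_inv hρ']
    · have hbs' : b' σ ∈ eY.source := by rw [h2]; exact hbs τ
      have has' : a' σ ∈ eX.source := by rw [h1]; exact has τ
      have hΘs : ∀ᶠ ρ in 𝓝 σ, eY (b' ρ) ∈ Θ.source := by
        have hc : ContinuousAt (fun ρ => eY (b' ρ)) σ := (eY.continuousAt hbs').comp hb'.1.continuousAt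
        refine hc.eventually (Θ.open_source.mem_nhds ?_)
        change eY (b' σ) ∈ _
        rw [h2, hby]
        exact hηs τ
      filter_upwards [hec, ha'.1.continuousAt.eventually (eX.open_source.mem_nhds has'),
        hb'.1.continuousAt.eventually (eY.open_source.mem_nhds hbs'), hΘs] with ρ hρ hρa hρb hρΘ
      change eY.symm (Θ.symm (φ' (α (e (c ρ))), κ (e (c ρ)))) = _
      rw [hρ, show α (w ρ) = eX (a' ρ) from congrArg Prod.fst (Λ.apply_symm_apply _),
        show κ (w ρ) = P (eY (b' ρ)) from congrArg Prod.snd (Λ.apply_symm_apply _),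
        show (φ' (eX (a' ρ)), P (eY (b' ρ))) = Θ (eY (b' ρ)) from ?_, Θ.left_inv hρΘ, eY.left_inv hρb]
      rw [hΘ, eY.left_inv hρb, ← hab ρ]
      simp only [φ']
      rw [eX.left_inv hρa]
  · change eX.symm (α (e (e.symm w₀))) = x
    rw [hw₀, hα₀, eX.left_inv hx]
  · change eY.symm (η (e (e.symm w₀))) = y
    rw [hw₀, hη₀, eY.left_inv hy]

theorem IsSmoothnessClass.isGood (hn : IsSmoothnessClass 𝔽 n) :
    IsGood (IsManifoldOfClass.{u} (𝔽 := 𝔽) n) where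
  charZero := inferInstance
  coord _ hX := hX.hasCoordinates hn
  point := isManifoldOfClass_point
  fiberProduct _ _ _ hX hY hZ _ _ hφ hψ _ _ hxy := hX.fiberProduct hn hY hZ hφ hψ hxy
  descent _ _ hY hZ _ hψ y f hf := hY.descent hn hZ hψ y f hf

end ManifoldFiberProduct

open scoped ContDiff in
theorem isGood_isSmoothManifold : IsGood IsSmoothManifold.{u} := by
  have hn : IsSmoothnessClass ℝ ∞ :=
    ⟨by simp, by simp, fun d f x hf => exists_hadamard_smooth hf⟩
  exact hn.isGood

open scoped ContDiff in
theorem isGood_isComplexManifold : IsGood IsComplexManifold.{u} := by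
  have hiff : ∀ {E F : Type} [NormedAddCommGroup E] [NormedSpace ℂ E] [NormedAddCommGroup F]
      [NormedSpace ℂ F] [CompleteSpace F] (f : E → F) (x : E),
      SmoothNear (𝔽 := ℂ) ω f x ↔ AnalyticAt ℂ f x := by
    intro E F _ _ _ _ _ f x
    refine ⟨fun h => h.contDiffAt.analyticAt, fun h => ?_⟩
    filter_upwards [h.eventually_analyticAt] with z hz using hz.contDiffAt
  have hn : IsSmoothnessClass ℂ ω := by
    refine ⟨by simp, by simp, fun d f x hf => ?_⟩
    obtain ⟨G, hG, h⟩ := exists_hadamard_analytic ((hiff f x).1 hf)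
    exact ⟨G, (hiff G x).2 hG, h⟩
  have hC : IsComplexManifold.{u} = IsManifoldOfClass ω := by
    funext X
    simp only [IsComplexManifold, IsManifoldOfClass, IsChart, hiff]
  rw [hC]
  exact hn.isGood

end FunctionSpace


/-! ### Smooth algebras over the complex numbers and their points -/

section SmoothAlgebra

open TensorProduct

/-- A standard smooth algebra over a field is étale over a polynomial ring `P`, hence flat over it, so
that it embeds into its base change to the field of fractions of `P`, which is étale over a
field. -/
theorem Algebra.IsStandardSmooth.isReduced (k A : Type) [Field k] [CommRing A] [Algebra k A]
    [Algebra.IsStandardSmooth k A] : IsReduced A := by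
  obtain ⟨n, g, -, hg⟩ := RingHom.IsStandardSmooth.exists_etale_mvPolynomial
    (RingHom.isStandardSmooth_algebraMap.2 ‹Algebra.IsStandardSmooth k A›)
  algebraize [g]
  have : Module.Flat (MvPolynomial (Fin n) k) A := Algebra.Smooth.flat _ _
  let K := FractionRing (MvPolynomial (Fin n) k)
  have hred : IsReduced (K ⊗[MvPolynomial (Fin n) k] A) :=
    Algebra.FormallyUnramified.isReduced_of_field K _
  refine isReduced_of_injective
    (Algebra.TensorProduct.includeRight (R := MvPolynomial (Fin n) k) (A := K) (B := A)) ?_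
  exact Algebra.TensorProduct.includeRight_injective (IsFractionRing.injective _ K)

theorem Algebra.Smooth.isReduced (k A : Type) [Field k] [CommRing A] [Algebra k A]
    [Algebra.Smooth k A] : IsReduced A := by
  obtain ⟨s, hs, h⟩ := Algebra.Smooth.exists_span_eq_top_isStandardSmooth k A
  refine ⟨fun a ha => ?_⟩
  refine Module.eq_zero_of_isLocalized_span s hs (fun r => Localization.Away r.1)
    (fun r => Algebra.linearMap A (Localization.Away r.1)) a fun r => ?_
  have := h r.1 r.2
  have := Algebra.IsStandardSmooth.isReduced k (Localization.Away r.1)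
  exact (ha.map (algebraMap A (Localization.Away r.1))).eq_zero

variable {A B R : Type} [CommRing A] [Algebra ℂ A] [CommRing B] [Algebra ℂ B] [CommRing R]
  [Algebra ℂ R]

/-- The Nullstellensatz: an affine scheme without complex points is empty. -/
theorem exists_complexPoint (A : Type) [CommRing A] [Algebra ℂ A] [Algebra.FiniteType ℂ A]
    [Nontrivial A] : Nonempty (A →ₐ[ℂ] ℂ) := by
  obtain ⟨m, hm⟩ := Ideal.exists_maximal A
  let := Ideal.Quotient.field m
  have : Module.Finite ℂ (A ⧸ m) := finite_of_finite_type_of_isJacobsonRing ℂ (A ⧸ m)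
  have hb := IsAlgClosed.algebraMap_bijective_of_isIntegral (k := ℂ) (K := A ⧸ m)
  exact ⟨((AlgEquiv.ofBijective (Algebra.ofId ℂ (A ⧸ m)) hb).symm : A ⧸ m →ₐ[ℂ] ℂ).comp
    (Ideal.Quotient.mkₐ ℂ m)⟩

/-- The points of the localization at `c` are the points where `c` does not vanish. -/
theorem exists_away_lift (p : A →ₐ[ℂ] ℂ) {c : A} (hc : p c ≠ 0) :
    ∃ q : Localization.Away c →ₐ[ℂ] ℂ, ∀ a, q (algebraMap A _ a) = p a := by
  refine ⟨IsLocalization.liftAlgHom (M := Submonoid.powers c) (f := p) ?_, fun a => ?_⟩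
  · rintro ⟨_, n, rfl⟩
    simpa using IsUnit.mk0 _ (pow_ne_zero n hc)
  · simp

theorem eq_zero_of_forall_complexPoint [Algebra.Smooth ℂ A] {a : A}
    (h : ∀ p : A →ₐ[ℂ] ℂ, p a = 0) : a = 0 := by
  have := Algebra.Smooth.isReduced ℂ A
  by_contra ha
  have hn : ¬IsNilpotent a := fun hn => ha hn.eq_zero
  have : Nontrivial (Localization.Away a) := by
    rw [← not_subsingleton_iff_nontrivial, IsLocalization.subsingleton_iff (M := Submonoid.powers a)]
    rintro ⟨n, hn'⟩
    exact hn ⟨n, hn'⟩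
  have : Algebra.Smooth A (Localization.Away a) := .of_isLocalization_Away a
  have : Algebra.Smooth ℂ (Localization.Away a) := .comp ℂ A _
  obtain ⟨q⟩ := exists_complexPoint (Localization.Away a)
  have hu : IsUnit (q (algebraMap A _ a)) :=
    (IsLocalization.Away.algebraMap_isUnit a).map q
  exact hu.ne_zero (h (q.comp (IsScalarTower.toAlgHom ℂ A _)))

/-- The universal property of the tensor product of algebras, with compatibility over `A` expressed by
equations. -/
theorem exists_tensor_algHom [Algebra A R] [IsScalarTower ℂ A R] [Algebra A B]
    [IsScalarTower ℂ A B] {K : Type*} [CommRing K] [Algebra ℂ K] (f : R →ₐ[ℂ] K) (g : B →ₐ[ℂ] K)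
    (h : ∀ a : A, f (algebraMap A R a) = g (algebraMap A B a)) :
    ∃ k : R ⊗[A] B →ₐ[ℂ] K, (∀ r, k (r ⊗ₜ 1) = f r) ∧ ∀ b, k (1 ⊗ₜ b) = g b := by
  let : Algebra A K := ((f : R →+* K).comp (algebraMap A R)).toAlgebra
  have : IsScalarTower ℂ A K := IsScalarTower.of_algebraMap_eq fun z => by
    change _ = f (algebraMap A R (algebraMap ℂ A z))
    rw [← IsScalarTower.algebraMap_apply ℂ A R, AlgHom.commutes]
  let f' : R →ₐ[A] K := { f with commutes' := fun a => rfl }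
  let g' : B →ₐ[A] K := { g with commutes' := fun a => (h a).symm }
  let k : R ⊗[A] B →ₐ[A] K := Algebra.TensorProduct.productMap f' g'
  refine ⟨k.restrictScalars ℂ, fun r => ?_, fun b => ?_⟩
  · change k (r ⊗ₜ 1) = f r
    rw [Algebra.TensorProduct.productMap_apply_tmul, map_one, mul_one]
    rfl
  · change k (1 ⊗ₜ b) = g b
    rw [Algebra.TensorProduct.productMap_apply_tmul, map_one, one_mul]
    rfl

/-! ### Point derivations -/

/-- A derivation `A → ℂ` at the point `p`. -/
def IsPointDerivation (p : A →ₐ[ℂ] ℂ) (δ : A →ₗ[ℂ] ℂ) : Prop :=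
  ∀ a b, δ (a * b) = p a * δ b + p b * δ a

/-- A derivation at `p` factors through the Kähler differentials. -/
theorem IsPointDerivation.exists_kaehler {p : A →ₐ[ℂ] ℂ} {δ : A →ₗ[ℂ] ℂ}
    (h : IsPointDerivation p δ) :
    ∃ L : Ω[A⁄ℂ] →+ ℂ, (∀ a w, L (a • w) = p a * L w) ∧ ∀ a, L (KaehlerDifferential.D ℂ A a) = δ a := by
  let : Module A ℂ := Module.compHom ℂ (p : A →+* ℂ)
  have : IsScalarTower ℂ A ℂ := ⟨fun z a w => by
    change p (z • a) * w = z • (p a * w)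
    rw [map_smul, smul_eq_mul, smul_eq_mul, mul_assoc]⟩
  let d : Derivation ℂ A ℂ := Derivation.mk' δ fun a b => h a b
  exact ⟨d.liftKaehlerDifferential.toAddMonoidHom, fun a w => d.liftKaehlerDifferential.map_smul a w,
    fun a => d.liftKaehlerDifferential_comp_D a⟩

theorem IsPointDerivation.map_one {p : A →ₐ[ℂ] ℂ} {δ : A →ₗ[ℂ] ℂ} (h : IsPointDerivation p δ) :
    δ 1 = 0 := by
  have := h 1 1
  simpa using this

theorem isPointDerivation_of_linearMap (p : A →ₐ[ℂ] ℂ) (θ : Ω[A⁄ℂ] →ₗ[A] A) :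
    IsPointDerivation p ((p.toLinearMap ∘ₗ θ.restrictScalars ℂ) ∘ₗ
      (KaehlerDifferential.D ℂ A).toLinearMap) := fun a b => by
  simp

open TrivSqZeroExt in
/-- Derivations at `p` are the homomorphisms to the dual numbers which lift `p`. -/
theorem IsPointDerivation.exists_dual {p : A →ₐ[ℂ] ℂ} {δ : A →ₗ[ℂ] ℂ} (h : IsPointDerivation p δ) :
    ∃ f : A →ₐ[ℂ] DualNumber ℂ, ∀ a, (f a).fst = p a ∧ (f a).snd = δ a := by
  let f : A →ₗ[ℂ] DualNumber ℂ :=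
    { toFun := fun a => inl (p a) + inr (δ a)
      map_add' := fun a b => by ext <;> simp
      map_smul' := fun z a => by ext <;> simp }
  refine ⟨AlgHom.ofLinearMap f ?_ ?_, fun a => ?_⟩
  · ext <;> simp [f, h.map_one]
  · intro a b
    ext <;> simp [f, h a b, mul_comm]
  · simp [f]

theorem isPointDerivation_snd {f : A →ₐ[ℂ] DualNumber ℂ} {p : A →ₐ[ℂ] ℂ}
    (h : ∀ a, (f a).fst = p a) :
    IsPointDerivation p ((TrivSqZeroExt.sndHom ℂ ℂ) ∘ₗ f.toLinearMap) := fun a b => by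
  simp [h, mul_comm]

end SmoothAlgebra


/-! ### The Jacobian criterion -/

section Jacobian

open TensorProduct KaehlerDifferential

variable {A B : Type} [CommRing A] [Algebra ℂ A] [CommRing B] [Algebra ℂ B] [Algebra A B]
  [IsScalarTower ℂ A B]

/-- If `B ⊗ Ω_A → Ω_B` has a left inverse, then `B` is smooth over `A`, by the Jacobi-Zariski exact
sequence. -/
theorem Algebra.FormallySmooth.of_comp_mapBaseChange_eq_id [Algebra.FormallySmooth ℂ B]
    (l : Ω[B⁄ℂ] →ₗ[B] B ⊗[A] Ω[A⁄ℂ]) (hl : l ∘ₗ mapBaseChange ℂ A B = LinearMap.id) :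
    Algebra.FormallySmooth A B := by
  have hinj : Function.Injective (mapBaseChange ℂ A B) :=
    Function.LeftInverse.injective (g := l) fun x => LinearMap.congr_fun hl x
  have hsurj : Function.Surjective (KaehlerDifferential.map ℂ A B B) :=
    KaehlerDifferential.map_surjective ℂ A B
  constructor
  · obtain ⟨-, s, hs⟩ := ((exact_mapBaseChange_map ℂ A B).split_tfae'.out 1 0 rfl rfl).1
      ⟨hsurj, l, hl⟩
    exact Module.Projective.of_split s _ hs
  · have h0 : ∀ x : Algebra.H1Cotangent A B, x = 0 := by
      intro x
      have h1 : Algebra.H1Cotangent.δ ℂ A B x = 0 :=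
        hinj (by rw [(Algebra.H1Cotangent.exact_δ_mapBaseChange ℂ A B).apply_apply_eq_zero, map_zero])
      obtain ⟨y, rfl⟩ := (Algebra.H1Cotangent.exact_map_δ ℂ A B x).1 h1
      rw [Subsingleton.elim y 0, map_zero]
    exact ⟨fun x y => by rw [h0 x, h0 y]⟩

/-- A standard smooth algebra has coordinates `x i`, whose differentials form a basis. -/
theorem exists_coordinates (A : Type) [CommRing A] [Algebra ℂ A] [Algebra.IsStandardSmooth ℂ A] :
    ∃ (n : ℕ) (x : Fin n → A) (b : Module.Basis (Fin n) A Ω[A⁄ℂ]), ∀ i, b i = D ℂ A (x i) := by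
  nontriviality A
  obtain ⟨-, I, b, hb⟩ := Algebra.IsStandardSmooth.iff_exists_basis_kaehlerDifferential.1
    ‹Algebra.IsStandardSmooth ℂ A›
  have : Finite I := Module.Finite.finite_basis b
  obtain ⟨n, ⟨e⟩⟩ := Finite.exists_equiv_fin I
  choose x hx using fun i => hb ⟨e.symm i, rfl⟩
  exact ⟨n, x, b.reindex e, fun i => by rw [hx, Module.Basis.reindex_apply]⟩

/-- The Jacobian criterion. If tangent vectors of `Spec A` at the image of `p` lift to tangent vectors of
`Spec B` at `p`, then `Spec B → Spec A` is smooth on a neighbourhood of `p`. The lifts of the coordinate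
vectors are values of linear forms on `Ω_B`, which give an endomorphism of `B ⊗ Ω_A` whose determinant
does not vanish at `p`. -/
theorem exists_smooth_away [Algebra.IsStandardSmooth ℂ A] [Algebra.IsStandardSmooth ℂ B]
    (p : B →ₐ[ℂ] ℂ)
    (h : ∀ δ, IsPointDerivation (p.comp (IsScalarTower.toAlgHom ℂ A B)) δ →
      ∃ δ', IsPointDerivation p δ' ∧ ∀ a, δ' (algebraMap A B a) = δ a) :
    ∃ c : B, p c ≠ 0 ∧ Algebra.Smooth A (Localization.Away c) := by
  obtain ⟨n, x, b, hb⟩ := exists_coordinates A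
  obtain ⟨m, y, b', hb'⟩ := exists_coordinates B
  have hθ : ∀ k, ∃ θ : Ω[B⁄ℂ] →ₗ[B] B, ∀ i,
      p (θ (D ℂ B (algebraMap A B (x i)))) = if i = k then 1 else 0 := by
    intro k
    obtain ⟨δ, hδ, hδ'⟩ := h _ (isPointDerivation_of_linearMap _ (b.coord k))
    obtain ⟨L, hL, hLD⟩ := hδ.exists_kaehler
    refine ⟨b'.constr ℂ fun j => algebraMap ℂ B (L (b' j)), fun i => ?_⟩
    have hLθ : ∀ w, p (b'.constr ℂ (fun j => algebraMap ℂ B (L (b' j))) w) = L w := by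
      intro w
      rw [Module.Basis.constr_apply_fintype]
      conv_rhs => rw [← b'.sum_equivFun w]
      rw [map_sum, map_sum]
      refine Finset.sum_congr rfl fun j _ => ?_
      rw [hL, smul_eq_mul, map_mul, AlgHom.commutes]
      rfl
    rw [hLθ, hLD, hδ']
    have hk : b.coord k (D ℂ A (x i)) = if i = k then 1 else 0 := by
      rw [← hb]
      simp [Finsupp.single_apply]
    change p (algebraMap A B (b.coord k (D ℂ A (x i)))) = _
    rw [hk]
    split_ifs <;> simp
  choose θ hθ using hθ
  let P : Matrix (Fin n) (Fin n) B := Matrix.of fun i k => θ k (D ℂ B (algebraMap A B (x i)))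
  have hP : P.map p = 1 := by
    ext i k
    simp [P, hθ, Matrix.one_apply]
  refine ⟨P.det, ?_, ?_⟩
  · have : p P.det = (P.map p).det := p.toRingHom.map_det P
    rw [this, hP, Matrix.det_one]
    exact one_ne_zero
  let B' := Localization.Away P.det
  have : Algebra.Smooth B B' := .of_isLocalization_Away P.det
  have : Algebra.Smooth ℂ B' := .comp ℂ B _
  have : Algebra.FormallyEtale B B' := .of_isLocalization (Submonoid.powers P.det)
  let e := tensorKaehlerEquivOfFormallyEtale ℂ B B'
  let θ' : Fin n → Ω[B'⁄ℂ] →ₗ[B'] B' := fun k =>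
    ((Algebra.linearMap B B') ∘ₗ θ k).liftBaseChange B' ∘ₗ e.symm.toLinearMap
  have hθ' : ∀ i k, θ' k (D ℂ B' (algebraMap A B' (x i))) = algebraMap B B' (P i k) := by
    intro i k
    rw [IsScalarTower.algebraMap_apply A B B']
    simp only [θ', e, LinearMap.comp_apply, LinearEquiv.coe_coe,
      tensorKaehlerEquivOfFormallyEtale_symm_D_algebraMap, LinearMap.liftBaseChange_tmul]
    simp [P]
  let Q : Matrix (Fin n) (Fin n) B' := ((algebraMap B B').mapMatrix P)⁻¹
  have hQ : (algebraMap B B').mapMatrix P * Q = 1 := by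
    refine Matrix.mul_nonsing_inv _ ?_
    rw [← RingHom.map_det]
    exact IsLocalization.Away.algebraMap_isUnit P.det
  let l : Ω[B'⁄ℂ] →ₗ[B'] B' ⊗[A] Ω[A⁄ℂ] :=
    ∑ k, ∑ j, (θ' k).smulRight (Q k j • (1 : B') ⊗ₜ[A] D ℂ A (x j))
  have hl : l ∘ₗ mapBaseChange ℂ A B' = LinearMap.id := by
    refine (b.baseChange B').ext fun i => ?_
    have h1 : ∀ j, ∑ k, algebraMap B B' (P i k) * Q k j = if i = j then 1 else 0 := fun j => by
      have := congrFun (congrFun hQ i) j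
      rwa [Matrix.one_apply] at this
    rw [Module.Basis.baseChange_apply, hb, LinearMap.comp_apply, mapBaseChange_tmul, one_smul, map_D]
    simp only [l, LinearMap.sum_apply, LinearMap.smulRight_apply, hθ', smul_smul]
    rw [Finset.sum_comm]
    simp [← Finset.sum_smul, h1]
  have := Algebra.FormallySmooth.of_comp_mapBaseChange_eq_id l hl
  have : Algebra.FinitePresentation A B := .of_restrict_scalars_finitePresentation ℂ A B
  have : Algebra.FinitePresentation B B' := IsLocalization.Away.finitePresentation P.det
  exact ⟨inferInstance, .trans A B B'⟩

/-! ### Descent of functions along smooth maps of affine schemes -/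

/-- A function on `Spec B` which is constant on the fibres of the smooth map `Spec B → Spec A` comes, on
a neighbourhood of the image of any given point, from a function on `Spec A`, by faithfully flat
descent; the images of points form an open set, as flat maps of finite presentation are open. -/
theorem exists_descent [Algebra.Smooth ℂ A] [Algebra.Smooth A B] (β : B)
    (hβ : ∀ p q : B →ₐ[ℂ] ℂ, (∀ a, p (algebraMap A B a) = q (algebraMap A B a)) → p β = q β)
    (p₀ : B →ₐ[ℂ] ℂ) :
    ∃ a a₁ : A, p₀ (algebraMap A B a) ≠ 0 ∧ ∀ r : A →ₐ[ℂ] ℂ, r a ≠ 0 →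
      ∃ p : B →ₐ[ℂ] ℂ, (∀ a, p (algebraMap A B a) = r a) ∧ r a * p β = r a₁ := by
  have hopen : IsOpen (Set.range (PrimeSpectrum.comap (algebraMap A B))) :=
    (PrimeSpectrum.isOpenMap_comap_of_hasGoingDown_of_finitePresentation
      (R := A) (S := B)).isOpen_range
  let P₀ : PrimeSpectrum B := ⟨RingHom.ker p₀, RingHom.ker_isPrime p₀.toRingHom⟩
  obtain ⟨_, ⟨_, ⟨a, rfl⟩, rfl⟩, ha₀, ha⟩ :=
    PrimeSpectrum.isBasis_basic_opens.exists_subset_of_mem_open (Set.mem_range_self P₀) hopen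
  have ha₀' : p₀ (algebraMap A B a) ≠ 0 := fun h0 => ha₀ h0
  let A' := Localization.Away a
  let B' := A' ⊗[A] B
  have hsurj : Function.Surjective (PrimeSpectrum.comap (algebraMap A' B')) := by
    intro P'
    let P := PrimeSpectrum.comap (algebraMap A A') P'
    have hP : P ∈ PrimeSpectrum.basicOpen a := by
      rw [← SetLike.mem_coe, ← PrimeSpectrum.localization_away_comap_range A' a]
      exact ⟨P', rfl⟩
    obtain ⟨Q, hQ⟩ := ha hP
    have hQa : Q ∈ PrimeSpectrum.basicOpen (algebraMap A B a) := by
      rw [← hQ] at hP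
      exact hP
    let : Algebra B B' := Algebra.TensorProduct.rightAlgebra
    have hloc : IsLocalization.Away (algebraMap A B a) B' := by
      have : IsLocalization (Algebra.algebraMapSubmonoid B (Submonoid.powers a)) B' := inferInstance
      rwa [Algebra.algebraMapSubmonoid, Submonoid.map_powers] at this
    rw [← SetLike.mem_coe, ← PrimeSpectrum.localization_away_comap_range B' (algebraMap A B a)] at hQa
    obtain ⟨Q', rfl⟩ := hQa
    refine ⟨Q', PrimeSpectrum.localization_comap_injective A' (Submonoid.powers a) ?_⟩
    change _ = P
    rw [← hQ, ← PrimeSpectrum.comap_comp_apply, ← PrimeSpectrum.comap_comp_apply]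
    congr 1
    ext b
    exact (Algebra.TensorProduct.includeRight (R := A) (A := A') (B := B)).commutes b |>.symm
  have : Module.FaithfullyFlat A' B' := .of_comap_surjective hsurj
  have : Algebra.Smooth A A' := .of_isLocalization_Away a
  have : Algebra.Smooth ℂ A' := .comp ℂ A _
  have : Algebra.Smooth ℂ B' := .comp ℂ A' _
  have : Algebra.Smooth ℂ (B' ⊗[A'] B') := .comp ℂ B' _
  let ι : B →ₐ[A] B' := Algebra.TensorProduct.includeRight
  have hι : ∀ p q : B' →ₐ[ℂ] ℂ, (∀ a, p (algebraMap A' B' a) = q (algebraMap A' B' a)) →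
      p (ι β) = q (ι β) := by
    intro p q hpq
    refine hβ (p.comp (ι.restrictScalars ℂ)) (q.comp (ι.restrictScalars ℂ)) fun a => ?_
    change p (ι (algebraMap A B a)) = q (ι (algebraMap A B a))
    rw [AlgHom.commutes, IsScalarTower.algebraMap_apply A A' B']
    exact hpq _
  have hβ' : (ι β) ⊗ₜ[A'] (1 : B') = (1 : B') ⊗ₜ[A'] (ι β) := by
    rw [← sub_eq_zero]
    refine eq_zero_of_forall_complexPoint (A := B' ⊗[A'] B') fun p => ?_
    rw [map_sub, sub_eq_zero]
    let ι₁ : B' →ₐ[A'] B' ⊗[A'] B' := Algebra.TensorProduct.includeLeft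
    let ι₂ : B' →ₐ[A'] B' ⊗[A'] B' := Algebra.TensorProduct.includeRight
    exact hι (p.comp (ι₁.restrictScalars ℂ)) (p.comp (ι₂.restrictScalars ℂ)) fun a => by
      change p (ι₁ (algebraMap A' B' a)) = p (ι₂ (algebraMap A' B' a))
      rw [AlgHom.commutes, AlgHom.commutes]
  obtain ⟨α, hα⟩ : ι β ∈ Set.range (algebraMap A' B') := by
    rw [← (Algebra.IsEffective.of_faithfullyFlat A' B').eqLocus_includeLeft_includeRight]
    exact hβ'
  obtain ⟨⟨a₁, ⟨_, N, rfl⟩⟩, hN⟩ := IsLocalization.surj (Submonoid.powers a) α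
  have hN' : α * algebraMap A A' a ^ N = algebraMap A A' a₁ := by simpa using hN
  refine ⟨a ^ (N + 1), a * a₁, by rw [map_pow, map_pow]; exact pow_ne_zero _ ha₀', fun r hr => ?_⟩
  have hra : r a ≠ 0 := fun h0 => hr (by rw [map_pow, h0, zero_pow N.succ_ne_zero])
  obtain ⟨r', hr'⟩ := exists_away_lift r hra
  obtain ⟨p, hp⟩ : ∃ p : B' →ₐ[ℂ] ℂ, ∀ a, p (algebraMap A' B' a) = r' a := by
    let : Algebra A' ℂ := (r' : A' →+* ℂ).toAlgebra
    have : IsScalarTower ℂ A' ℂ := IsScalarTower.of_algebraMap_eq fun z => (r'.commutes z).symm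
    have : Nontrivial (ℂ ⊗[A'] B') := inferInstance
    have : Algebra.Smooth ℂ (ℂ ⊗[A'] B') := inferInstance
    obtain ⟨p⟩ := exists_complexPoint (ℂ ⊗[A'] B')
    refine ⟨p.comp (Algebra.TensorProduct.includeRight.restrictScalars ℂ), fun a => ?_⟩
    change p (1 ⊗ₜ algebraMap A' B' a) = _
    rw [← Algebra.TensorProduct.tmul_one_eq_one_tmul]
    exact p.commutes (r' a)
  refine ⟨p.comp (ι.restrictScalars ℂ), fun a' => ?_, ?_⟩
  · change p (ι (algebraMap A B a')) = _
    rw [AlgHom.commutes, IsScalarTower.algebraMap_apply A A' B', hp, hr']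
  · change r (a ^ (N + 1)) * p (ι β) = _
    rw [← hα, hp, pow_succ', map_mul, map_mul, map_pow, ← hr' a₁, ← hN', map_mul, map_pow, hr']
    ring

end Jacobian


/-! ### Affine charts of smooth schemes -/

section Affine

/-- Finite intersections of the basic open sets are basic open sets. -/
theorem MaxSpec.isTopologicalBasis (A : Type) [CommRing A] [Algebra ℂ A] :
    TopologicalSpace.IsTopologicalBasis {U : Set (MaxSpec A) | ∃ a : A, U = {p | p.eval a ≠ 0}} where
  exists_subset_inter := by
    rintro _ ⟨a, rfl⟩ _ ⟨b, rfl⟩ p ⟨ha, hb⟩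
    refine ⟨_, ⟨a * b, rfl⟩, ?_, fun q hq => ?_⟩
    · change p.eval (a * b) ≠ 0
      rw [map_mul]
      exact mul_ne_zero ha hb
    · change q.eval (a * b) ≠ 0 at hq
      rw [map_mul] at hq
      exact ⟨left_ne_zero_of_mul hq, right_ne_zero_of_mul hq⟩
  sUnion_eq := Set.eq_univ_of_forall fun p => ⟨_, ⟨1, rfl⟩, by
    change p.eval 1 ≠ 0
    rw [map_one]
    exact one_ne_zero⟩
  eq_generateFrom := rfl

theorem MaxSpec.eventually_ne {A : Type} [CommRing A] [Algebra ℂ A] {p : MaxSpec A} {a : A}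
    (h : p.eval a ≠ 0) : ∀ᶠ q in 𝓝 p, q.eval a ≠ 0 :=
  (TopologicalSpace.isOpen_generateFrom_of_mem ⟨a, rfl⟩ : IsOpen {q : MaxSpec A | q.eval a ≠ 0}).mem_nhds h

namespace FunctionSpace

/-- `U` is an open subset of `X`, identified by `z ↦ ev z` with an open subset of the space of closed
points of `Spec A`, with the sheaf of regular functions. -/
structure IsAffineChart (X : FunctionSpace.{u} ℂ) (A : Type) [CommRing A] [Algebra ℂ A] (U : Set X.Pt)
    (ev : X.Pt → A →ₐ[ℂ] ℂ) : Prop where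
  isOpen : IsOpen U
  injOn : Set.InjOn ev U
  eventually_ne : ∀ z ∈ U, ∀ a, ev z a ≠ 0 → ∀ᶠ w in 𝓝 z, ev w a ≠ 0
  exists_subset : ∀ z ∈ U, ∀ W ∈ 𝓝 z, ∃ a, ev z a ≠ 0 ∧ ∀ w ∈ U, ev w a ≠ 0 → w ∈ W
  open_range : ∀ z ∈ U, ∃ a, ev z a ≠ 0 ∧ ∀ p : A →ₐ[ℂ] ℂ, p a ≠ 0 → ∃ w ∈ U, ev w = p
  mem_regAt_iff : ∀ z ∈ U, ∀ f : X.Pt → ℂ,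
    f ∈ X.regAt z ↔ ∃ a b, ev z b ≠ 0 ∧ ∀ᶠ w in 𝓝 z, f w = ev w a / ev w b

variable {X Y Z T : FunctionSpace.{u} ℂ} {A B : Type} [CommRing A] [Algebra ℂ A] [CommRing B]
  [Algebra ℂ B] {U : Set X.Pt} {ev : X.Pt → A →ₐ[ℂ] ℂ} {x z : X.Pt}

theorem isAffineChart_of_openPartialHomeomorph (e : OpenPartialHomeomorph X.Pt (MaxSpec A))
    (h : ∀ y ∈ e.source, ∀ f : X.Pt → ℂ, f ∈ X.regAt y ↔ ∃ a b : A, (e y).eval b ≠ 0 ∧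
      ∀ᶠ z in 𝓝 y, f z = (e z).eval a / (e z).eval b) :
    IsAffineChart X A e.source fun z => (e z).eval where
  isOpen := e.open_source
  injOn := e.injOn
  eventually_ne z hz a ha := (e.continuousAt hz).eventually (MaxSpec.eventually_ne ha)
  exists_subset z hz W hW := by
    have hW' : e.target ∩ e.symm ⁻¹' W ∈ 𝓝 (e z) := by
      refine Filter.inter_mem (e.open_target.mem_nhds (e.map_source hz)) ?_
      refine (e.continuousAt_symm (e.map_source hz)).preimage_mem_nhds ?_
      rwa [e.left_inv hz]
    obtain ⟨_, ⟨a, rfl⟩, ha, haW⟩ := (MaxSpec.isTopologicalBasis A).mem_nhds_iff.1 hW'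
    refine ⟨a, ha, fun w hw hwa => ?_⟩
    have := (haW hwa).2
    rwa [Set.mem_preimage, e.left_inv hw] at this
  open_range z hz := by
    obtain ⟨_, ⟨a, rfl⟩, ha, haW⟩ := (MaxSpec.isTopologicalBasis A).mem_nhds_iff.1
      (e.open_target.mem_nhds (e.map_source hz))
    exact ⟨a, ha, fun p hp => ⟨e.symm p, e.map_target (haW hp), e.right_inv (haW hp)⟩⟩
  mem_regAt_iff := h

theorem IsAffineChart.eval_mem (h : IsAffineChart X A U ev) (hz : z ∈ U) (a : A) :
    (fun w => ev w a) ∈ X.regAt z :=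
  (h.mem_regAt_iff z hz _).2 ⟨a, 1, by simp, Filter.Eventually.of_forall fun w => by simp⟩

theorem IsAffineChart.inv_mem (h : IsAffineChart X A U ev) (hz : z ∈ U) {f : X.Pt → ℂ}
    (hf : f ∈ X.regAt z) (h0 : f z ≠ 0) : (fun w => (f w)⁻¹) ∈ X.regAt z := by
  obtain ⟨a, b, hb, hab⟩ := (h.mem_regAt_iff z hz f).1 hf
  refine (h.mem_regAt_iff z hz _).2 ⟨b, a, fun ha => h0 ?_, ?_⟩
  · rw [hab.self_of_nhds, ha, zero_div]
  · filter_upwards [hab] with w hw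
    rw [hw, inv_div]

theorem IsAffineChart.eventually_ne_zero (h : IsAffineChart X A U ev) (hz : z ∈ U) {f : X.Pt → ℂ}
    (hf : f ∈ X.regAt z) (h0 : f z ≠ 0) : ∀ᶠ w in 𝓝 z, f w ≠ 0 := by
  obtain ⟨a, b, hb, hab⟩ := (h.mem_regAt_iff z hz f).1 hf
  have ha : ev z a ≠ 0 := fun ha => h0 (by rw [hab.self_of_nhds, ha, zero_div])
  filter_upwards [hab, h.eventually_ne z hz a ha, h.eventually_ne z hz b hb] with w hw hwa hwb
  rw [hw]
  exact div_ne_zero hwa hwb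

/-- An equation between elements of `A` which holds near a point holds after multiplication by a function
which does not vanish at the point. -/
theorem IsAffineChart.exists_mul_eq_zero (h : IsAffineChart X A U ev) [Algebra.Smooth ℂ A]
    (hz : z ∈ U) {a : A} (ha : ∀ᶠ w in 𝓝 z, ev w a = 0) : ∃ c, ev z c ≠ 0 ∧ c * a = 0 := by
  obtain ⟨c₁, h₁, h₁'⟩ := h.exists_subset z hz _ ha
  obtain ⟨c₂, h₂, h₂'⟩ := h.open_range z hz
  refine ⟨c₁ * c₂, by rw [map_mul]; exact mul_ne_zero h₁ h₂, eq_zero_of_forall_complexPoint fun p => ?_⟩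
  rw [map_mul, map_mul]
  by_cases hp₂ : p c₂ = 0
  · rw [hp₂, mul_zero, zero_mul]
  · obtain ⟨w, hw, rfl⟩ := h₂' p hp₂
    by_cases hp₁ : ev w c₁ = 0
    · rw [hp₁, zero_mul, zero_mul]
    · rw [h₁' w hw hp₁, mul_zero]

/-- The open subset of an affine chart where `c` does not vanish. -/
theorem IsAffineChart.exists_away (h : IsAffineChart X A U ev) {c : A} (hx : ev x c ≠ 0) :
    ∃ ev' : X.Pt → Localization.Away c →ₐ[ℂ] ℂ,
      (∀ z, ev z c ≠ 0 → ∀ a, ev' z (algebraMap A _ a) = ev z a) ∧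
      IsAffineChart X (Localization.Away c) {z ∈ U | ev z c ≠ 0} ev' ∧
      ((∀ p : A →ₐ[ℂ] ℂ, p c ≠ 0 → ∃ w ∈ U, ev w = p) →
        ∀ p : Localization.Away c →ₐ[ℂ] ℂ, ∃ w ∈ {z ∈ U | ev z c ≠ 0}, ev' w = p) := by
  classical
  let ev' : X.Pt → Localization.Away c →ₐ[ℂ] ℂ := fun z =>
    if hz : ev z c ≠ 0 then (exists_away_lift (ev z) hz).choose
    else (exists_away_lift (ev x) hx).choose
  have hev : ∀ z, ev z c ≠ 0 → ∀ a, ev' z (algebraMap A _ a) = ev z a := by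
    intro z hz
    simp only [ev', dif_pos hz]
    exact (exists_away_lift (ev z) hz).choose_spec
  have hnum : ∀ α : Localization.Away c, ∃ (a : A) (n : ℕ), ∀ z, ev z c ≠ 0 →
      ev' z α * ev z c ^ n = ev z a := by
    intro α
    obtain ⟨⟨a, ⟨_, n, rfl⟩⟩, hn⟩ := IsLocalization.surj (Submonoid.powers c) α
    refine ⟨a, n, fun z hz => ?_⟩
    rw [← hev z hz c, ← hev z hz a, ← hn]
    simp
  have hopen : IsOpen {z ∈ U | ev z c ≠ 0} := isOpen_iff_mem_nhds.2 fun z hz =>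
    Filter.inter_mem (h.isOpen.mem_nhds hz.1) (h.eventually_ne z hz.1 c hz.2)
  have hsurj : ∀ p : Localization.Away c →ₐ[ℂ] ℂ,
      (∃ w ∈ U, ev w = p.comp (IsScalarTower.toAlgHom ℂ A _)) →
        ∃ w ∈ {z ∈ U | ev z c ≠ 0}, ev' w = p := by
    rintro p ⟨w, hw, hwp⟩
    have hc : ev w c ≠ 0 := by
      rw [hwp]
      exact ((IsLocalization.Away.algebraMap_isUnit c).map p).ne_zero
    refine ⟨w, ⟨hw, hc⟩, IsLocalization.algHom_ext (Submonoid.powers c) ?_⟩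
    ext a
    change ev' w (algebraMap A _ a) = p (algebraMap A _ a)
    rw [hev w hc, hwp]
    rfl
  refine ⟨ev', hev, ?_, fun hp p => hsurj p ?_⟩
  · constructor
    · exact hopen
    · intro z hz w hw hzw
      refine h.injOn hz.1 hw.1 (AlgHom.ext fun a => ?_)
      rw [← hev z hz.2, ← hev w hw.2, hzw]
    · intro z hz α hα
      obtain ⟨a, n, han⟩ := hnum α
      have : ev z a ≠ 0 := by
        rw [← han z hz.2]
        exact mul_ne_zero hα (pow_ne_zero _ hz.2)
      filter_upwards [h.eventually_ne z hz.1 a this, hopen.mem_nhds hz] with w hw hwU hw0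
      rw [← han w hwU.2, hw0, zero_mul] at hw
      exact hw rfl
    · intro z hz W hW
      obtain ⟨a, ha, haW⟩ := h.exists_subset z hz.1 W hW
      refine ⟨algebraMap A _ a, by rwa [hev z hz.2], fun w hw hwa => haW w hw.1 ?_⟩
      rwa [hev w hw.2] at hwa
    · intro z hz
      obtain ⟨a, ha, haU⟩ := h.open_range z hz.1
      exact ⟨algebraMap A _ a, by rwa [hev z hz.2], fun p hp => hsurj p (haU _ hp)⟩
    · intro z hz f
      rw [h.mem_regAt_iff z hz.1 f]
      constructor
      · rintro ⟨a, b, hb, hab⟩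
        refine ⟨algebraMap A _ a, algebraMap A _ b, by rwa [hev z hz.2], ?_⟩
        filter_upwards [hab, hopen.mem_nhds hz] with w hw hwU
        rw [hev w hwU.2, hev w hwU.2, hw]
      · rintro ⟨α, β, hβ, hαβ⟩
        obtain ⟨a, n, han⟩ := hnum α
        obtain ⟨b, m, hbm⟩ := hnum β
        refine ⟨a * c ^ m, b * c ^ n, ?_, ?_⟩
        · rw [map_mul, map_pow, ← hbm z hz.2]
          exact mul_ne_zero (mul_ne_zero hβ (pow_ne_zero _ hz.2)) (pow_ne_zero _ hz.2)
        · filter_upwards [hαβ, hopen.mem_nhds hz] with w hw hwU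
          rw [map_mul, map_mul, map_pow, map_pow, ← han w hwU.2, ← hbm w hwU.2, hw]
          have := pow_ne_zero n hwU.2
          have := pow_ne_zero m hwU.2
          field_simp
  · exact hp _ ((IsLocalization.Away.algebraMap_isUnit c).map p).ne_zero

theorem isStandardSmooth_away [Algebra.IsStandardSmooth ℂ A] (c : A) :
    Algebra.IsStandardSmooth ℂ (Localization.Away c) := by
  have : Algebra.IsStandardSmooth A (Localization.Away c) := .localization_away c
  exact .trans ℂ A _

/-- Every point has arbitrarily small neighbourhoods isomorphic to `Spec A`, for a standard smooth
algebra `A`. -/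
theorem IsSmoothScheme.exists_affineChart (hX : IsSmoothScheme X) (x : X.Pt) {W : Set X.Pt}
    (hW : W ∈ 𝓝 x) :
    ∃ (A : Type) (_ : CommRing A) (_ : Algebra ℂ A) (_ : Algebra.IsStandardSmooth ℂ A) (U : Set X.Pt)
      (ev : X.Pt → A →ₐ[ℂ] ℂ), IsAffineChart X A U ev ∧ x ∈ U ∧ U ⊆ W ∧
        ∀ p : A →ₐ[ℂ] ℂ, ∃ w ∈ U, ev w = p := by
  obtain ⟨A, _, _, _, e, hx, he⟩ := hX x
  have h := isAffineChart_of_openPartialHomeomorph e he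
  obtain ⟨s, hs, hs'⟩ := Algebra.Smooth.exists_span_eq_top_isStandardSmooth ℂ A
  obtain ⟨c, hcs, hc⟩ : ∃ c ∈ s, (e x).eval c ≠ 0 := by
    by_contra! hcon
    have : Ideal.span s ≤ RingHom.ker (e x).eval := Ideal.span_le.2 fun c hc => hcon c hc
    rw [hs] at this
    exact RingHom.ker_ne_top (e x).eval.toRingHom (top_le_iff.1 this)
  have := hs' c hcs
  obtain ⟨ev₁, -, h₁, -⟩ := h.exists_away hc
  obtain ⟨a, ha, haW⟩ := h₁.exists_subset x ⟨hx, hc⟩ W hW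
  obtain ⟨b, hb, hbU⟩ := h₁.open_range x ⟨hx, hc⟩
  have hab : ev₁ x (a * b) ≠ 0 := by
    rw [map_mul]
    exact mul_ne_zero ha hb
  obtain ⟨ev₂, -, h₂, hsurj⟩ := h₁.exists_away hab
  refine ⟨_, _, _, isStandardSmooth_away (a * b), _, ev₂, h₂, ⟨⟨hx, hc⟩, hab⟩, ?_, hsurj ?_⟩
  · rintro w ⟨hw, hwab⟩
    rw [map_mul] at hwab
    exact haW w hw (left_ne_zero_of_mul hwab)
  · intro p hp
    rw [map_mul] at hp
    exact hbU p (right_ne_zero_of_mul hp)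

theorem IsSmoothScheme.inv_mem (hX : IsSmoothScheme X) {f : X.Pt → ℂ} (hf : f ∈ X.regAt x)
    (h0 : f x ≠ 0) : (fun w => (f w)⁻¹) ∈ X.regAt x := by
  obtain ⟨A, _, _, _, U, ev, h, hx, -⟩ := hX.exists_affineChart x Filter.univ_mem
  exact h.inv_mem hx hf h0

theorem IsSmoothScheme.eventually_ne (hX : IsSmoothScheme X) {f : X.Pt → ℂ} (hf : f ∈ X.regAt x)
    (h0 : f x ≠ 0) : ∀ᶠ w in 𝓝 x, f w ≠ 0 := by
  obtain ⟨A, _, _, _, U, ev, h, hx, -⟩ := hX.exists_affineChart x Filter.univ_mem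
  exact h.eventually_ne_zero hx hf h0

/-- A map to an affine chart whose coordinates are regular is a morphism. -/
theorem IsAffineChart.pullsAt (h : IsAffineChart X A U ev) (hT : IsSmoothScheme T) {φ : T.Pt → X.Pt}
    {τ : T.Pt} (hU : ∀ᶠ σ in 𝓝 τ, φ σ ∈ U) (hreg : ∀ a, (fun σ => ev (φ σ) a) ∈ T.regAt τ) :
    ContinuousAt φ τ ∧ PullsAt T X φ τ := by
  have hc : ContinuousAt φ τ := by
    intro W hW
    obtain ⟨a, ha, haW⟩ := h.exists_subset _ hU.self_of_nhds W hW
    change ∀ᶠ σ in 𝓝 τ, φ σ ∈ W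
    filter_upwards [hU, hT.eventually_ne (hreg a) ha] with σ hσ hσa using haW _ hσ hσa
  refine ⟨hc, fun f hf => ?_⟩
  obtain ⟨a, b, hb, hab⟩ := (h.mem_regAt_iff _ hU.self_of_nhds f).1 hf
  refine T.regAt_congr (mul_mem' (hreg a) (hT.inv_mem (hreg b) hb)) ?_
  filter_upwards [hc.eventually hab] with σ hσ
  rw [Function.comp_apply, hσ, div_eq_mul_inv]

/-- A morphism to an affine chart `Spec A` is given, locally on its source, by a homomorphism of
algebras. -/
theorem IsAffineChart.exists_algHom (h : IsAffineChart X A U ev) [Algebra.FiniteType ℂ A]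
    (hT : IsSmoothScheme T) {φ : T.Pt → X.Pt} (hφ : IsMorphism T X φ) {τ : T.Pt} (hτ : φ τ ∈ U) :
    ∃ (B : Type) (_ : CommRing B) (_ : Algebra ℂ B) (_ : Algebra.IsStandardSmooth ℂ B) (V : Set T.Pt)
      (ev' : T.Pt → B →ₐ[ℂ] ℂ) (F : A →ₐ[ℂ] B), IsAffineChart T B V ev' ∧ τ ∈ V ∧
        (∀ p : B →ₐ[ℂ] ℂ, ∃ w ∈ V, ev' w = p) ∧
        ∀ w ∈ V, φ w ∈ U ∧ ∀ a, ev' w (F a) = ev (φ w) a := by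
  obtain ⟨B, _, _, _, V, ev', h', hτV, hVU, hV⟩ := hT.exists_affineChart τ
    (hφ.1.continuousAt.preimage_mem_nhds (h.isOpen.mem_nhds hτ))
  obtain ⟨n, g, hg⟩ := Algebra.FiniteType.iff_quotient_mvPolynomial''.1
    ‹Algebra.FiniteType ℂ A›
  have hreg : ∀ i, (fun w => ev (φ w) (g (MvPolynomial.X i))) ∈ T.regAt τ := fun i =>
    hφ.2 τ _ (h.eval_mem hτ _)
  choose α β hβ hαβ using fun i => (h'.mem_regAt_iff τ hτV _).1 (hreg i)
  obtain ⟨c₀, hc₀, hc₀'⟩ := h'.exists_subset τ hτV _ (Filter.eventually_all.2 hαβ)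
  let c := c₀ * ∏ i, β i
  have hc : ev' τ c ≠ 0 := by
    rw [map_mul, map_prod]
    exact mul_ne_zero hc₀ (Finset.prod_ne_zero_iff.2 fun i _ => hβ i)
  obtain ⟨ev₁, hev₁, h₁, hsurj⟩ := h'.exists_away hc
  have hsurj₁ := hsurj fun p _ => hV p
  have hunit : ∀ i, IsUnit (algebraMap B (Localization.Away c) (β i)) := fun i =>
    isUnit_of_dvd_unit (map_dvd _ ((Finset.dvd_prod_of_mem β (Finset.mem_univ i)).mul_left c₀))
      (IsLocalization.Away.algebraMap_isUnit c)
  let F₀ : MvPolynomial (Fin n) ℂ →ₐ[ℂ] Localization.Away c :=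
    MvPolynomial.aeval fun i => algebraMap B _ (α i) * ((hunit i).unit⁻¹ : (Localization.Away c)ˣ)
  have hF₀ : ∀ w ∈ {z ∈ V | ev' z c ≠ 0}, (ev₁ w).comp F₀ = (ev (φ w)).comp g := by
    rintro w ⟨hwV, hwc⟩
    refine MvPolynomial.algHom_ext fun i => ?_
    have hne : ev' w c₀ ≠ 0 ∧ ∀ i, ev' w (β i) ≠ 0 := by
      rw [map_mul, map_prod] at hwc
      exact ⟨left_ne_zero_of_mul hwc, fun i =>
        Finset.prod_ne_zero_iff.1 (right_ne_zero_of_mul hwc) i (Finset.mem_univ i)⟩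
    have hmul : ev₁ w (F₀ (MvPolynomial.X i)) * ev' w (β i) = ev' w (α i) := by
      rw [← hev₁ w hwc, ← hev₁ w hwc, ← map_mul]
      simp [F₀, mul_assoc]
    change ev₁ w (F₀ (MvPolynomial.X i)) = ev (φ w) (g (MvPolynomial.X i))
    rw [show ev (φ w) (g (MvPolynomial.X i)) = ev' w (α i) / ev' w (β i) from hc₀' w hwV hne.1 i,
      eq_div_iff (hne.2 i), hmul]
  have := isStandardSmooth_away c
  have hker : RingHom.ker g.toRingHom ≤ RingHom.ker F₀.toRingHom := by
    intro q hq
    refine eq_zero_of_forall_complexPoint fun p => ?_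
    obtain ⟨w, hw, rfl⟩ := hsurj₁ p
    have := AlgHom.congr_fun (hF₀ w hw) q
    change ev₁ w (F₀ q) = ev (φ w) (g q) at this
    rw [show g q = 0 from hq, map_zero] at this
    exact this
  let F : A →ₐ[ℂ] Localization.Away c := g.liftOfSurjective hg F₀ hker
  refine ⟨_, _, _, this, _, ev₁, F, h₁, ⟨hτV, hc⟩, hsurj₁, fun w hw => ⟨hVU hw.1, fun a => ?_⟩⟩
  obtain ⟨q, rfl⟩ := hg a
  have hFq : F (g q) = F₀ q := by simp [F]
  rw [hFq]
  exact AlgHom.congr_fun (hF₀ w hw) q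

end FunctionSpace

end Affine


/-! ### Tangent vectors and coordinates on smooth schemes -/

section AffineTangent

namespace FunctionSpace

open KaehlerDifferential

variable {X Y Z T : FunctionSpace.{u} ℂ} {A B : Type} [CommRing A] [Algebra ℂ A] [CommRing B]
  [Algebra ℂ B] {U : Set X.Pt} {ev : X.Pt → A →ₐ[ℂ] ℂ} {x z : X.Pt}

/-- The derivation of `A` given by a tangent vector. -/
theorem IsAffineChart.exists_pointDerivation (h : IsAffineChart X A U ev) (hz : z ∈ U)
    (v : X.Tangent z) :
    ∃ δ : A →ₗ[ℂ] ℂ, IsPointDerivation (ev z) δ ∧ ∀ a, δ a = X.d (fun w => ev w a) z v := by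
  let δ : A →ₗ[ℂ] ℂ :=
    { toFun := fun a => X.d (fun w => ev w a) z v
      map_add' := fun a b => by
        simp only [map_add]
        exact d_add (h.eval_mem hz a) (h.eval_mem hz b) v
      map_smul' := fun c a => by
        simp only [map_smul, smul_eq_mul]
        exact d_const_mul c (h.eval_mem hz a) v }
  refine ⟨δ, fun a b => ?_, fun a => rfl⟩
  change X.d (fun w => ev w (a * b)) z v = _
  simp only [map_mul]
  exact d_mul (h.eval_mem hz a) (h.eval_mem hz b) v

/-- The quotient rule. -/
theorem IsAffineChart.d_div (h : IsAffineChart X A U ev) (hz : z ∈ U) {f : X.Pt → ℂ} {a b : A}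
    (hb : ev z b ≠ 0) (hab : ∀ᶠ w in 𝓝 z, f w = ev w a / ev w b) (v : X.Tangent z) :
    X.d f z v = (X.d (fun w => ev w a) z v - f z * X.d (fun w => ev w b) z v) / ev z b := by
  have hf : f ∈ X.regAt z := (h.mem_regAt_iff z hz f).2 ⟨a, b, hb, hab⟩
  have : (fun w => ev w a) =ᶠ[𝓝 z] fun w => f w * ev w b := by
    filter_upwards [hab, h.eventually_ne z hz b hb] with w hw hwb
    rw [hw, div_mul_cancel₀ _ hwb]
  rw [d_congr this, d_mul hf (h.eval_mem hz b), eq_div_iff hb]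
  ring

/-- Tangent vectors are determined by the derivatives of the elements of `A`. -/
theorem IsAffineChart.tangent_ext (h : IsAffineChart X A U ev) (hz : z ∈ U) {v v' : X.Tangent z}
    (hv : ∀ a, X.d (fun w => ev w a) z v = X.d (fun w => ev w a) z v') : v = v' := by
  refine FunctionSpace.tangent_ext fun f hf => ?_
  obtain ⟨a, b, hb, hab⟩ := (h.mem_regAt_iff z hz f).1 hf
  rw [h.d_div hz hb hab, h.d_div hz hb hab, hv, hv]

/-- A derivation of `A` at a point extends to the local ring of regular functions. -/
theorem IsAffineChart.exists_tangent (h : IsAffineChart X A U ev) [Algebra.Smooth ℂ A] (hz : z ∈ U)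
    {δ : A →ₗ[ℂ] ℂ} (hδ : IsPointDerivation (ev z) δ) :
    ∃ v : X.Tangent z, ∀ a, X.d (fun w => ev w a) z v = δ a := by
  classical
  let Q : (X.Pt → ℂ) → A → A → Prop := fun f a b => ev z b ≠ 0 ∧ ∀ᶠ w in 𝓝 z, f w = ev w a / ev w b
  let D : (X.Pt → ℂ) → ℂ := fun f =>
    if hf : ∃ q : A × A, Q f q.1 q.2 then
      (δ hf.choose.1 - f z * δ hf.choose.2) / ev z hf.choose.2
    else 0
  have hwell : ∀ f a b a' b', Q f a b → Q f a' b' →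
      (δ a - f z * δ b) / ev z b = (δ a' - f z * δ b') / ev z b' := by
    rintro f a b a' b' ⟨hb, hab⟩ ⟨hb', hab'⟩
    have hev : ∀ᶠ w in 𝓝 z, ev w (a * b' - a' * b) = 0 := by
      filter_upwards [hab, hab', h.eventually_ne z hz b hb, h.eventually_ne z hz b' hb'] with
        w h1 h2 h3 h4
      rw [h1, div_eq_div_iff h3 h4] at h2
      rw [map_sub, map_mul, map_mul, h2, sub_self]
    obtain ⟨c, hc, hc0⟩ := h.exists_mul_eq_zero hz hev
    have h1 : δ (a * b' - a' * b) = 0 := by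
      have := hδ c (a * b' - a' * b)
      rw [hc0, map_zero, hev.self_of_nhds, zero_mul, add_zero] at this
      exact (mul_eq_zero.1 this.symm).resolve_left hc
    rw [map_sub, hδ, hδ] at h1
    have ha : ev z a = f z * ev z b := by rw [hab.self_of_nhds, div_mul_cancel₀ _ hb]
    have ha' : ev z a' = f z * ev z b' := by rw [hab'.self_of_nhds, div_mul_cancel₀ _ hb']
    rw [ha, ha'] at h1
    rw [div_eq_div_iff hb hb']
    linear_combination h1
  have hD : ∀ f a b, Q f a b → D f = (δ a - f z * δ b) / ev z b := by
    intro f a b hab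
    have hf : ∃ q : A × A, Q f q.1 q.2 := ⟨(a, b), hab⟩
    simp only [D, dif_pos hf]
    exact hwell f _ _ _ _ hf.choose_spec hab
  obtain ⟨v, hv⟩ := FunctionSpace.exists_tangent (x := z) D (by
    intro f hf g hg
    obtain ⟨a, b, hb, hab⟩ := (h.mem_regAt_iff z hz f).1 hf
    obtain ⟨a', b', hb', hab'⟩ := (h.mem_regAt_iff z hz g).1 hg
    rw [hD f a b ⟨hb, hab⟩, hD g a' b' ⟨hb', hab'⟩,
      hD (fun w => f w + g w) (a * b' + a' * b) (b * b') ⟨?_, ?_⟩, map_add, hδ, hδ, hδ, map_mul]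
    · have ha : ev z a = f z * ev z b := by rw [hab.self_of_nhds, div_mul_cancel₀ _ hb]
      have ha' : ev z a' = g z * ev z b' := by rw [hab'.self_of_nhds, div_mul_cancel₀ _ hb']
      rw [ha, ha']
      field_simp
      ring
    · rw [map_mul]
      exact mul_ne_zero hb hb'
    · filter_upwards [hab, hab', h.eventually_ne z hz b hb, h.eventually_ne z hz b' hb'] with
        w h1 h2 h3 h4
      rw [h1, h2, map_add, map_mul, map_mul, map_mul, div_add_div _ _ h3 h4]
      ring) (by
    intro c f hf
    obtain ⟨a, b, hb, hab⟩ := (h.mem_regAt_iff z hz f).1 hf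
    rw [hD f a b ⟨hb, hab⟩, hD (fun w => c * f w) (c • a) b ⟨hb, ?_⟩, map_smul, smul_eq_mul]
    · ring
    · filter_upwards [hab] with w hw
      rw [hw, map_smul, smul_eq_mul, mul_div_assoc]) (by
    intro f hf g hg
    obtain ⟨a, b, hb, hab⟩ := (h.mem_regAt_iff z hz f).1 hf
    obtain ⟨a', b', hb', hab'⟩ := (h.mem_regAt_iff z hz g).1 hg
    rw [hD f a b ⟨hb, hab⟩, hD g a' b' ⟨hb', hab'⟩,
      hD (fun w => f w * g w) (a * a') (b * b') ⟨?_, ?_⟩, hδ, hδ, map_mul]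
    · have ha : ev z a = f z * ev z b := by rw [hab.self_of_nhds, div_mul_cancel₀ _ hb]
      have ha' : ev z a' = g z * ev z b' := by rw [hab'.self_of_nhds, div_mul_cancel₀ _ hb']
      rw [ha, ha']
      field_simp
      ring
    · rw [map_mul]
      exact mul_ne_zero hb hb'
    · filter_upwards [hab, hab'] with w h1 h2
      rw [h1, h2, map_mul, map_mul, div_mul_div_comm])
  refine ⟨v, fun a => ?_⟩
  rw [hv _ (h.eval_mem hz a), hD _ a 1 ⟨by simp, Filter.Eventually.of_forall fun w => by simp⟩]
  simp [hδ.map_one]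

/-- A basis of the Kähler differentials by differentials of elements of `A` gives coordinates. -/
theorem IsAffineChart.exists_frame (h : IsAffineChart X A U ev) [Algebra.IsStandardSmooth ℂ A]
    (hx : x ∈ U) :
    ∃ (n : ℕ) (y : Fin n → X.Pt → ℂ) (D : Fin n → X.VectorField), X.IsFrame x y D := by
  classical
  obtain ⟨n, c, b, hb⟩ := exists_coordinates A
  let δ : Fin n → A → A := fun i a => b.coord i (KaehlerDifferential.D ℂ A a)
  have hex : ∀ z ∈ U, ∀ i, ∃ v : X.Tangent z, ∀ a, X.d (fun w => ev w a) z v = ev z (δ i a) :=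
    fun z hz i => h.exists_tangent hz (isPointDerivation_of_linearMap (ev z) (b.coord i))
  let V : Fin n → X.VectorField := fun i z => if hz : z ∈ U then (hex z hz i).choose else 0
  have hV : ∀ z ∈ U, ∀ i a, X.d (fun w => ev w a) z (V i z) = ev z (δ i a) := by
    intro z hz i
    simp only [V, dif_pos hz]
    exact (hex z hz i).choose_spec
  have hδc : ∀ i j, δ i (c j) = if i = j then 1 else 0 := by
    intro i j
    change b.coord i (KaehlerDifferential.D ℂ A (c j)) = _
    rw [← hb]
    simp [Finsupp.single_apply, eq_comm]
  have hexp : ∀ z ∈ U, ∀ v : X.Tangent z, v = ∑ i, X.d (fun w => ev w (c i)) z v • V i z := by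
    intro z hz v
    refine h.tangent_ext hz fun a => ?_
    obtain ⟨δv, hδv, hv⟩ := h.exists_pointDerivation hz v
    obtain ⟨L, hL, hLD⟩ := hδv.exists_kaehler
    rw [map_sum, ← hv, ← hLD]
    conv_lhs => rw [← b.sum_equivFun (KaehlerDifferential.D ℂ A a)]
    rw [map_sum]
    refine Finset.sum_congr rfl fun i _ => ?_
    rw [hL, hb, hLD, hv, map_smul, hV z hz, smul_eq_mul, mul_comm]
    rfl
  refine ⟨n, fun i w => ev w (c i), V, fun i => h.eval_mem hx _, fun i => ?_, ?_, ?_⟩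
  · filter_upwards [h.isOpen.mem_nhds hx] with z hz f hf
    obtain ⟨a, b', hb', hab⟩ := (h.mem_regAt_iff z hz f).1 hf
    refine X.regAt_congr (mul_mem' (sub_mem' (h.eval_mem hz (δ i a))
      (mul_mem' hf (h.eval_mem hz (δ i b')))) (h.inv_mem hz (h.eval_mem hz b') hb')) ?_
    filter_upwards [hab.eventually_nhds, h.eventually_ne z hz b' hb', h.isOpen.mem_nhds hz] with
      w hw hwb hwU
    rw [h.d_div hwU hwb hw, hV w hwU, hV w hwU, div_eq_mul_inv]
  · filter_upwards [h.isOpen.mem_nhds hx] with z hz i j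
    rw [hV z hz, hδc]
    split_ifs <;> simp
  · filter_upwards [h.isOpen.mem_nhds hx] with z hz v f hf
    conv_lhs => rw [hexp z hz v]
    rw [map_sum]
    exact Finset.sum_congr rfl fun i _ => by rw [map_smul, smul_eq_mul, mul_comm]

theorem IsSmoothScheme.hasCoordinates (hX : IsSmoothScheme X) : HasCoordinates X where
  inv_mem := hX.inv_mem
  eventually_ne := hX.eventually_ne
  exists_frame x := by
    obtain ⟨A, _, _, _, U, ev, h, hx, -⟩ := hX.exists_affineChart x Filter.univ_mem
    exact h.exists_frame hx

/-! ### Submersions of smooth schemes -/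

/-- A submersion of smooth schemes is given, in suitable affine charts, by a smooth algebra. -/
theorem exists_smooth_charts (hY : IsSmoothScheme Y) (hZ : IsSmoothScheme Z) {ψ : Y.Pt → Z.Pt}
    (hψ : IsSubmersion Y Z ψ) (y : Y.Pt) :
    ∃ (A : Type) (_ : CommRing A) (_ : Algebra ℂ A) (_ : Algebra.IsStandardSmooth ℂ A) (U : Set Z.Pt)
      (ev : Z.Pt → A →ₐ[ℂ] ℂ) (B : Type) (_ : CommRing B) (_ : Algebra ℂ B) (V : Set Y.Pt)
      (ev' : Y.Pt → B →ₐ[ℂ] ℂ) (_ : Algebra A B) (_ : IsScalarTower ℂ A B) (_ : Algebra.Smooth A B),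
      IsAffineChart Z A U ev ∧ IsAffineChart Y B V ev' ∧ y ∈ V ∧
        (∀ p : B →ₐ[ℂ] ℂ, ∃ w ∈ V, ev' w = p) ∧
        ∀ w ∈ V, ψ w ∈ U ∧ ∀ a, ev' w (algebraMap A B a) = ev (ψ w) a := by
  obtain ⟨A, _, _, _, U, ev, h, hyU, -⟩ := hZ.exists_affineChart (ψ y) Filter.univ_mem
  obtain ⟨B, _, _, _, V, ev', F, h', hyV, hV, hF⟩ := h.exists_algHom hY hψ.1 hyU
  let : Algebra A B := F.toAlgebra
  have : IsScalarTower ℂ A B := IsScalarTower.of_algebraMap_eq fun r => (F.commutes r).symm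
  obtain ⟨c, hc, hcs⟩ := exists_smooth_away (A := A) (ev' y) (by
    intro δ hδ
    have hp : (ev' y).comp (IsScalarTower.toAlgHom ℂ A B) = ev (ψ y) :=
      AlgHom.ext fun a => (hF y hyV).2 a
    rw [hp] at hδ
    obtain ⟨v, hv⟩ := h.exists_tangent hyU hδ
    obtain ⟨w, rfl⟩ := hψ.2 y v
    obtain ⟨δ', hδ', hw⟩ := h'.exists_pointDerivation hyV w
    refine ⟨δ', hδ', fun a => ?_⟩
    rw [hw, ← hv a, d_differential (hψ.1.pullsAt y) rfl (h.eval_mem hyU a)]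
    refine d_congr ?_ w
    filter_upwards [h'.isOpen.mem_nhds hyV] with z hz using (hF z hz).2 a)
  obtain ⟨ev₁, hev₁, h₁, hsurj⟩ := h'.exists_away hc
  refine ⟨A, _, _, inferInstance, U, ev, Localization.Away c, _, inferInstance, _, ev₁, inferInstance,
    inferInstance, hcs, h, h₁, ⟨hyV, hc⟩, hsurj fun p _ => hV p, fun w hw => ⟨(hF w hw.1).1, fun a => ?_⟩⟩
  rw [IsScalarTower.algebraMap_apply A B, hev₁ w hw.2]
  exact (hF w hw.1).2 a

/-- After localization, `f ∘ ψ` is an element of an algebra which is smooth over the ring of an affine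
neighbourhood of `ψ y`, and it is constant on the fibres. -/
theorem IsSmoothScheme.descent (hY : IsSmoothScheme Y) (hZ : IsSmoothScheme Z) {ψ : Y.Pt → Z.Pt}
    (hψ : IsSubmersion Y Z ψ) (y : Y.Pt) {f : Z.Pt → ℂ} (hf : f ∘ ψ ∈ Y.regAt y) :
    f ∈ Z.regAt (ψ y) := by
  obtain ⟨A, _, _, _, U, ev, B, _, _, V, ev', _, _, _, h, h', hyV, hV, hψV⟩ :=
    exists_smooth_charts hY hZ hψ y
  obtain ⟨α, γ, hγ, hαγ⟩ := (h'.mem_regAt_iff y hyV _).1 hf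
  obtain ⟨c₀, hc₀, hc₀'⟩ := h'.exists_subset y hyV _ hαγ
  have hc : ev' y (c₀ * γ) ≠ 0 := by
    rw [map_mul]
    exact mul_ne_zero hc₀ hγ
  obtain ⟨ev₁, hev₁, h₁, hsurj⟩ := h'.exists_away hc
  have hsurj := hsurj fun p _ => hV p
  let B' := Localization.Away (c₀ * γ)
  have : Algebra.Smooth B B' := .of_isLocalization_Away (c₀ * γ)
  have : Algebra.Smooth A B' := .comp A B _
  have hu : IsUnit (algebraMap B B' γ) :=
    isUnit_of_dvd_unit (map_dvd _ (dvd_mul_left γ c₀)) (IsLocalization.Away.algebraMap_isUnit (c₀ * γ))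
  let β : B' := algebraMap B B' α * (hu.unit⁻¹ : B'ˣ)
  have hA : ∀ w ∈ {z ∈ V | ev' z (c₀ * γ) ≠ 0}, ∀ a, ev₁ w (algebraMap A B' a) = ev (ψ w) a := by
    intro w hw a
    rw [IsScalarTower.algebraMap_apply A B, hev₁ w hw.2]
    exact (hψV w hw.1).2 a
  have hβ : ∀ w ∈ {z ∈ V | ev' z (c₀ * γ) ≠ 0}, ev₁ w β = f (ψ w) := by
    rintro w ⟨hwV, hwc⟩
    have hne := hwc
    rw [map_mul] at hne
    have hmul : ev₁ w β * ev' w γ = ev' w α := by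
      rw [← hev₁ w hwc, ← hev₁ w hwc, ← map_mul, mul_assoc, hu.val_inv_mul, mul_one]
    rw [show f (ψ w) = ev' w α / ev' w γ from hc₀' w hwV (left_ne_zero_of_mul hne),
      eq_div_iff (right_ne_zero_of_mul hne), hmul]
  have hinj : ∀ w ∈ {z ∈ V | ev' z (c₀ * γ) ≠ 0}, ∀ z ∈ U,
      (∀ a, ev₁ w (algebraMap A B' a) = ev z a) → ψ w = z := by
    intro w hw z hz hwz
    exact h.injOn (hψV w hw.1).1 hz (AlgHom.ext fun a => by rw [← hwz, hA w hw])
  obtain ⟨a, a₁, ha, har⟩ := exists_descent (A := A) β (by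
    intro p q hpq
    obtain ⟨w, hw, rfl⟩ := hsurj p
    obtain ⟨w', hw', rfl⟩ := hsurj q
    rw [hβ w hw, hβ w' hw', hinj w hw (ψ w') (hψV w' hw'.1).1 fun a => by rw [hpq, hA w' hw']])
    (ev₁ y)
  have hyU := (hψV y hyV).1
  rw [hA y ⟨hyV, hc⟩] at ha
  refine (h.mem_regAt_iff _ hyU f).2 ⟨a₁, a, ha, ?_⟩
  filter_upwards [h.isOpen.mem_nhds hyU, h.eventually_ne _ hyU a ha] with z hz hza
  obtain ⟨p, hp, hpβ⟩ := har (ev z) hza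
  obtain ⟨w, hw, rfl⟩ := hsurj p
  rw [eq_div_iff hza, ← hpβ, hβ w hw, hinj w hw z hz hp, mul_comm]

end FunctionSpace

end AffineTangent


/-! ### Fibre products of smooth schemes -/

section AffineFiberProduct

open TensorProduct

namespace FunctionSpace

/-- The space of closed points of `Spec R`, with its sheaf of regular functions. -/
def maxSpec (R : Type) [CommRing R] [Algebra ℂ R] : FunctionSpace.{u} ℂ where
  Pt := ULift.{u} (MaxSpec R)
  regAt τ :=
    { carrier := {f | ∃ a b : R, τ.down.eval b ≠ 0 ∧ ∀ᶠ σ in 𝓝 τ, f σ = σ.down.eval a / σ.down.eval b}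
      mul_mem' := by
        rintro f g ⟨a, b, hb, hf⟩ ⟨a', b', hb', hg⟩
        refine ⟨a * a', b * b', by rw [map_mul]; exact mul_ne_zero hb hb', ?_⟩
        filter_upwards [hf, hg] with σ h1 h2
        rw [Pi.mul_apply, h1, h2, map_mul, map_mul, div_mul_div_comm]
      add_mem' := by
        rintro f g ⟨a, b, hb, hf⟩ ⟨a', b', hb', hg⟩
        refine ⟨a * b' + b * a', b * b', by rw [map_mul]; exact mul_ne_zero hb hb', ?_⟩
        filter_upwards [hf, hg,
          continuous_uliftDown.continuousAt.eventually (MaxSpec.eventually_ne hb),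
          continuous_uliftDown.continuousAt.eventually (MaxSpec.eventually_ne hb')] with σ h1 h2 h3 h4
        rw [Pi.add_apply, h1, h2, map_add, map_mul, map_mul, map_mul, div_add_div _ _ h3 h4]
      algebraMap_mem' := fun r => ⟨algebraMap ℂ R r, 1, by simp, Filter.Eventually.of_forall fun σ => by
        simp⟩ }
  regAt_congr := by
    rintro τ f g ⟨a, b, hb, hf⟩ hfg
    refine ⟨a, b, hb, ?_⟩
    filter_upwards [hf, hfg] with σ h1 h2
    rw [← h2, h1]
  regAt_nhds := by
    rintro τ f ⟨a, b, hb, hf⟩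
    filter_upwards [hf.eventually_nhds,
      continuous_uliftDown.continuousAt.eventually (MaxSpec.eventually_ne hb)] with σ h1 h2
    exact ⟨a, b, h2, h1⟩

theorem mem_regAt_maxSpec {R : Type} [CommRing R] [Algebra ℂ R] (τ : (maxSpec.{u} R).Pt)
    (f : (maxSpec.{u} R).Pt → ℂ) :
    f ∈ (maxSpec.{u} R).regAt τ ↔ ∃ a b : R, τ.down.eval b ≠ 0 ∧
      ∀ᶠ σ in 𝓝 τ, f σ = σ.down.eval a / σ.down.eval b := Iff.rfl

theorem isSmoothScheme_maxSpec (R : Type) [CommRing R] [Algebra ℂ R] [Algebra.Smooth ℂ R] :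
    IsSmoothScheme (maxSpec.{u} R) := fun _ =>
  ⟨R, _, _, inferInstance, (Homeomorph.ulift : ULift.{u} (MaxSpec R) ≃ₜ MaxSpec R).toOpenPartialHomeomorph,
    trivial, fun τ _ f => mem_regAt_maxSpec τ f⟩

theorem isAffineChart_maxSpec (R : Type) [CommRing R] [Algebra ℂ R] :
    IsAffineChart (maxSpec.{u} R) R Set.univ fun τ => τ.down.eval :=
  isAffineChart_of_openPartialHomeomorph (X := maxSpec.{u} R)
    (Homeomorph.ulift : ULift.{u} (MaxSpec R) ≃ₜ MaxSpec R).toOpenPartialHomeomorph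
    fun τ _ f => mem_regAt_maxSpec τ f

variable {X Y Z : FunctionSpace.{u} ℂ}

/-- Locally, the fibre product of `Spec R` and `Spec B` over `Spec A` is the spectrum of `R ⊗ B`, which
is smooth over `R` if `B` is smooth over `A`. Its tangent vectors are homomorphisms to the dual
numbers. -/
theorem IsSmoothScheme.fiberProduct (hX : IsSmoothScheme X) (hY : IsSmoothScheme Y)
    (hZ : IsSmoothScheme Z) {φ : X.Pt → Z.Pt} {ψ : Y.Pt → Z.Pt} (hφ : IsMorphism X Z φ)
    (hψ : IsSubmersion Y Z ψ) {x : X.Pt} {y : Y.Pt} (hxy : φ x = ψ y) :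
    ∃ (T : FunctionSpace.{u} ℂ) (a : T.Pt → X.Pt) (b : T.Pt → Y.Pt) (τ : T.Pt),
      IsLocalFiberProduct IsSmoothScheme (X := X) (Y := Y) (Z := Z) φ ψ a b ∧ a τ = x ∧ b τ = y := by
  obtain ⟨A, _, _, _, U, ev, B, _, _, V, evY, _, _, _, h, hV, hyV, hVs, hψV⟩ :=
    exists_smooth_charts hY hZ hψ y
  have hxU : φ x ∈ U := hxy ▸ (hψV y hyV).1
  obtain ⟨R, _, _, _, W, evX, F, hW, hxW, hWs, hφW⟩ := h.exists_algHom hX hφ hxU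
  let : Algebra A R := F.toAlgebra
  have : IsScalarTower ℂ A R := IsScalarTower.of_algebraMap_eq fun r => (F.commutes r).symm
  have hφW : ∀ w ∈ W, φ w ∈ U ∧ ∀ a, evX w (algebraMap A R a) = ev (φ w) a := hφW
  let P := R ⊗[A] B
  have : Algebra.Smooth ℂ P := .comp ℂ R _
  let ι₁ : R →ₐ[ℂ] P := (Algebra.TensorProduct.includeLeft : R →ₐ[A] P).restrictScalars ℂ
  let ι₂ : B →ₐ[ℂ] P := (Algebra.TensorProduct.includeRight : B →ₐ[A] P).restrictScalars ℂ
  have hι : ∀ a, ι₁ (algebraMap A R a) = ι₂ (algebraMap A B a) := fun a => by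
    change (Algebra.TensorProduct.includeLeft : R →ₐ[A] P) _ =
      (Algebra.TensorProduct.includeRight : B →ₐ[A] P) _
    rw [AlgHom.commutes, AlgHom.commutes]
  have htmul : ∀ r b, (r ⊗ₜ[A] b : P) = ι₁ r * ι₂ b := fun r b => by
    change _ = (r ⊗ₜ[A] (1 : B)) * ((1 : R) ⊗ₜ[A] b)
    rw [Algebra.TensorProduct.tmul_mul_tmul, mul_one, one_mul]
  let T : FunctionSpace.{u} ℂ := maxSpec P
  let evT : T.Pt → P →ₐ[ℂ] ℂ := fun τ => τ.down.eval
  have hT : IsSmoothScheme T := isSmoothScheme_maxSpec P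
  have hTc : IsAffineChart T P Set.univ evT := isAffineChart_maxSpec P
  choose a haW ha using fun τ : T.Pt => hWs ((evT τ).comp ι₁)
  choose b hbV hb using fun τ : T.Pt => hVs ((evT τ).comp ι₂)
  have ha' : ∀ τ r, evX (a τ) r = evT τ (ι₁ r) := fun τ r => by rw [ha]; rfl
  have hb' : ∀ τ s, evY (b τ) s = evT τ (ι₂ s) := fun τ s => by rw [hb]; rfl
  have hreg : ∀ τ p, (fun σ => evT σ p) ∈ T.regAt τ := fun τ p => hTc.eval_mem trivial p
  have hca := fun τ => hW.pullsAt hT (φ := a) (τ := τ) (Filter.Eventually.of_forall haW)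
    fun r => by simpa only [ha'] using hreg τ (ι₁ r)
  have hcb := fun τ => hV.pullsAt hT (φ := b) (τ := τ) (Filter.Eventually.of_forall hbV)
    fun s => by simpa only [hb'] using hreg τ (ι₂ s)
  have hma : IsMorphism T X a := ⟨continuous_iff_continuousAt.2 fun τ => (hca τ).1, fun τ => (hca τ).2⟩
  have hmb : IsMorphism T Y b := ⟨continuous_iff_continuousAt.2 fun τ => (hcb τ).1, fun τ => (hcb τ).2⟩
  have hcomm : ∀ τ, φ (a τ) = ψ (b τ) := fun τ =>
    h.injOn (hφW _ (haW τ)).1 (hψV _ (hbV τ)).1 (AlgHom.ext fun α => by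
      rw [← (hφW _ (haW τ)).2, ← (hψV _ (hbV τ)).2, ha', hb', hι])
  -- A point of `T` is determined by its images, and any pair of compatible points comes from one.
  have hpt : ∀ x' ∈ W, ∀ y' ∈ V, φ x' = ψ y' → ∃ τ, a τ = x' ∧ b τ = y' := by
    intro x' hx' y' hy' hxy'
    obtain ⟨k, hk₁, hk₂⟩ := exists_tensor_algHom (A := A) (evX x') (evY y') fun α => by
      rw [(hφW _ hx').2, (hψV _ hy').2, hxy']
    let τ : T.Pt := ULift.up (show MaxSpec P from k)
    refine ⟨τ, hW.injOn (haW _) hx' (AlgHom.ext fun r => ?_), hV.injOn (hbV _) hy' (AlgHom.ext fun s => ?_)⟩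
    · rw [ha']
      exact hk₁ r
    · rw [hb']
      exact hk₂ s
  have hext : ∀ τ τ', a τ = a τ' → b τ = b τ' → τ = τ' := by
    intro τ τ' h1 h2
    refine hTc.injOn trivial trivial (AlgHom.ext fun p => ?_)
    induction p using TensorProduct.induction_on with
    | zero => rw [map_zero, map_zero]
    | tmul r s => rw [htmul, map_mul, map_mul, ← ha', ← ha', ← hb', ← hb', h1, h2]
    | add p q hp hq => rw [map_add, map_add, hp, hq]
  have hda : ∀ τ r (t : T.Tangent τ), X.d (fun w => evX w r) (a τ) (differential a τ (a τ) t) =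
      T.d (fun σ => evT σ (ι₁ r)) τ t := fun τ r t => by
    rw [d_differential (hma.pullsAt τ) rfl (hW.eval_mem (haW τ) r)]
    exact d_congr (Filter.Eventually.of_forall fun σ => ha' σ r) t
  have hdb : ∀ τ s (t : T.Tangent τ), Y.d (fun w => evY w s) (b τ) (differential b τ (b τ) t) =
      T.d (fun σ => evT σ (ι₂ s)) τ t := fun τ s t => by
    rw [d_differential (hmb.pullsAt τ) rfl (hV.eval_mem (hbV τ) s)]
    exact d_congr (Filter.Eventually.of_forall fun σ => hb' σ s) t
  obtain ⟨τ₀, hτ₀⟩ := hpt x hxW y hyV hxy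
  refine ⟨T, a, b, τ₀, ?_, hτ₀.1, hτ₀.2⟩
  refine ⟨hT, hma, hmb, hcomm, fun τ v w hvw => ?_, fun τ t h1 h2 => ?_, ?_⟩
  · obtain ⟨δ, hδ, hδv⟩ := hW.exists_pointDerivation (haW τ) v
    obtain ⟨ε, hε, hεw⟩ := hV.exists_pointDerivation (hbV τ) w
    obtain ⟨f, hf⟩ := hδ.exists_dual
    obtain ⟨g, hg⟩ := hε.exists_dual
    have hφa := hφW _ (haW τ)
    have hψb := hψV _ (hbV τ)
    obtain ⟨k, hk₁, hk₂⟩ := exists_tensor_algHom (A := A) f g fun α => by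
      refine TrivSqZeroExt.ext ?_ ?_
      · rw [(hf _).1, (hg _).1, hφa.2, hψb.2, hcomm]
      · rw [(hf _).2, (hg _).2, hδv, hεw]
        have h1 := d_differential (hφ.pullsAt (a τ)) rfl (h.eval_mem hφa.1 α) v
        have h2 := d_differential (hψ.1.pullsAt (b τ)) (hcomm τ).symm (h.eval_mem hφa.1 α) w
        rw [hvw, h2] at h1
        refine (d_congr ?_ v).trans (h1.symm.trans (d_congr ?_ w))
        · filter_upwards [hW.isOpen.mem_nhds (haW τ)] with z hz using (hφW z hz).2 α
        · filter_upwards [hV.isOpen.mem_nhds (hbV τ)] with z hz using ((hψV z hz).2 α).symm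
    have hfst : ∀ p, (k p).fst = evT τ p := by
      intro p
      induction p using TensorProduct.induction_on with
      | zero => rw [map_zero, map_zero, TrivSqZeroExt.fst_zero]
      | tmul r s =>
        rw [htmul, map_mul, map_mul, TrivSqZeroExt.fst_mul, ← ha', ← hb', ← (hf r).1, ← (hg s).1,
          ← hk₁, ← hk₂]
        rfl
      | add p q hp hq => rw [map_add, map_add, TrivSqZeroExt.fst_add, hp, hq]
    obtain ⟨t, ht⟩ := hTc.exists_tangent trivial (isPointDerivation_snd hfst)
    refine ⟨t, hW.tangent_ext (haW τ) fun r => ?_, hV.tangent_ext (hbV τ) fun s => ?_⟩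
    · rw [hda, ht, ← hδv, ← (hf r).2, ← hk₁]
      rfl
    · rw [hdb, ht, ← hεw, ← (hg s).2, ← hk₂]
      rfl
  · obtain ⟨δ, hδ, hδt⟩ := hTc.exists_pointDerivation trivial t
    have h1' : ∀ r, δ (ι₁ r) = 0 := fun r => by rw [hδt, ← hda, h1, map_zero]
    have h2' : ∀ s, δ (ι₂ s) = 0 := fun s => by rw [hδt, ← hdb, h2, map_zero]
    refine hTc.tangent_ext trivial fun p => ?_
    rw [map_zero, ← hδt]
    induction p using TensorProduct.induction_on with
    | zero => rw [map_zero]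
    | tmul r s => rw [htmul, hδ, h1', h2', mul_zero, mul_zero, add_zero]
    | add p q hp hq => rw [map_add, hp, hq, add_zero]
  · intro S hS a' b' ha'm hb'm hab σ τ hσa hσb
    classical
    let c : S.Pt → T.Pt := fun ρ =>
      if hρ : ∃ τ', a τ' = a' ρ ∧ b τ' = b' ρ then hρ.choose else τ
    have hc : ∀ ρ, (∃ τ', a τ' = a' ρ ∧ b τ' = b' ρ) → a (c ρ) = a' ρ ∧ b (c ρ) = b' ρ := by
      intro ρ hρ
      simp only [c, dif_pos hρ]
      exact hρ.choose_spec
    have hcσ := hc σ ⟨τ, hσa.symm, hσb.symm⟩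
    have hcτ : c σ = τ := hext _ _ (hcσ.1.trans hσa) (hcσ.2.trans hσb)
    have hev : ∀ᶠ ρ in 𝓝 σ, a (c ρ) = a' ρ ∧ b (c ρ) = b' ρ := by
      filter_upwards [ha'm.1.continuousAt.eventually (hW.isOpen.mem_nhds (hσa ▸ haW τ)),
        hb'm.1.continuousAt.eventually (hV.isOpen.mem_nhds (hσb ▸ hbV τ))] with ρ h1 h2
      exact hc ρ (hpt _ h1 _ h2 (hab ρ))
    refine ⟨c, hcτ, ?_, hev.mono fun _ h => h.1, hev.mono fun _ h => h.2⟩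
    refine (hTc.pullsAt hS (Filter.Eventually.of_forall fun _ => trivial) fun p => ?_).2
    induction p using TensorProduct.induction_on with
    | zero => simpa using const_mem (0 : ℂ)
    | tmul r s =>
      refine S.regAt_congr (mul_mem' (ha'm.2 σ _ (hW.eval_mem (hσa ▸ haW τ) r))
        (hb'm.2 σ _ (hV.eval_mem (hσb ▸ hbV τ) s))) ?_
      filter_upwards [hev] with ρ hρ
      rw [htmul, map_mul, ← ha', ← hb', hρ.1, hρ.2]
      rfl
    | add p q hp hq => simpa only [map_add] using add_mem' hp hq

theorem isSmoothScheme_point : IsSmoothScheme (point.{u} ℂ) := by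
  have : Nonempty (Unique (MaxSpec ℂ)) := ⟨(inferInstance : Unique (ℂ →ₐ[ℂ] ℂ))⟩
  obtain ⟨_⟩ := this
  refine fun _ => ⟨ℂ, _, _, inferInstance,
    (Homeomorph.homeomorphOfUnique PUnit (MaxSpec ℂ)).toOpenPartialHomeomorph, trivial,
    fun y _ f => ⟨fun _ => ⟨f PUnit.unit, 1, by simp, Filter.Eventually.of_forall fun z => ?_⟩,
      fun _ => trivial⟩⟩
  rw [map_one, div_one]
  exact (AlgHom.commutes (MaxSpec.eval _) (f PUnit.unit)).symm

/-- The category of smooth schemes. -/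
theorem isGood_isSmoothScheme : IsGood IsSmoothScheme.{u} where
  charZero := inferInstance
  coord _ hX := hX.hasCoordinates
  point := isSmoothScheme_point
  fiberProduct _ _ _ hX hY hZ _ _ hφ hψ _ _ hxy := hX.fiberProduct hY hZ hφ hψ hxy
  descent _ _ hY hZ _ hψ y _ hf := hY.descent hZ hψ y hf

end FunctionSpace

end AffineFiberProduct

/-! ### The Chern-Weil theorem for Lie groupoids -/

theorem FunctionSpace.SmoothCategory.isGood {C : FunctionSpace.{u} 𝕜 → Prop}
    (hC : SmoothCategory 𝕜 C) : IsGood C := by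
  cases hC with
  | smooth => exact isGood_isSmoothManifold
  | analytic => exact isGood_isComplexManifold
  | algebraic => exact isGood_isSmoothScheme

theorem mainTheorem3 {𝕜 : Type} [Field 𝕜] {C : FunctionSpace.{u} 𝕜 → Prop}
    (hC : SmoothCategory 𝕜 C)
    {X₀ X₁ G E : FunctionSpace.{u} 𝕜} [Group G.Pt] (hG : IsLieGroup C G)
    (𝒳 : LieGroupoid C X₀ X₁) (ℋ : 𝒳.Connection) (hℋ : ℋ.IsFlat)
    (P : PrincipalBundle 𝒳 G E) (D : P.Connection) :
    (∃! K, D.IsCurvature K) ∧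
      ∀ K, D.IsCurvature K →
        ∀ (k : ℕ) (ν : MultilinearMap 𝕜 (fun _ : Fin k => G.LieAlg) 𝕜),
          IsInvariantSymmetric G ν →
            ∃ ω : X₀.FormField (2 * k),
              (∀ (x : X₀.Pt) (p : {p : E.Pt // P.π p = x}) (v : Fin (2 * k) → X₀.Tangent x),
                ω x v = evalPolynomial ν (K x p) v) ∧
              ℋ.IsGroupoidForm ω ∧ IsClosedForm ω := by
  exact hC.isGood.chernWeil hG 𝒳 ℋ P D
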